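/- A degree sequence of length $n$ is $\boldsymbol d_n=(d_{n,1},\dots,d_{n,n})$ with non-negative integers $d_{n,i}<n$ and even sum; it is feasible if it is the degree sequence of some simple graph on $[n]$. Let $n_{n,k}=|\{i\in[n]: d_{n,i}=k\}|$ and let $D_n$ be the distribution on $\{0,1,2,\dots\}$ with $\Pr(D_n=k)=n_{n,k}/n$. Let $\boldsymbol d=(\boldsymbol d_n)_{n\ge 1}$ be a sequence of degree sequences and $D$ a probability distribution on $\{0,1,2,\dots\}$ such that (i) every $\boldsymbol d_n$ is feasible; (ii) $D_n\to D$ in distribution; (iii) $\mathbb E[D]$ and $\mathbb E[D^2]$ are finite, $\mathbb E[D_n]\to\mathbb E[D]$ and $\mathbb E[D_n^2]\to\mathbb E[D^2]$; (iv) if $\Pr(D=k)=0$, then $n_{n,k}=0$ for all $n$. Put $\lambda_k=\Pr(D=k)$, $\rho_1=\mathbb E[D]$, $\rho_2=\mathbb E[D(D-1)]$, assume $\rho_1>0$, and let $\nu=\rho_2/\rho_1$. The configuration model $\mathbb{CM}_n(\boldsymbol d_n)$ is the random multigraph on $[n]$ obtained by attaching $d_{n,v}$ half-edges to each vertex $v$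 and taking a uniformly random perfect matching of all the half-edges; each matched pair becomes an edge (a loop if both half-edges are at the same vertex). Multigraphs are finite and may have loops and multiple edges; a loop counts as one edge and adds two to the degree of its vertex. A connected multigraph is unicyclic if it has as many edges (with multiplicity) as vertices; a fragment is a (possibly empty) disjoint union of unicyclic multigraphs; and $\mathrm{Frag}(G)$ is the union of the unicyclic connected components of $G$. For a multigraph $H$ with $\ell$ loops and edge multiplicities $m(\{u,v\})$, let $\mathrm{aut}(H)$ be the number of vertex permutations that preserve all multiplicities and let $$\mathrm{aut}_{he}(H)=\mathrm{aut}(H)\,2^{\ell}\prod_{\{u,v\}} m(\{u,v\})!,$$ where the product is over all unordered pairs of vertices, $u=v$ included. If $\nu<1$, then for every fragment $H$, $$\lim_{n\to\infty}\Pr\bigl(\mathrm{Frag}(\mathbb{CM}_n(\boldsymbol d_n))\simeq H\bigr)=\frac{\sqrt{1-\nu}}{\mathrm{aut}_{he}(H)}\prod_{i\ge 0}\left(\frac{\lambda_i\, i!}{\rho_1}\right)^{h_i},$$ where $h_i$ is the number of vertices of degree $i$ in $H$. -/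

import Mathlib

open Filter Topology

/-- A multigraph (loops and multiple edges allowed) on a vertex type `V`, always finite below: the
multiset of edges is recorded by the multiplicity of each unordered pair of vertices. -/
structure Multigraph (V : Type*) where
  mult : Sym2 V → ℕ

namespace Multigraph

variable {V W : Type*}

/-- Isomorphisms of multigraphs: bijections of the vertex sets that preserve all multiplicities. -/
def Iso (G : Multigraph V) (H : Multigraph W) : Type _ :=
  {f : V ≃ W // ∀ e : Sym2 V, H.mult (e.map f) = G.mult e}

/-- The sub-multigraph induced on a set of vertices. -/
def induce (G : Multigraph V) (S : Set V) : Multigraph S where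
  mult e := G.mult (e.map Subtype.val)

/-- The simple graph in which two distinct vertices are adjacent when some edge joins them; it has
the same connected components as the multigraph. -/
def skeleton (G : Multigraph V) : SimpleGraph V :=
  SimpleGraph.fromEdgeSet {e | G.mult e ≠ 0}

open Classical in
/-- Number of edges, counted with multiplicity (a loop is one edge). -/
noncomputable def numEdges [Fintype V] (G : Multigraph V) : ℕ :=
  ∑ e : Sym2 V, G.mult e

/-- The excess `|E(G)| - |V(G)|`. -/
noncomputable def excess [Fintype V] (G : Multigraph V) : ℤ :=
  (G.numEdges : ℤ) - (Fintype.card V : ℤ)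

open Classical in
/-- The degree of a vertex: a loop contributes two. -/
noncomputable def degree [Fintype V] (G : Multigraph V) (v : V) : ℕ :=
  (∑ u ∈ Finset.univ.erase v, G.mult s(u, v)) + 2 * G.mult s(v, v)

open Classical in
/-- Number of vertices of degree `i`. -/
noncomputable def degreeCount [Fintype V] (G : Multigraph V) (i : ℕ) : ℕ :=
  (Finset.univ.filter fun v : V => G.degree v = i).card

/-- Unicyclic: connected with excess zero. -/
def IsUnicyclic [Fintype V] (G : Multigraph V) : Prop :=
  G.skeleton.Connected ∧ G.excess = 0

open Classical in
/-- The connected component of `v` in `G` is unicyclic. -/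
def InUnicyclicComponent [Fintype V] (G : Multigraph V) (v : V) : Prop :=
  (G.induce (G.skeleton.connectedComponentMk v).supp).IsUnicyclic

/-- A fragment: a disjoint union of unicyclic components (possibly empty). -/
def IsFragment [Fintype V] (G : Multigraph V) : Prop :=
  ∀ v : V, G.InUnicyclicComponent v

/-- The fragment of a multigraph: the union of its unicyclic components. -/
def frag [Fintype V] (G : Multigraph V) : Multigraph {v : V | G.InUnicyclicComponent v} :=
  G.induce {v : V | G.InUnicyclicComponent v}

/-- The number of automorphisms. -/
noncomputable def aut (G : Multigraph V) : ℕ :=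
  Nat.card (Iso G G)

/-- The number of loops, counted with multiplicity. -/
noncomputable def numLoops [Fintype V] (G : Multigraph V) : ℕ :=
  ∑ v : V, G.mult s(v, v)

open Classical in
/-- The number of half-edge automorphisms `aut(G) · 2^ℓ · ∏_{{u,v}} m({u,v})!`; the product runs
over unordered pairs, `u = v` included. -/
noncomputable def authe [Fintype V] (G : Multigraph V) : ℕ :=
  G.aut * 2 ^ G.numLoops * ∏ e : Sym2 V, (G.mult e).factorial

end Multigraph

/-- The half-edges of the configuration model: `d v` of them at each vertex `v`. -/
abbrev HalfEdge {n : ℕ} (d : Fin n → ℕ) : Type :=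
  (v : Fin n) × Fin (d v)

/-- A perfect matching of a set `X`: a set of pairs of distinct elements such that every element
lies in exactly one of the pairs. -/
def IsPerfectMatchingOn {X : Type*} (M : Finset (Sym2 X)) : Prop :=
  (∀ e ∈ M, ¬ e.IsDiag) ∧ ∀ x : X, ∃! e : Sym2 X, e ∈ M ∧ x ∈ e

open Classical in
/-- All perfect matchings of the half-edges. -/
noncomputable def configurations {n : ℕ} (d : Fin n → ℕ) : Finset (Finset (Sym2 (HalfEdge d))) :=
  Finset.univ.filter fun M => IsPerfectMatchingOn M

open Classical in
/-- The underlying multigraph of a matching of half-edges: each matched pair becomes an edge between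
the vertices to which its two half-edges are incident. -/
noncomputable def underlyingMultigraph {n : ℕ} (d : Fin n → ℕ) (M : Finset (Sym2 (HalfEdge d))) :
    Multigraph (Fin n) where
  mult e := (M.filter fun p => p.map Sigma.fst = e).card

open Classical in
/-- The probability that the configuration model with degrees `d` (the underlying multigraph of a
uniformly random perfect matching of the half-edges) has the property `P`. -/
noncomputable def cmProb {n : ℕ} (d : Fin n → ℕ) (P : Multigraph (Fin n) → Prop) : ℝ :=
  (((configurations d).filter fun M => P (underlyingMultigraph d M)).card : ℝ) /
    ((configurations d).card : ℝ)

open Classical in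
/-- `d` is feasible: it is the degree sequence of a simple graph on `n` vertices. (This forces
`d v < n` for every `v` and an even sum of degrees.) -/
def Feasible {n : ℕ} (d : Fin n → ℕ) : Prop :=
  ∃ G : SimpleGraph (Fin n), ∀ v, G.degree v = d v

/-- The number of vertices of prescribed degree `k`. -/
def vertexCount {n : ℕ} (d : Fin n → ℕ) (k : ℕ) : ℕ :=
  (Finset.univ.filter fun v => d v = k).card

/-- The `r`-th moment of the degree of a uniformly random vertex. -/
noncomputable def empiricalMoment {n : ℕ} (d : Fin n → ℕ) (r : ℕ) : ℝ :=
  (∑ v, (d v : ℝ) ^ r) / (n : ℝ)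

/-- The `r`-th moment of a distribution on the non-negative integers (when it is finite). -/
noncomputable def limitMoment (D : PMF ℕ) (r : ℕ) : ℝ :=
  ∑' k : ℕ, (k : ℝ) ^ r * (D k).toReal

/-- The `r`-th factorial moment `E[D(D-1)⋯(D-r+1)]` (when it is finite). -/
noncomputable def factorialMoment (D : PMF ℕ) (r : ℕ) : ℝ :=
  ∑' k : ℕ, (k.descFactorial r : ℝ) * (D k).toReal

/-- The parameter `ν = E[D(D-1)] / E[D]`. -/
noncomputable def nuParam (D : PMF ℕ) : ℝ :=
  factorialMoment D 2 / factorialMoment D 1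

/-- The standing assumption on a sequence of degree sequences `d` with limiting degree
distribution `D`. -/
structure RegularDegrees (d : (n : ℕ) → Fin n → ℕ) (D : PMF ℕ) : Prop where
  feasible : ∀ n, Feasible (d n)
  /-- The degree distributions converge in distribution to `D`; for laws on the integers this is
  convergence of the point masses. -/
  tendsto_law : ∀ k : ℕ,
    Tendsto (fun n : ℕ => (vertexCount (d n) k : ℝ) / (n : ℝ)) atTop (𝓝 (D k).toReal)
  /-- `D` has a finite second moment (hence a finite mean). -/
  summable_sq : Summable fun k : ℕ => (k : ℝ) ^ 2 * (D k).toReal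
  tendsto_mean : Tendsto (fun n : ℕ => empiricalMoment (d n) 1) atTop (𝓝 (limitMoment D 1))
  tendsto_sq : Tendsto (fun n : ℕ => empiricalMoment (d n) 2) atTop (𝓝 (limitMoment D 2))
  no_rare_degree : ∀ k : ℕ, D k = 0 → ∀ n : ℕ, vertexCount (d n) k = 0

/-! Let M be the number of half-edges and S = Σ d(d-1) the number of ordered pairs of distinct
half-edges at a common vertex, so that S/M tends to ν. Matchings are treated as fixed-point-free
involutions of the half-edges.

The core of the proof is that the probability of having no unicyclic component tends to √(1-ν)
(`exists_not_hasUnicyclic_near`). Both halves of this come from one lower bound,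
`exists_forest_lower`: the multigraph is a forest with probability at least √(1-ν) - ε. There are at
most about S^j/(2j) possible cycles of length j, each present with probability about M^(-j). By a
switching argument, a cycle is not made more likely when cycles on other half-edges are forbidden.
The local lemma for negative dependency graphs then bounds the probability of avoiding all short
cycles below by nearly exp(-Σ ν^j/(2j)), which is at least √(1-ν); long cycles are removed by a
union bound.

A forest has no unicyclic component, which is the lower half. For the upper half, consider the
multigraphs with at least one cycle in which every component has at most one. Let Y be the set of
half-edges on the cycles, at k vertices. There are about S^k/(2^k k!) choices of Y and (2k-1)!!
matchings of Y, and the rest must be a forest once the vertices of Y are contracted to one, which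
again has probability at least √(1-ν) - ε. Different Y give disjoint events, so a unicyclic
component exists with probability at least about √(1-ν) Σ_{k≥1} (2k-1)!! ν^k/(2^k k!) = √(1-ν)
(1/√(1-ν) - 1) = 1 - √(1-ν).

These estimates are uniform over degree sequences near the limiting regime (`IsNearRegime`), a
condition that survives contracting a bounded number of vertices or deleting a bounded number of
edges.

For a fragment H with k vertices, aut(H) times the number of matchings with fragment H is a sum over
embeddings of its vertices (`aut_mul_mcount`). For a degree-preserving embedding the matching splits
into an inner part with multigraph H, with ∏ d! / (2^ℓ ∏ m!) possibilities (`mcount_graph_eq`), and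
an outer part without unicyclic components, a fraction √(1-ν) of all outer matchings in the limit.
There are about n^k ∏ λ such embeddings, and the outer matchings are a fraction about (ρ₁ n)^(-k) of
all matchings, since H has exactly 2k half-edges. -/

namespace ConfigurationModel

open Classical

universe u

/-! ### Counting perfect matchings -/

section

variable {X V : Type*}

/-- A perfect matching of `X`, as a fixed-point-free involution. -/
def IsMatching (m : Equiv.Perm X) : Prop := ∀ x, m (m x) = x ∧ m x ≠ x

/-- The number of perfect matchings of `X` with the property `P`. -/
noncomputable def mcount (P : Equiv.Perm X → Prop) : ℕ :=
  {m : Equiv.Perm X | IsMatching m ∧ P m}.ncard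

theorem mcount_eq_card [Fintype X] (P : Equiv.Perm X → Prop) :
    mcount P = (Finset.univ.filter fun m => IsMatching m ∧ P m).card := by
  rw [mcount, Set.ncard_eq_toFinset_card']
  congr 1
  ext m
  simp

theorem mcount_congr {P Q : Equiv.Perm X → Prop} (h : ∀ m, IsMatching m → (P m ↔ Q m)) :
    mcount P = mcount Q := by
  unfold mcount
  congr 1
  ext m
  exact and_congr_right (h m)

theorem mcount_mono [Finite X] {P Q : Equiv.Perm X → Prop}
    (h : ∀ m, IsMatching m → P m → Q m) : mcount P ≤ mcount Q :=
  Set.ncard_le_ncard (fun m hm => ⟨hm.1, h m hm.1 hm.2⟩) (Set.toFinite _)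

/-- Classification of the matchings with property `P` by the values of a function. -/
theorem mcount_eq_sum [Finite X] {ι : Type*} (s : Finset ι) (g : Equiv.Perm X → ι)
    (P : Equiv.Perm X → Prop) (h : ∀ m, IsMatching m → P m → g m ∈ s) :
    mcount P = ∑ i ∈ s, mcount fun m => P m ∧ g m = i := by
  have := Fintype.ofFinite X
  simp only [mcount_eq_card]
  rw [Finset.card_eq_sum_card_fiberwise (f := g) (t := s)]
  · refine Finset.sum_congr rfl fun i _ => ?_
    rw [Finset.filter_filter]
    congr 1; ext m; simp [and_assoc]
  · intro m hm
    simp only [Finset.coe_filter, Set.mem_ofPred_eq] at hm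
    exact h m hm.2.1 hm.2.2

theorem IsMatching.restrict {m : Equiv.Perm X} (hm : IsMatching m) {p : X → Prop}
    (h : ∀ x, p (m x) ↔ p x) : IsMatching (m.subtypePerm h) := by
  intro x
  refine ⟨Subtype.ext (hm x).1, fun e => (hm x).2 ?_⟩
  exact congrArg Subtype.val e

theorem IsMatching.subtypeCongr {p : X → Prop} {a : Equiv.Perm {x // p x}}
    {b : Equiv.Perm {x // ¬ p x}} (ha : IsMatching a) (hb : IsMatching b) :
    IsMatching (Equiv.Perm.subtypeCongr a b) := by
  intro x
  by_cases hx : p x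
  · rw [Equiv.Perm.subtypeCongr.left_apply _ _ hx, Equiv.Perm.subtypeCongr.left_apply_subtype]
    exact ⟨by rw [(ha _).1], fun e => (ha ⟨x, hx⟩).2 (Subtype.ext e)⟩
  · rw [Equiv.Perm.subtypeCongr.right_apply _ _ hx, Equiv.Perm.subtypeCongr.right_apply_subtype]
    exact ⟨by rw [(hb _).1], fun e => (hb ⟨x, hx⟩).2 (Subtype.ext e)⟩

/-- Matchings preserving `p` are pairs of matchings of the two parts. -/
theorem mcount_split [Finite X] (p : X → Prop) (P : Equiv.Perm {x // p x} → Prop)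
    (Q : Equiv.Perm {x // ¬ p x} → Prop) :
    (mcount fun m : Equiv.Perm X => ∃ h : ∀ x, p (m x) ↔ p x,
      P (m.subtypePerm h) ∧ Q (m.subtypePerm fun x => not_congr (h x))) =
    mcount P * mcount Q := by
  have := Fintype.ofFinite X
  simp only [mcount_eq_card]
  rw [← Finset.card_product]
  symm
  have hl : ∀ (a : Equiv.Perm {x // p x}) (b : Equiv.Perm {x // ¬ p x}),
      ∀ x, p (Equiv.Perm.subtypeCongr a b x) ↔ p x := by
    intro a b x
    by_cases hx : p x
    · rw [Equiv.Perm.subtypeCongr.left_apply _ _ hx]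
      simp [hx, (a ⟨x, hx⟩).2]
    · rw [Equiv.Perm.subtypeCongr.right_apply _ _ hx]
      simp [hx, (b ⟨x, hx⟩).2]
  have ea : ∀ (a : Equiv.Perm {x // p x}) (b : Equiv.Perm {x // ¬ p x}),
      (Equiv.Perm.subtypeCongr a b).subtypePerm (hl a b) = a := by
    intro a b
    ext x
    simp [Equiv.Perm.subtypePerm_apply]
  have eb : ∀ (a : Equiv.Perm {x // p x}) (b : Equiv.Perm {x // ¬ p x}),
      (Equiv.Perm.subtypeCongr a b).subtypePerm (fun x => not_congr (hl a b x)) = b := by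
    intro a b
    ext x
    simp [Equiv.Perm.subtypePerm_apply]
  refine Finset.card_bij (fun ab _ => Equiv.Perm.subtypeCongr ab.1 ab.2) ?_ ?_ ?_
  · rintro ⟨a, b⟩ hab
    simp only [Finset.mem_product, Finset.mem_filter, Finset.mem_univ, true_and] at hab ⊢
    refine ⟨hab.1.1.subtypeCongr hab.2.1, hl a b, ?_, ?_⟩
    · rw [ea]; exact hab.1.2
    · rw [eb]; exact hab.2.2
  · rintro ⟨a, b⟩ _ ⟨a', b'⟩ _ h
    have := Equiv.Perm.subtypeCongrHom_injective p (a₁ := (a, b)) (a₂ := (a', b')) h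
    exact this
  · intro m hm
    simp only [Finset.mem_filter, Finset.mem_univ, true_and] at hm
    obtain ⟨hm, h, hP, hQ⟩ := hm
    refine ⟨(m.subtypePerm h, m.subtypePerm fun x => not_congr (h x)), ?_, ?_⟩
    · simp only [Finset.mem_product, Finset.mem_filter, Finset.mem_univ, true_and]
      exact ⟨⟨hm.restrict h, hP⟩, ⟨hm.restrict _, hQ⟩⟩
    · ext x
      by_cases hx : p x
      · simp [Equiv.Perm.subtypeCongr.left_apply _ _ hx]
      · simp [Equiv.Perm.subtypeCongr.right_apply _ _ hx]

/-- Pairing x with m x cancels the ones modulo 2. In the contraction arguments this parity turns one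
surplus half-edge into two. -/
theorem even_card_of_invariant {m : Equiv.Perm X} (hm : IsMatching m) {Y : Finset X}
    (hY : ∀ x ∈ Y, m x ∈ Y) : Even Y.card := by
  have h : ∑ x ∈ Y, (1 : ZMod 2) = 0 :=
    Finset.sum_involution (fun x _ => m x) (fun _ _ => by decide) (fun x _ _ => (hm x).2)
      (fun x hx => hY x hx) (fun x _ => (hm x).1)
  rw [Finset.sum_const, nsmul_eq_mul, mul_one] at h
  exact (ZMod.natCast_eq_zero_iff_even).1 h

/-- The number of perfect matchings of a set with the given number of elements. -/
def pm : ℕ → ℕ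
  | 0 => 1
  | 1 => 0
  | n + 2 => (n + 1) * pm n

theorem mcount_pair {x y : X} (hxy : x ≠ y) :
    mcount (fun _ : Equiv.Perm {z // z = x ∨ z = y} => True) = 1 := by
  have hsw : ∀ z, (z = x ∨ z = y) ↔ (Equiv.swap x y z = x ∨ Equiv.swap x y z = y) := by
    intro z
    by_cases h1 : z = x
    · simp [h1]
    · by_cases h2 : z = y
      · simp [h2]
      · simp [Equiv.swap_apply_of_ne_of_ne h1 h2]
  rw [mcount, Set.ncard_eq_one]
  refine ⟨(Equiv.swap x y).subtypePerm fun z => (hsw z).symm, ?_⟩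
  ext m
  simp only [Set.mem_ofPred_eq, Set.mem_singleton_iff, and_true]
  constructor
  · intro hm
    ext ⟨z, hz⟩
    have h1 := (m ⟨z, hz⟩).2
    have h2 := (hm ⟨z, hz⟩).2
    have h3 : (m ⟨z, hz⟩ : X) ≠ z := fun e => h2 (Subtype.ext e)
    rcases hz with rfl | rfl <;> simp [Equiv.Perm.subtypePerm_apply] <;> tauto
  · rintro rfl
    intro z
    refine ⟨Subtype.ext (by simp), fun e => ?_⟩
    have e' := congrArg Subtype.val e
    simp only [Equiv.Perm.subtypePerm_apply] at e'
    rcases z.2 with h | h <;> rw [h] at e' <;> simp [hxy, hxy.symm] at e'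

theorem IsMatching.pair_iff {m : Equiv.Perm X} (hm : IsMatching m) {x y : X} (h : m x = y) (z : X) :
    (m z = x ∨ m z = y) ↔ (z = x ∨ z = y) := by
  have h' : m y = x := by rw [← h, (hm x).1]
  constructor
  · rintro (e | e)
    · right; apply m.injective; rw [e, h']
    · left; apply m.injective; rw [e, h]
  · rintro (rfl | rfl)
    · exact Or.inr h
    · exact Or.inl h'

/-- Matchings in which `x` is matched to `y`. -/
theorem mcount_apply_eq [Finite X] {x y : X} (hxy : x ≠ y)
    (Q : Equiv.Perm {z // ¬ (z = x ∨ z = y)} → Prop) :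
    (mcount fun m : Equiv.Perm X => m x = y ∧ ∃ h : ∀ z, (m z = x ∨ m z = y) ↔ (z = x ∨ z = y),
      Q (m.subtypePerm fun z => not_congr (h z))) = mcount Q := by
  have := mcount_split (fun z => z = x ∨ z = y) (fun _ => True) Q
  rw [mcount_pair hxy, one_mul] at this
  rw [← this]
  refine mcount_congr fun m hm => ?_
  constructor
  · rintro ⟨_, h, hQ⟩
    exact ⟨h, trivial, hQ⟩
  · rintro ⟨h, _, hQ⟩
    exact ⟨((h x).2 (Or.inl rfl)).resolve_left (hm x).2, h, hQ⟩

theorem card_compl_pair [Finite X] {x y : X} (hxy : x ≠ y) :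
    Nat.card {z // ¬ (z = x ∨ z = y)} + 2 = Nat.card X := by
  have := Fintype.ofFinite X
  simp only [Nat.card_eq_fintype_card]
  have h := Fintype.card_subtype_compl (fun z => z = x ∨ z = y)
  have h2 : Fintype.card {z // z = x ∨ z = y} = 2 := by
    rw [Fintype.card_subtype]
    have : (Finset.univ.filter fun z => z = x ∨ z = y) = {x, y} := by
      ext; simp
    rw [this, Finset.card_pair hxy]
  have h3 := Fintype.card_subtype_le (fun z => z = x ∨ z = y)
  omega

/-- Condition on the partner of a fixed element: each choice leaves a matching of two elements
fewer. The type is quantified inside the induction because deleting a pair changes it. -/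
theorem mcount_true_aux (n : ℕ) : ∀ (X : Type u) [Finite X], Nat.card X = n →
    mcount (fun _ : Equiv.Perm X => True) = pm n := by
  induction n using Nat.strong_induction_on with
  | _ n ih =>
    intro X _ hX
    match n, ih, hX with
    | 0, _, hX =>
      have := (Nat.card_eq_zero.1 hX).resolve_right (fun h => h.not_finite inferInstance)
      rw [pm, mcount, Set.ncard_eq_one]
      refine ⟨1, ?_⟩
      ext m
      simp only [Set.mem_ofPred_eq, Set.mem_singleton_iff, and_true]
      exact ⟨fun _ => Subsingleton.elim _ _, fun _ x => (IsEmpty.false x).elim⟩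
    | 1, _, hX =>
      rw [pm, mcount, Set.ncard_eq_zero]
      obtain ⟨hs, ⟨x⟩⟩ := Nat.card_eq_one_iff_unique.1 hX
      exact Set.eq_empty_of_forall_notMem fun m hm => (hm.1 x).2 (Subsingleton.elim _ _)
    | n + 2, ih, hX =>
      have : Nonempty X := (Nat.card_pos_iff.1 (by omega)).1
      obtain ⟨x⟩ := this
      have := Fintype.ofFinite X
      rw [mcount_eq_sum (Finset.univ.erase x) (fun m => m x), Finset.sum_congr rfl
        (g := fun _ => pm n), Finset.sum_const, Finset.card_erase_of_mem (Finset.mem_univ _),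
        Finset.card_univ, ← Nat.card_eq_fintype_card, hX]
      · simp [pm]
      · intro y hy
        have hxy : x ≠ y := (Finset.ne_of_mem_erase hy).symm
        have h2 := mcount_apply_eq hxy (fun _ => True)
        have h3 := card_compl_pair hxy
        rw [ih n (by omega) _ (by omega)] at h2
        rw [← h2]
        exact mcount_congr fun m hm => ⟨fun h => ⟨h.2, hm.pair_iff h.2, trivial⟩,
          fun h => ⟨trivial, h.1⟩⟩
      · intro m hm _
        simp [(hm x).2]

theorem mcount_true [Finite X] : mcount (fun _ : Equiv.Perm X => True) = pm (Nat.card X) :=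
  mcount_true_aux _ X rfl

theorem pm_pos_of_even : ∀ {n : ℕ}, Even n → 0 < pm n := by
  intro n
  induction n using Nat.strong_induction_on with
  | _ n ih =>
    intro hn
    match n, ih, hn with
    | 0, _, _ => simp [pm]
    | 1, _, hn => simp at hn
    | n + 2, ih, hn =>
      rw [pm]
      exact Nat.mul_pos (by omega) (ih n (by omega) (by simpa [parity_simps] using hn))

end

/-! ### Cores, components and unicyclic parts -/

section

variable {X V : Type*}

/-- The multigraph of the matching contains a nonempty subgraph of minimum degree two; equivalently
it is not a forest. -/
def HasCore (f : X → V) (m : Equiv.Perm X) : Prop :=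
  ∃ Y : Set X, Y.Nonempty ∧ (∀ x ∈ Y, m x ∈ Y) ∧ ∀ x ∈ Y, ∃ y ∈ Y, y ≠ x ∧ f y = f x

/-- The half-edges of the subgraph induced on `S`. -/
def inner (f : X → V) (m : Equiv.Perm X) (S : Finset V) : Set X :=
  {x | f x ∈ S ∧ f (m x) ∈ S}

/-- No edge leaves `S`. -/
def IsClosedSet (f : X → V) (m : Equiv.Perm X) (S : Finset V) : Prop :=
  ∀ x, f x ∈ S → f (m x) ∈ S

/-- `S` is the vertex set of a connected component. -/
structure IsComponent (f : X → V) (m : Equiv.Perm X) (S : Finset V) : Prop where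
  nonempty : S.Nonempty
  closed : IsClosedSet f m S
  minimal : ∀ T ⊆ S, T.Nonempty → IsClosedSet f m T → T = S

/-- `S` is the vertex set of a unicyclic component. -/
structure IsUnicyclicPart (f : X → V) (m : Equiv.Perm X) (S : Finset V) : Prop
    extends IsComponent f m S where
  card : {x | f x ∈ S}.ncard = 2 * S.card

/-- Some component is unicyclic. -/
def HasUnicyclic (f : X → V) (m : Equiv.Perm X) : Prop := ∃ S, IsUnicyclicPart f m S

theorem IsClosedSet.inner_eq {f : X → V} {m : Equiv.Perm X} {S : Finset V}
    (h : IsClosedSet f m S) : inner f m S = {x | f x ∈ S} := by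
  ext x
  exact ⟨fun hx => hx.1, fun hx => ⟨hx, h x hx⟩⟩

/-- At least as many edges as vertices forces a cycle, by pruning leaves: deleting a vertex with one
half-edge costs one vertex and at most one edge, so the inequality persists until every remaining
half-edge has a companion at its vertex. -/
theorem hasCore_of_card_le [Finite X] {f : X → V} {m : Equiv.Perm X} (hm : IsMatching m) :
    ∀ (n : ℕ) (S : Finset V), S.card = n → S.Nonempty → 2 * S.card ≤ (inner f m S).ncard →
      HasCore f m := by
  intro n
  induction n with
  | zero => intro S hS hne; simp [Finset.card_eq_zero.1 hS] at hne
  | succ n ih =>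
    intro S hS hne hcard
    by_cases hY : ∀ x ∈ inner f m S, ∃ y ∈ inner f m S, y ≠ x ∧ f y = f x
    · refine ⟨inner f m S, ?_, fun x hx => ⟨hx.2, ?_⟩, hY⟩
      · apply Set.nonempty_of_ncard_ne_zero
        omega
      · rw [(hm x).1]; exact hx.1
    · push Not at hY
      obtain ⟨x, hx, hxy⟩ := hY
      have hu : ∀ y ∈ inner f m S, f y = f x → y = x := fun y hy e => by
        by_contra h
        exact hxy y hy h e
      have hinv : ∀ z ∈ inner f m S, m z ∈ inner f m S := fun z hz =>
        ⟨hz.2, by rw [(hm z).1]; exact hz.1⟩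
      have hsub : inner f m S \ {x, m x} ⊆ inner f m (S.erase (f x)) := by
        rintro z ⟨hz, hz'⟩
        simp only [Set.mem_insert_iff, Set.mem_singleton_iff, not_or] at hz'
        refine ⟨Finset.mem_erase.2 ⟨fun e => hz'.1 (hu z hz e), hz.1⟩,
          Finset.mem_erase.2 ⟨fun e => hz'.2 ?_, hz.2⟩⟩
        rw [← hu _ (hinv z hz) e, (hm z).1]
      have h1 : (inner f m S).ncard ≤ (inner f m (S.erase (f x))).ncard + 2 := by
        have a := Set.ncard_le_ncard hsub (Set.toFinite _)
        have b := Set.le_ncard_sdiff ({x, m x} : Set X) (inner f m S) (Set.toFinite _)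
        have c := Set.ncard_pair (hm x).2.symm
        omega
      have h2 : (S.erase (f x)).card = n := by
        rw [Finset.card_erase_of_mem hx.1, hS]; rfl
      refine ih _ h2 ?_ (by omega)
      -- If no vertex were left, the edge of `x` would be a loop and `m x` a second half-edge at `f
      -- x`.
      by_contra hem
      rw [Finset.not_nonempty_iff_eq_empty] at hem
      have h3 : f (m x) = f x := by
        by_contra h3
        have : f (m x) ∈ S.erase (f x) := Finset.mem_erase.2 ⟨h3, hx.2⟩
        rw [hem] at this
        simp at this
      exact (hm x).2 (hu _ (hinv x hx) h3)

/-- Forests therefore have no unicyclic component, which yields the lower half of the main estimate.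
-/
theorem HasUnicyclic.hasCore [Finite X] {f : X → V} {m : Equiv.Perm X} (hm : IsMatching m)
    (h : HasUnicyclic f m) : HasCore f m := by
  obtain ⟨S, hS⟩ := h
  refine hasCore_of_card_le hm _ S rfl hS.nonempty ?_
  rw [hS.closed.inner_eq, hS.card]

/-- In a connected graph, adding vertices one at a time adds at least as many edges. -/
theorem IsComponent.card_le [Finite X] {f : X → V} {m : Equiv.Perm X} (hm : IsMatching m)
    {S : Finset V} (hS : IsComponent f m S) : ∀ (n : ℕ) (T : Finset V), T ⊆ S →
      S.card - T.card = n → T.Nonempty → 2 * T.card ≤ (inner f m T).ncard →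
      2 * S.card ≤ {x | f x ∈ S}.ncard := by
  intro n
  induction n with
  | zero =>
    intro T hTS hn _ hT
    have : T = S := Finset.eq_of_subset_of_card_le hTS (by omega)
    subst this
    rwa [hS.closed.inner_eq] at hT
  | succ n ih =>
    intro T hTS hn hne hT
    have hnc : ¬ IsClosedSet f m T := fun h => by
      have := hS.minimal T hTS hne h
      subst this
      omega
    unfold IsClosedSet at hnc
    push Not at hnc
    obtain ⟨x, hx, hmx⟩ := hnc
    have hc : (insert (f (m x)) T).card = T.card + 1 := Finset.card_insert_of_notMem hmx
    refine ih (insert (f (m x)) T) ?_ (by omega) (Finset.insert_nonempty _ _) ?_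
    · exact Finset.insert_subset (hS.closed x (hTS hx)) hTS
    · have hsub : insert x (insert (m x) (inner f m T)) ⊆ inner f m (insert (f (m x)) T) := by
        rintro z (rfl | rfl | hz)
        · exact ⟨Finset.mem_insert_of_mem hx, Finset.mem_insert_self _ _⟩
        · refine ⟨Finset.mem_insert_self _ _, ?_⟩
          rw [(hm x).1]
          exact Finset.mem_insert_of_mem hx
        · exact ⟨Finset.mem_insert_of_mem hz.1, Finset.mem_insert_of_mem hz.2⟩
      have a := Set.ncard_le_ncard hsub (Set.toFinite _)
      rw [Set.ncard_insert_of_notMem, Set.ncard_insert_of_notMem] at a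
      · omega
      · exact fun h => hmx h.1
      · rintro (h | h)
        · exact (hm x).2 h.symm
        · exact hmx h.2

/-- A smallest closed set containing `v` works: a proper closed subset either contains `v` or has a
smaller closed complement that does. -/
theorem exists_isComponent [Finite V] {f : X → V} {m : Equiv.Perm X} (hm : IsMatching m) (v : V) :
    ∃ S, v ∈ S ∧ IsComponent f m S := by
  have := Fintype.ofFinite V
  obtain ⟨S, hS, hmin⟩ := Finset.exists_min_image
    (Finset.univ.filter fun S : Finset V => v ∈ S ∧ IsClosedSet f m S) Finset.card
    ⟨Finset.univ, Finset.mem_filter.2 ⟨Finset.mem_univ _, Finset.mem_univ _,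
      fun _ _ => Finset.mem_univ _⟩⟩
  simp only [Finset.mem_filter, Finset.mem_univ, true_and] at hS hmin
  refine ⟨S, hS.1, ⟨v, hS.1⟩, hS.2, fun T hT hne hcl => ?_⟩
  by_cases hv : v ∈ T
  · exact Finset.eq_of_subset_of_card_le hT (hmin T ⟨hv, hcl⟩)
  · exfalso
    have h1 := hmin (S \ T) ⟨Finset.mem_sdiff.2 ⟨hS.1, hv⟩, fun x hx => by
      rw [Finset.mem_sdiff] at hx ⊢
      refine ⟨hS.2 x hx.1, fun h => hx.2 ?_⟩
      have := hcl _ h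
      rwa [(hm x).1] at this⟩
    have h2 := Finset.card_sdiff_add_card_eq_card hT
    have h3 := hne.card_pos
    omega

theorem IsComponent.eq_of_mem {f : X → V} {m : Equiv.Perm X} {S T : Finset V}
    (hS : IsComponent f m S) (hT : IsComponent f m T) {v : V} (h1 : v ∈ S) (h2 : v ∈ T) :
    S = T := by
  have hne : (S ∩ T).Nonempty := ⟨v, Finset.mem_inter.2 ⟨h1, h2⟩⟩
  have hcl : IsClosedSet f m (S ∩ T) := fun x hx => by
    rw [Finset.mem_inter] at hx ⊢
    exact ⟨hS.closed x hx.1, hT.closed x hx.2⟩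
  rw [← hS.minimal _ Finset.inter_subset_left hne hcl,
    hT.minimal _ Finset.inter_subset_right hne hcl]

/-! ### Two-regular sets of half-edges and contraction -/

/-- Every vertex has none or exactly two of the half-edges in `Y`. -/
def IsTwoRegular (f : X → V) (Y : Finset X) : Prop :=
  ∀ x ∈ Y, (Y.filter fun y => f y = f x).card = 2

theorem IsTwoRegular.card_eq {f : X → V} {Y : Finset X} (h : IsTwoRegular f Y) :
    Y.card = 2 * (Y.image f).card := by
  rw [Finset.card_eq_sum_card_image f Y, Finset.sum_congr rfl (g := fun _ => 2),
    Finset.sum_const, smul_eq_mul, mul_comm]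
  intro v hv
  obtain ⟨x, hx, rfl⟩ := Finset.mem_image.1 hv
  exact h x hx

theorem IsTwoRegular.filter {f : X → V} {Y : Finset X} (h : IsTwoRegular f Y) (p : V → Prop)
    [DecidablePred fun x => p (f x)] : IsTwoRegular f (Y.filter fun x => p (f x)) := by
  intro x hx
  rw [Finset.mem_filter] at hx
  rw [← h x hx.1, Finset.filter_filter]
  congr 1
  refine Finset.filter_congr fun y _ => ⟨fun h => h.2, fun h => ⟨?_, h⟩⟩
  rw [h]; exact hx.2

/-- The incidence map after deletion of the half-edges in `Y` and contraction of all the vertices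
that they touch to the vertex `v`. -/
noncomputable def contract (f : X → V) (Y : Finset X) (v : V) : {x // ¬ x ∈ Y} → V :=
  fun x => if f x ∈ Y.image f then v else f x

/-- The half-edges of `Y'` outside `Y` form a core. Those at vertices untouched by `Y` keep their
companions. At the contracted vertex the only danger is a single half-edge, but then `Y' \ Y` would
have odd size, although `m` preserves it. Consequently two different unions of cycles cannot both
leave a forest after contraction. -/
theorem hasCore_contract {f : X → V} {m : Equiv.Perm X} (hm : IsMatching m) {Y Y' : Finset X}
    (v : V) (hY' : IsTwoRegular f Y')
    (h : ∀ x, m x ∈ Y ↔ x ∈ Y) (h' : ∀ x, m x ∈ Y' ↔ x ∈ Y') (hne : ¬ Y' ⊆ Y) :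
    HasCore (contract f Y v) (m.subtypePerm fun x => not_congr (h x)) := by
  obtain ⟨x, hx', hx⟩ := Finset.not_subset.1 hne
  refine ⟨{z | z.1 ∈ Y'}, ⟨⟨x, hx⟩, hx'⟩, fun z hz => (h' z.1).2 hz, ?_⟩
  rintro ⟨z, hz⟩ hz'
  simp only [Set.mem_ofPred_eq] at hz'
  by_cases hzY : f z ∈ Y.image f
  · by_contra hno
    push Not at hno
    have hW := (hY'.filter fun v => v ∉ Y.image f).card_eq
    have hE : Even (Y' \ Y).card := even_card_of_invariant hm fun w hw => by
      rw [Finset.mem_sdiff] at hw ⊢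
      rwa [h, h']
    have heq : Y' \ Y = insert z (Y'.filter fun x => f x ∉ Y.image f) := by
      ext w
      simp only [Finset.mem_sdiff, Finset.mem_insert, Finset.mem_filter]
      constructor
      · rintro ⟨hw1, hw2⟩
        by_cases hwY : f w ∈ Y.image f
        · left
          by_contra hwz
          refine hno ⟨w, hw2⟩ hw1 (fun e => hwz (congrArg Subtype.val e)) ?_
          simp only [contract, hwY, hzY, if_true]
        · exact Or.inr ⟨hw1, hwY⟩
      · rintro (rfl | ⟨hw1, hw2⟩)
        · exact ⟨hz', hz⟩
        · exact ⟨hw1, fun h => hw2 (Finset.mem_image_of_mem f h)⟩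
    have hzn : z ∉ Y'.filter fun x => f x ∉ Y.image f := fun h => (Finset.mem_filter.1 h).2 hzY
    rw [heq, Finset.card_insert_of_notMem hzn, hW] at hE
    revert hE
    simp [parity_simps]
  · have h2 := hY' z hz'
    have : ∃ y ∈ Y'.filter fun y => f y = f z, y ≠ z :=
      Finset.exists_mem_ne (by omega) z
    obtain ⟨y, hy, hyz⟩ := this
    rw [Finset.mem_filter] at hy
    have hyY : y ∉ Y := fun h => hzY (hy.2 ▸ Finset.mem_image_of_mem f h)
    refine ⟨⟨y, hyY⟩, hy.1, fun e => hyz (congrArg Subtype.val e), ?_⟩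
    simp only [contract, hy.2]

/-- The component of a vertex of `Y` contains a cycle, so it has at least as many edges as vertices.
With a surplus edge, contracting the vertices of its cycles would still leave at least as many edges
as vertices, hence a core. -/
theorem IsTwoRegular.hasUnicyclic [Finite X] [Finite V] {f : X → V} {m : Equiv.Perm X}
    (hm : IsMatching m) {Y : Finset X} (hY : IsTwoRegular f Y) {x₀ : X} (hx₀ : x₀ ∈ Y)
    (h : ∀ x, m x ∈ Y ↔ x ∈ Y)
    (hno : ¬ HasCore (contract f Y (f x₀)) (m.subtypePerm fun x => not_congr (h x))) :
    HasUnicyclic f m := by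
  obtain ⟨S, hvS, hS⟩ := exists_isComponent (f := f) hm (f x₀)
  refine ⟨S, hS, ?_⟩
  set Z := Y.filter fun x => f x ∈ S with hZ
  have hZr : IsTwoRegular f Z := hY.filter fun v => v ∈ S
  have hZc := hZr.card_eq
  have hZS : Z.image f ⊆ S := by
    intro v hv
    obtain ⟨x, hx, rfl⟩ := Finset.mem_image.1 hv
    exact (Finset.mem_filter.1 hx).2
  have hx₀Z : x₀ ∈ Z := Finset.mem_filter.2 ⟨hx₀, hvS⟩
  have hlow : 2 * S.card ≤ {x | f x ∈ S}.ncard := by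
    refine hS.card_le hm _ (Z.image f) hZS rfl ⟨f x₀, Finset.mem_image_of_mem f hx₀Z⟩ ?_
    rw [← hZc, ← Set.ncard_coe_finset]
    refine Set.ncard_le_ncard (fun x hx => ?_) (Set.toFinite _)
    have hx := Finset.mem_coe.1 hx
    refine ⟨Finset.mem_image_of_mem f hx, Finset.mem_image_of_mem f ?_⟩
    rw [hZ, Finset.mem_filter] at hx ⊢
    exact ⟨(h x).2 hx.1, hS.closed x hx.2⟩
  refine le_antisymm ?_ hlow
  by_contra hlt
  push Not at hlt
  have := Fintype.ofFinite X
  have heven : Even {x | f x ∈ S}.ncard := by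
    rw [Set.ncard_eq_toFinset_card']
    exact even_card_of_invariant hm fun x hx => by
      simp only [Set.mem_toFinset, Set.mem_ofPred_eq] at hx ⊢
      exact hS.closed x hx
  have hge : 2 * S.card + 2 ≤ {x | f x ∈ S}.ncard := by
    obtain ⟨c, hc⟩ := heven
    omega
  refine hno ?_
  -- `S'` is the component after contraction. It has `|S| - |f(Z)| + 1` vertices, and at least `2|S|
  -- + 2 - 2|f(Z)|` half-edges remain in it, which is twice as many.
  set S' := insert (f x₀) (S \ Z.image f) with hS'
  have hS'c : S'.card + (Z.image f).card = S.card + 1 := by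
    have h1 : f x₀ ∉ S \ Z.image f := fun h =>
      (Finset.mem_sdiff.1 h).2 (Finset.mem_image_of_mem f hx₀Z)
    have h2 := Finset.card_sdiff_add_card_eq_card hZS
    rw [hS', Finset.card_insert_of_notMem h1]
    omega
  refine hasCore_of_card_le (hm.restrict fun x => not_congr (h x)) _ S' rfl
    (Finset.insert_nonempty _ _) ?_
  have hcon : ∀ x : {x // ¬ x ∈ Y}, f x ∈ S → contract f Y (f x₀) x ∈ S' := by
    intro x hx
    unfold contract
    split_ifs with hxY
    · exact Finset.mem_insert_self _ _
    · refine Finset.mem_insert_of_mem (Finset.mem_sdiff.2 ⟨hx, fun h => hxY ?_⟩)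
      exact Finset.image_subset_image (Finset.filter_subset _ _) h
  have hsub : {x : {x // ¬ x ∈ Y} | f x ∈ S} ⊆
      inner (contract f Y (f x₀)) (m.subtypePerm fun x => not_congr (h x)) S' :=
    fun x hx => ⟨hcon x hx, hcon _ (hS.closed _ hx)⟩
  refine le_trans ?_ (Set.ncard_le_ncard hsub (Set.toFinite _))
  have himg : (Subtype.val '' {x : {x // ¬ x ∈ Y} | f x ∈ S}) = {x | f x ∈ S} \ (Z : Set X) := by
    ext x
    simp only [Set.mem_image, Set.mem_ofPred_eq, Subtype.exists, Set.mem_sdiff, Finset.mem_coe,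
      hZ, Finset.mem_filter]
    constructor
    · rintro ⟨a, ha, haS, rfl⟩
      exact ⟨haS, fun h => ha h.1⟩
    · rintro ⟨ha, hb⟩
      exact ⟨x, fun h => hb ⟨h, ha⟩, ha, rfl⟩
  rw [← Set.ncard_image_of_injective _ Subtype.val_injective, himg]
  have hd := Set.le_ncard_sdiff (Z : Set X) {x | f x ∈ S} (Set.toFinite _)
  rw [Set.ncard_coe_finset] at hd
  omega

end

/-! ### Cyclic sequences of half-edges -/

section

variable {X V : Type*}

/-- A sequence of pairs of distinct half-edges, each at one vertex, at pairwise distinct vertices. -/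
structure IsPairSeq (f : X → V) {n : ℕ} (s : Fin n → X × X) : Prop where
  vtx : ∀ j, f (s j).1 = f (s j).2
  ne : ∀ j, (s j).1 ≠ (s j).2
  inj : Function.Injective fun j => f (s j).1

/-- The matching contains the cycle that enters and leaves its vertices by the given pairs. -/
def Follows (m : Equiv.Perm X) {k : ℕ} (s : Fin (k + 1) → X × X) : Prop :=
  ∀ j, m (s j).2 = (s (j + 1)).1

/-- Walk inside the core, leaving each vertex by a half-edge other than the one of arrival, until a
vertex repeats; the first repetition closes a cycle. -/
theorem HasCore.exists_follows [Finite X] {f : X → V} {m : Equiv.Perm X} (hm : IsMatching m)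
    (h : HasCore f m) : ∃ (k : ℕ) (s : Fin (k + 1) → X × X), IsPairSeq f s ∧ Follows m s := by
  obtain ⟨Y, ⟨x₀, hx₀⟩, hinv, hoth⟩ := h
  choose! o ho1 ho2 ho3 using hoth
  let x : ℕ → X := fun t => (fun z => o (m z))^[t] x₀
  have hxs : ∀ t, x (t + 1) = o (m (x t)) := fun t => Function.iterate_succ_apply' _ _ _
  have hxY : ∀ t, x t ∈ Y := by
    intro t
    induction t with
    | zero => exact hx₀
    | succ t ih => rw [hxs]; exact ho1 _ (hinv _ ih)
  have hv : ∀ t, f (x (t + 1)) = f (m (x t)) := fun t => by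
    rw [hxs]; exact ho3 _ (hinv _ (hxY t))
  have hex : ∃ j, ∃ i < j, f (x i) = f (x j) := by
    obtain ⟨a, b, hab, e⟩ := Finite.exists_ne_map_eq_of_infinite x
    rcases lt_or_gt_of_ne hab with h | h
    · exact ⟨b, a, h, by rw [e]⟩
    · exact ⟨a, b, h, by rw [e]⟩
  obtain ⟨i, hij, hwij⟩ := Nat.find_spec hex
  set j := Nat.find hex with hj
  have hinj : ∀ a < j, ∀ b < j, f (x a) = f (x b) → a = b := by
    intro a ha b hb e
    rcases lt_trichotomy a b with h | h | h
    · exact absurd ⟨a, h, e⟩ (Nat.find_min hex hb)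
    · exact h
    · exact absurd ⟨b, h, e.symm⟩ (Nat.find_min hex ha)
  obtain ⟨k, hk⟩ : ∃ k, j = i + k + 1 := ⟨j - i - 1, by omega⟩
  clear_value j
  have hnext : ∀ t : Fin (k + 1), f (x (i + (t + 1 : Fin (k + 1)).val)) = f (m (x (i + t.val))) := by
    intro t
    rw [Fin.val_add_one]
    split_ifs with ht
    · rw [ht, Fin.val_last, ← hv, Nat.add_zero, hwij, hk]
    · rw [← hv, Nat.add_assoc]
  -- The half-edges of arrival and departure differ by the choice of `o`, except perhaps where the
  -- cycle closes. Equality there would force `k = 0`, a fixed point of `m`, or `k = 1`, where the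
  -- walk would return along the edge just used.
  have hne : ∀ t : Fin (k + 1), m (x (i + t.val)) ≠ x (i + (t + 1 : Fin (k + 1)).val) := by
    intro t
    rw [Fin.val_add_one]
    split_ifs with ht
    · rw [ht, Fin.val_last, Nat.add_zero]
      intro e
      rcases Nat.eq_zero_or_pos k with rfl | hkpos
      · exact (hm _).2 e
      · have e2 : x (i + k) = m (x i) := by rw [← e, (hm _).1]
        have e3 := hv i
        rw [← e2] at e3
        have e4 := hinj _ (by omega) _ (by omega) e3
        have e5 := hxs i
        rw [← e2, e4] at e5
        exact ho2 _ (hxY _) e5.symm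
    · rw [← Nat.add_assoc, hxs]
      exact (ho2 _ (hinv _ (hxY _))).symm
  -- Each pair lists the half-edge of arrival and that of departure; subtraction in `Fin (k + 1)` is
  -- cyclic.
  refine ⟨k, fun t => (m (x (i + (t - 1 : Fin (k + 1)).val)), x (i + t.val)), ⟨?_, ?_, ?_⟩, ?_⟩
  · intro t
    have := hnext (t - 1)
    rw [sub_add_cancel] at this
    exact this.symm
  · intro t
    have := hne (t - 1)
    rw [sub_add_cancel] at this
    exact this
  · intro t t' e
    have h1 := hnext (t - 1)
    have h2 := hnext (t' - 1)
    rw [sub_add_cancel] at h1 h2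
    simp only at e
    rw [← h1, ← h2] at e
    have := hinj _ (by omega) _ (by omega) e
    exact Fin.ext (by omega)
  · intro t
    simp only [add_sub_cancel_right]

theorem IsPairSeq.eq_of_fst {f : X → V} {n : ℕ} {s : Fin n → X × X} (hs : IsPairSeq f s)
    {i j : Fin n} (h : (s i).1 = (s j).1) : i = j := hs.inj (by simp only [h])

theorem IsPairSeq.eq_of_snd {f : X → V} {n : ℕ} {s : Fin n → X × X} (hs : IsPairSeq f s)
    {i j : Fin n} (h : (s i).2 = (s j).2) : i = j := hs.inj (by simp only [hs.vtx, h])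

theorem IsPairSeq.fst_ne_snd {f : X → V} {n : ℕ} {s : Fin n → X × X} (hs : IsPairSeq f s)
    (i j : Fin n) : (s i).1 ≠ (s j).2 := by
  intro h
  have hij : i = j := hs.inj (by simp only [h, hs.vtx])
  subst hij
  exact hs.ne i h

theorem IsPairSeq.rotate {f : X → V} {k : ℕ} {s : Fin (k + 1) → X × X} (hs : IsPairSeq f s)
    (r : Fin (k + 1)) : IsPairSeq f fun j => s (j + r) :=
  ⟨fun _ => hs.vtx _, fun _ => hs.ne _, fun _ _ e => add_right_cancel (hs.inj e)⟩

theorem IsPairSeq.reverse {f : X → V} {k : ℕ} {s : Fin (k + 1) → X × X} (hs : IsPairSeq f s)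
    (r : Fin (k + 1)) : IsPairSeq f fun j => (s (r - j)).swap := by
  refine ⟨fun j => (hs.vtx _).symm, fun j => (hs.ne _).symm, fun i j e => ?_⟩
  simp only [Prod.fst_swap, ← hs.vtx] at e
  exact sub_right_injective (hs.inj e)

theorem Follows.rotate_iff {m : Equiv.Perm X} {k : ℕ} {s : Fin (k + 1) → X × X}
    (r : Fin (k + 1)) : Follows m (fun j => s (j + r)) ↔ Follows m s := by
  constructor
  · intro h j
    have := h (j - r)
    simp only [sub_add_cancel] at this
    rw [this]
    congr 2
    abel
  · intro h j
    simp only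
    rw [h]
    congr 2
    abel

theorem Follows.reverse_iff {m : Equiv.Perm X} (hm : IsMatching m) {k : ℕ}
    {s : Fin (k + 1) → X × X} (r : Fin (k + 1)) :
    Follows m (fun j => (s (r - j)).swap) ↔ Follows m s := by
  constructor
  · intro h j
    have := h (r - (j + 1))
    simp only [Prod.snd_swap, Prod.fst_swap] at this
    have e1 : r - (r - (j + 1)) = j + 1 := by abel
    have e2 : r - (r - (j + 1) + 1) = j := by abel
    rw [e1, e2] at this
    rw [← this, (hm _).1]
  · intro h j
    have := h (r - (j + 1))
    have e1 : r - (j + 1) + 1 = r - j := by abel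
    rw [e1] at this
    simp only [Prod.snd_swap, Prod.fst_swap]
    rw [← this, (hm _).1]

/-! ### Counting the possible cycles -/

section Counting

variable [Fintype X]

/-- The sequences of `n` pairs. -/
noncomputable def pairSeqs (f : X → V) (n : ℕ) : Finset (Fin n → X × X) :=
  Finset.univ.filter fun s => IsPairSeq f s

/-- The ordered pairs of distinct half-edges at one vertex. -/
noncomputable def pairs (f : X → V) : Finset (X × X) :=
  Finset.univ.filter fun p => f p.1 = f p.2 ∧ p.1 ≠ p.2

theorem mem_pairSeqs {f : X → V} {n : ℕ} {s : Fin n → X × X} :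
    s ∈ pairSeqs f n ↔ IsPairSeq f s := by simp [pairSeqs]

theorem mem_pairs {f : X → V} {p : X × X} : p ∈ pairs f ↔ f p.1 = f p.2 ∧ p.1 ≠ p.2 := by
  simp [pairs]

/-- Every used vertex excludes at least its own pair in both orders. -/
theorem card_filter_pairs_le {f : X → V} {n : ℕ} {s : Fin n → X × X} (hs : IsPairSeq f s) :
    ((pairs f).filter fun p => ∀ j, f p.1 ≠ f (s j).1).card ≤ (pairs f).card - 2 * n := by
  have h1 : ((pairs f).filter fun p => ∀ j, f p.1 ≠ f (s j).1).card +
      ((pairs f).filter fun p => ¬ ∀ j, f p.1 ≠ f (s j).1).card = (pairs f).card :=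
    Finset.card_filter_add_card_filter_not _
  have h2 : 2 * n ≤ ((pairs f).filter fun p => ¬ ∀ j, f p.1 ≠ f (s j).1).card := by
    have hc : (Finset.univ : Finset (Fin n × Bool)).card = 2 * n := by
      simp [Finset.card_univ, mul_comm]
    rw [← hc]
    refine Finset.card_le_card_of_injOn
      (fun jb => if jb.2 then ((s jb.1).2, (s jb.1).1) else s jb.1) ?_ ?_
    · rintro ⟨j, b⟩ _
      rw [Finset.mem_coe, Finset.mem_filter, mem_pairs]
      push Not
      cases b
      · exact ⟨⟨hs.vtx j, hs.ne j⟩, j, rfl⟩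
      · exact ⟨⟨(hs.vtx j).symm, (hs.ne j).symm⟩, j, (hs.vtx j).symm⟩
    · rintro ⟨j, b⟩ _ ⟨j', b'⟩ _ e
      have e1 := congrArg Prod.fst e
      have hjj : j = j' := by
        apply hs.inj
        have e2 := congrArg f e1
        cases b <;> cases b' <;> simpa [hs.vtx] using e2
      subst hjj
      have := hs.ne j
      cases b <;> cases b' <;> simp at e1 ⊢
      · exact this e1
      · exact this e1.symm
  omega

/-- The corrections `2 * l` are kept because they match those in the number of ways to match
half-edges successively; see `prod_sub_le`. -/
theorem card_pairSeqs_le (f : X → V) (n : ℕ) :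
    (pairSeqs f n).card ≤ ∏ l ∈ Finset.range n, ((pairs f).card - 2 * l) := by
  induction n with
  | zero => simpa using Finset.card_le_univ (pairSeqs f 0)
  | succ n ih =>
    rw [Finset.prod_range_succ, mul_comm]
    refine le_trans (Finset.card_le_mul_card_image_of_maps_to (f := Fin.tail) (t := pairSeqs f n)
      ?_ ((pairs f).card - 2 * n) ?_) (Nat.mul_le_mul_left _ ih)
    · intro s hs
      rw [mem_pairSeqs] at hs ⊢
      exact ⟨fun j => hs.vtx j.succ, fun j => hs.ne j.succ,
        fun a b e => Fin.succ_injective _ (hs.inj e)⟩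
    · intro t ht
      rw [mem_pairSeqs] at ht
      refine le_trans ?_ (card_filter_pairs_le ht)
      refine Finset.card_le_card_of_injOn (fun s => s 0) ?_ ?_
      · intro s hs
        rw [Finset.mem_coe, Finset.mem_filter, mem_pairSeqs] at hs
        obtain ⟨hs, rfl⟩ := hs
        rw [Finset.mem_coe, Finset.mem_filter, mem_pairs]
        exact ⟨⟨hs.vtx 0, hs.ne 0⟩, fun j e => absurd (hs.inj e) (Fin.succ_ne_zero j).symm⟩
      · intro s hs s' hs' e
        rw [Finset.mem_coe, Finset.mem_filter] at hs hs'
        simp only at e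
        rw [← Fin.cons_self_tail s, ← Fin.cons_self_tail s', hs.2, hs'.2, e]

/-- The half-edges of a sequence of pairs. -/
noncomputable def seqSupport {n : ℕ} (s : Fin n → X × X) : Finset X :=
  Finset.univ.filter fun x => ∃ j, x = (s j).1 ∨ x = (s j).2

theorem mem_seqSupport {n : ℕ} {s : Fin n → X × X} {x : X} :
    x ∈ seqSupport s ↔ ∃ j, x = (s j).1 ∨ x = (s j).2 := by simp [seqSupport]

theorem IsPairSeq.card_seqSupport {f : X → V} {n : ℕ} {s : Fin n → X × X} (hs : IsPairSeq f s) :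
    (seqSupport s).card = 2 * n := by
  have : seqSupport s = (Finset.univ.image fun j => (s j).1) ∪
      (Finset.univ.image fun j => (s j).2) := by
    ext x
    simp only [mem_seqSupport, Finset.mem_union, Finset.mem_image, Finset.mem_univ, true_and]
    constructor
    · rintro ⟨j, h | h⟩
      · exact Or.inl ⟨j, h.symm⟩
      · exact Or.inr ⟨j, h.symm⟩
    · rintro (⟨j, h⟩ | ⟨j, h⟩)
      · exact ⟨j, Or.inl h.symm⟩
      · exact ⟨j, Or.inr h.symm⟩
  rw [this, Finset.card_union_of_disjoint, Finset.card_image_of_injective _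
    (fun i j h => hs.eq_of_fst h), Finset.card_image_of_injective _ (fun i j h => hs.eq_of_snd h)]
  · simp; omega
  · rw [Finset.disjoint_left]
    intro x h1 h2
    simp only [Finset.mem_image, Finset.mem_univ, true_and] at h1 h2
    obtain ⟨i, rfl⟩ := h1
    obtain ⟨j, hj⟩ := h2
    exact hs.fst_ne_snd i j hj.symm

/-- Choose the position and the side of `x`, then its companion at the same vertex, then the other
pairs freely. -/
theorem card_pairSeqs_through_le (f : X → V) {D : ℕ}
    (hD : ∀ v, (Finset.univ.filter fun x => f x = v).card ≤ D) (n : ℕ) (x : X) :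
    ((pairSeqs f (n + 1)).filter fun s => x ∈ seqSupport s).card ≤
      2 * (n + 1) * (D * (pairs f).card ^ n) := by
  set F := Finset.univ.filter fun y => f y = f x with hF
  let T : Fin (n + 1) × Bool → Finset (Fin (n + 1) → X × X) := fun jb =>
    Fintype.piFinset fun i => if i = jb.1 then (if jb.2 then {x} ×ˢ F else F ×ˢ {x}) else pairs f
  have hT : ∀ jb, (T jb).card ≤ D * (pairs f).card ^ n := by
    rintro ⟨j, b⟩
    rw [Fintype.card_piFinset, ← Finset.mul_prod_erase _ _ (Finset.mem_univ j)]
    refine Nat.mul_le_mul ?_ (le_of_eq ?_)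
    · cases b <;> simpa using hD (f x)
    · rw [Finset.prod_congr rfl (g := fun _ => (pairs f).card)]
      · simp
      · intro i hi
        simp [(Finset.ne_of_mem_erase hi)]
  have hsub : (pairSeqs f (n + 1)).filter (fun s => x ∈ seqSupport s) ⊆
      Finset.univ.biUnion T := by
    intro s hs
    rw [Finset.mem_filter, mem_pairSeqs, mem_seqSupport] at hs
    obtain ⟨hs, j, h⟩ := hs
    rw [Finset.mem_biUnion]
    have hp : ∀ i, s i ∈ pairs f := fun i => mem_pairs.2 ⟨hs.vtx i, hs.ne i⟩
    rcases h with h | h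
    · refine ⟨(j, true), Finset.mem_univ _, Fintype.mem_piFinset.2 fun i => ?_⟩
      by_cases hi : i = j
      · subst hi
        simp [hF, h, hs.vtx]
      · simp only [if_neg hi]; exact hp i
    · refine ⟨(j, false), Finset.mem_univ _, Fintype.mem_piFinset.2 fun i => ?_⟩
      by_cases hi : i = j
      · subst hi
        simp [hF, h, hs.vtx]
      · simp only [if_neg hi]; exact hp i
  refine (Finset.card_le_card hsub).trans (Finset.card_biUnion_le.trans ?_)
  refine (Finset.sum_le_sum fun jb _ => hT jb).trans ?_
  rw [Finset.sum_const, smul_eq_mul, Finset.card_univ]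
  simp [mul_comm]

/-- A set of representatives of the cycles: every cycle is described by `2 (k + 1)` sequences. -/
theorem exists_transversal (f : X → V) (k : ℕ) :
    ∃ R ⊆ pairSeqs f (k + 1), R.card * (2 * (k + 1)) ≤ (pairSeqs f (k + 1)).card ∧
      ∀ s ∈ pairSeqs f (k + 1), ∃ r ∈ R, ∀ m, IsMatching m → (Follows m r ↔ Follows m s) := by
  -- Sequences are identified when they describe the same event; one representative is taken from
  -- each class.
  let E : (Fin (k + 1) → X × X) → Set (Equiv.Perm X) := fun s => {m | IsMatching m ∧ Follows m s}
  have hE : ∀ r s, E r = E s → ∀ m, IsMatching m → (Follows m r ↔ Follows m s) := by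
    intro r s h m hm
    have := Set.ext_iff.1 h m
    simpa [E, hm] using this
  have hE' : ∀ r s, (∀ m, IsMatching m → (Follows m r ↔ Follows m s)) → E r = E s := by
    intro r s h
    ext m
    exact and_congr_right (h m)
  have hsec : ∀ a ∈ (pairSeqs f (k + 1)).image E, ∃ s ∈ pairSeqs f (k + 1), E s = a :=
    fun a ha => Finset.mem_image.1 ha
  choose g hg1 hg2 using hsec
  refine ⟨((pairSeqs f (k + 1)).image E).attach.image fun a => g a.1 a.2, ?_, ?_, ?_⟩
  · intro s hs
    obtain ⟨a, _, rfl⟩ := Finset.mem_image.1 hs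
    exact hg1 a.1 a.2
  · refine (Nat.mul_le_mul_right _ Finset.card_image_le).trans ?_
    rw [Finset.card_attach, Finset.card_eq_sum_card_image E (pairSeqs f (k + 1)), ← smul_eq_mul]
    refine Finset.card_nsmul_le_sum _ _ _ fun a ha => ?_
    obtain ⟨s, hs, rfl⟩ := Finset.mem_image.1 ha
    rw [mem_pairSeqs] at hs
    have hc : (Finset.univ : Finset (Fin (k + 1) × Bool)).card = 2 * (k + 1) := by
      simp [Finset.card_univ, mul_comm]
    rw [← hc]
    -- The `k + 1` rotations and `k + 1` reflections are distinct even for loops and double edges,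
    -- since the half-edges in the pairs are distinct.
    refine Finset.card_le_card_of_injOn
      (fun rb => if rb.2 then fun j => (s (rb.1 - j)).swap else fun j => s (j + rb.1)) ?_ ?_
    · rintro ⟨r, b⟩ _
      rw [Finset.mem_coe, Finset.mem_filter, mem_pairSeqs]
      cases b
      · exact ⟨hs.rotate r, hE' _ _ fun m _ => Follows.rotate_iff r⟩
      · exact ⟨hs.reverse r, hE' _ _ fun m hm => Follows.reverse_iff hm r⟩
    · rintro ⟨r, b⟩ _ ⟨r', b'⟩ _ e
      have e1 := congrArg Prod.fst (congrFun e 0)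
      cases b <;> cases b' <;> simp only [Bool.false_eq_true, if_true, if_false, zero_add, sub_zero,
        Prod.fst_swap] at e1
      · rw [hs.eq_of_fst e1]
      · exact absurd e1 (hs.fst_ne_snd _ _)
      · exact absurd e1.symm (hs.fst_ne_snd _ _)
      · rw [hs.eq_of_snd e1]
  · intro s hs
    have ha := Finset.mem_image_of_mem E hs
    exact ⟨g (E s) ha, Finset.mem_image.2 ⟨⟨E s, ha⟩, Finset.mem_attach _ _, rfl⟩, hE _ _ (hg2 _ ha)⟩

end Counting

end

/-! ### Switching and the local lemma -/

section

variable {X V : Type*}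

/-- This conjugation is the switching in which `y` and `z` exchange partners. -/
theorem IsMatching.conj {m : Equiv.Perm X} (hm : IsMatching m) (y z : X) :
    IsMatching (Equiv.swap y z * m * Equiv.swap y z) := by
  intro x
  simp only [Equiv.Perm.mul_apply, Equiv.swap_apply_self, (hm _).1, true_and]
  intro e
  have := congrArg (Equiv.swap y z) e
  rw [Equiv.swap_apply_self] at this
  exact (hm _).2 this

/-- Forcing `n` disjoint pairs in a family closed under switchings is a rare event. -/
theorem card_filter_forced_le [Fintype X] {n : ℕ} (x y : Fin n → X)
    (hy : Function.Injective y) (hxy : ∀ i j, x i ≠ y j) (B : Finset (Equiv.Perm X))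
    (hB : ∀ m ∈ B, ∀ l z, m (x l) = y l → z ≠ x l →
      Equiv.swap (y l) z * m * Equiv.swap (y l) z ∈ B) :
    (B.filter fun m => ∀ j, m (x j) = y j).card *
      ∏ l ∈ Finset.range n, (Fintype.card X - 1 - 2 * l) ≤ B.card := by
  have key : ∀ l ≤ n, (B.filter fun m => ∀ j : Fin n, j.val < l → m (x j) = y j).card *
      ∏ i ∈ Finset.range l, (Fintype.card X - 1 - 2 * i) ≤ B.card := by
    intro l
    induction l with
    | zero => intro _; simp
    | succ l ih =>
      intro hl
      refine le_trans ?_ (ih (by omega))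
      rw [Finset.prod_range_succ, mul_comm (∏ i ∈ Finset.range l, _), ← mul_assoc]
      refine Nat.mul_le_mul_right _ ?_
      set L : Fin n := ⟨l, hl⟩ with hL
      set A := (Finset.univ.filter fun j : Fin n => j.val < l) with hA
      have hAc : A.card = l := by
        rw [hA, Fin.card_filter_val_lt]
        omega
      -- The possible new partners of `x L`: everything except `x L` itself and the pairs already
      -- forced. The choice `z = y L` is allowed and switches nothing.
      set Z := Finset.univ \ (insert (x L) (A.image x ∪ A.image y)) with hZ
      have hZc : Fintype.card X - 1 - 2 * l ≤ Z.card := by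
        have h1 := Finset.card_insert_le (x L) (A.image x ∪ A.image y)
        have h2 := Finset.card_union_le (A.image x) (A.image y)
        have h3 := Finset.card_image_le (s := A) (f := x)
        have h4 := Finset.card_image_le (s := A) (f := y)
        have h5 : Finset.card Finset.univ - (insert (x L) (A.image x ∪ A.image y)).card ≤ Z.card :=
          Finset.le_card_sdiff _ _
        rw [Finset.card_univ] at h5
        omega
      refine (Nat.mul_le_mul_left _ hZc).trans ?_
      rw [← Finset.card_product]
      have hzx : ∀ z ∈ Z, z ≠ x L ∧ ∀ j : Fin n, j.val < l → x j ≠ z ∧ y j ≠ z := by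
        intro z hz
        rw [hZ, Finset.mem_sdiff, Finset.mem_insert, Finset.mem_union, not_or, not_or] at hz
        refine ⟨hz.2.1, fun j hj => ⟨fun e => hz.2.2.1 ?_, fun e => hz.2.2.2 ?_⟩⟩
        · exact Finset.mem_image.2 ⟨j, by simp [hA, hj], e⟩
        · exact Finset.mem_image.2 ⟨j, by simp [hA, hj], e⟩
      have happ : ∀ (m : Equiv.Perm X) (z : X), z ≠ x L → m (x L) = y L →
          (Equiv.swap (y L) z * m * Equiv.swap (y L) z) (x L) = z := by
        intro m z hz hm
        simp only [Equiv.Perm.mul_apply]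
        rw [Equiv.swap_apply_of_ne_of_ne (hxy L L) hz.symm, hm, Equiv.swap_apply_left]
      -- The switched matching determines `z` as the partner of `x L`, and then `m` by undoing the
      -- switch.
      refine Finset.card_le_card_of_injOn
        (fun mz => Equiv.swap (y L) mz.2 * mz.1 * Equiv.swap (y L) mz.2) ?_ ?_
      · rintro ⟨m, z⟩ hmz
        rw [Finset.mem_coe, Finset.mem_product, Finset.mem_filter] at hmz
        obtain ⟨⟨hm, hf⟩, hz⟩ := hmz
        obtain ⟨hz1, hz2⟩ := hzx z hz
        rw [Finset.mem_coe, Finset.mem_filter]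
        refine ⟨hB m hm L z (hf L (by simp [hL])) hz1, fun j hj => ?_⟩
        have hjL : j ≠ L := fun e => by simp [e, hL] at hj
        simp only [Equiv.Perm.mul_apply]
        rw [Equiv.swap_apply_of_ne_of_ne (hxy j L) (hz2 j hj).1, hf j (by omega),
          Equiv.swap_apply_of_ne_of_ne (fun e => hjL (hy e)) (hz2 j hj).2]
      · rintro ⟨m, z⟩ hmz ⟨m', z'⟩ hmz' e
        rw [Finset.mem_coe, Finset.mem_product, Finset.mem_filter] at hmz hmz'
        simp only at e
        have h1 := happ m z (hzx z hmz.2).1 (hmz.1.2 L (by simp [hL]))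
        have h2 := happ m' z' (hzx z' hmz'.2).1 (hmz'.1.2 L (by simp [hL]))
        rw [e, h2] at h1
        subst h1
        rw [mul_left_inj, mul_right_inj] at e
        rw [e]
  have := key n le_rfl
  convert this using 4
  simp

/-- The finite set of perfect matchings. -/
noncomputable def matchings (X : Type*) [Fintype X] : Finset (Equiv.Perm X) :=
  Finset.univ.filter IsMatching

theorem mem_matchings [Fintype X] {m : Equiv.Perm X} : m ∈ matchings X ↔ IsMatching m := by
  simp [matchings]

theorem card_matchings_filter [Fintype X] (P : Equiv.Perm X → Prop) [DecidablePred P] :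
    ((matchings X).filter P).card = mcount P := by
  rw [mcount_eq_card, matchings, Finset.filter_filter]
  congr 1
  ext m
  simp

/-- A cycle is negatively correlated with the presence of cycles with other half-edges. -/
theorem card_filter_follows_le [Fintype X] {f : X → V} {k : ℕ} {s : Fin (k + 1) → X × X}
    (hs : IsPairSeq f s) {ι : Type*} (T : Finset ι) (c : ι → ℕ)
    (t : (i : ι) → Fin (c i + 1) → X × X)
    (hT : ∀ i ∈ T, Disjoint (seqSupport s) (seqSupport (t i))) :
    ((matchings X).filter fun m => Follows m s ∧ ∀ i ∈ T, ¬ Follows m (t i)).card *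
      ∏ l ∈ Finset.range (k + 1), (Fintype.card X - 1 - 2 * l) ≤
    ((matchings X).filter fun m => ∀ i ∈ T, ¬ Follows m (t i)).card := by
  have := card_filter_forced_le (fun j => (s j).2) (fun j => (s (j + 1)).1)
    (fun i j h => add_right_cancel (hs.eq_of_fst h))
    (fun i j => (hs.fst_ne_snd (j + 1) i).symm)
    ((matchings X).filter fun m => ∀ i ∈ T, ¬ Follows m (t i)) ?_
  · rw [Finset.filter_filter] at this
    refine le_trans (le_of_eq ?_) this
    congr 2
    exact Finset.filter_congr fun m _ => and_comm
  · intro m hm l z hml hz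
    rw [Finset.mem_filter, mem_matchings] at hm ⊢
    refine ⟨hm.1.conj _ _, fun i hi hF => hm.2 i hi fun j => ?_⟩
    -- A switching cannot create the cycle `t i`. That cycle avoids both ends of the switched pair
    -- by disjointness; it avoids `z` too, because after the switch `z` is matched to a half-edge of
    -- `s`. On the remaining half-edges it uses, the two matchings agree.
    have hout : ∀ a ∈ seqSupport (t i), a ≠ (s l).2 ∧ a ≠ (s (l + 1)).1 := fun a ha =>
      ⟨fun e => Finset.disjoint_left.1 (hT i hi) (mem_seqSupport.2 ⟨l, Or.inr e⟩) ha,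
        fun e => Finset.disjoint_left.1 (hT i hi) (mem_seqSupport.2 ⟨l + 1, Or.inl e⟩) ha⟩
    obtain ⟨ha1, ha2⟩ := hout (t i j).2 (mem_seqSupport.2 ⟨j, Or.inr rfl⟩)
    obtain ⟨hb1, hb2⟩ := hout (t i (j + 1)).1 (mem_seqSupport.2 ⟨j + 1, Or.inl rfl⟩)
    have h := hF j
    simp only [Equiv.Perm.mul_apply] at h
    have hmy : m (s (l + 1)).1 = (s l).2 := by rw [← hml, (hm.1 _).1]
    have haz : (t i j).2 ≠ z := by
      intro e
      rw [e, Equiv.swap_apply_right, hmy, Equiv.swap_apply_of_ne_of_ne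
        (hs.fst_ne_snd (l + 1) l).symm hz.symm] at h
      exact hb1 h.symm
    rw [Equiv.swap_apply_of_ne_of_ne ha2 haz] at h
    have hbz : (t i (j + 1)).1 ≠ z := by
      intro e
      rw [e, Equiv.swap_apply_eq_iff, Equiv.swap_apply_right, ← hml] at h
      exact ha1 (m.injective h)
    rw [Equiv.swap_apply_eq_iff, Equiv.swap_apply_of_ne_of_ne hb2 hbz] at h
    exact h

/-- The local lemma for negative dependency graphs, with small neighbourhoods. -/
theorem local_lemma {Ω ι : Type*} (U : Finset Ω) (A : ι → Ω → Prop) (I : Finset ι)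
    (adj : ι → ι → Prop) (p : ι → ℝ) {η : ℝ} (hη0 : 0 ≤ η) (hη : η ≤ 1 / 4) (hp0 : ∀ i, 0 ≤ p i)
    (hneg : ∀ i ∈ I, ∀ S ⊆ I, (∀ j ∈ S, ¬ adj i j) →
      ((U.filter fun ω => A i ω ∧ ∀ j ∈ S, ¬ A j ω).card : ℝ) ≤
        p i * (U.filter fun ω => ∀ j ∈ S, ¬ A j ω).card)
    (hpη : ∀ i ∈ I, p i ≤ η)
    (hsum : ∀ i ∈ I, ∑ j ∈ I.filter (adj i), p j ≤ η) :
    Real.exp (-(∑ i ∈ I, p i) / (1 - 3 * η)) * U.card ≤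
      (U.filter fun ω => ∀ j ∈ I, ¬ A j ω).card := by
  -- Conditionally on avoiding any family `S`, the event `A i` has probability at most `p i / (1 - 2
  -- * η)`. The induction is on the size of `S`, split into neighbours and non-neighbours of `i`.
  have key : ∀ (n : ℕ) (S : Finset ι), S.card = n → S ⊆ I → ∀ i ∈ I,
      ((U.filter fun ω => A i ω ∧ ∀ j ∈ S, ¬ A j ω).card : ℝ) * (1 - 2 * η) ≤
        p i * (U.filter fun ω => ∀ j ∈ S, ¬ A j ω).card := by
    intro n
    induction n using Nat.strong_induction_on with
    | _ n ih =>
      intro S hn hSI i hi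
      set S1 := S.filter (adj i) with hS1
      set S2 := S.filter (fun j => ¬ adj i j) with hS2
      have hS2S : S2 ⊆ S := Finset.filter_subset _ _
      have hcard : S1.card + S2.card = S.card := Finset.card_filter_add_card_filter_not _
      have h2 := hneg i hi S2 (hS2S.trans hSI) (fun j hj => (Finset.mem_filter.1 hj).2)
      set N : ℝ := ((U.filter fun ω => ∀ j ∈ S, ¬ A j ω).card : ℝ) with hN
      set N2 : ℝ := ((U.filter fun ω => ∀ j ∈ S2, ¬ A j ω).card : ℝ) with hN2
      -- Given that the non-neighbours are avoided, a union bound over the neighbours costs at most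
      -- `2 * η`; the factor 2 bounds `1 / (1 - 2 * η)`, as `η ≤ 1 / 4`.
      have hN2' : N2 * (1 - 2 * η) ≤ N := by
        have hun : (U.filter fun ω => ∀ j ∈ S2, ¬ A j ω) ⊆
            (U.filter fun ω => ∀ j ∈ S, ¬ A j ω) ∪
              S1.biUnion fun j => U.filter fun ω => A j ω ∧ ∀ j ∈ S2, ¬ A j ω := by
          intro ω hω
          rw [Finset.mem_filter] at hω
          rw [Finset.mem_union]
          by_cases h : ∀ j ∈ S, ¬ A j ω
          · exact Or.inl (Finset.mem_filter.2 ⟨hω.1, h⟩)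
          · right
            push Not at h
            obtain ⟨j, hj, hA⟩ := h
            refine Finset.mem_biUnion.2 ⟨j, Finset.mem_filter.2 ⟨hj, ?_⟩,
              Finset.mem_filter.2 ⟨hω.1, hA, hω.2⟩⟩
            by_contra hna
            exact hω.2 j (Finset.mem_filter.2 ⟨hj, hna⟩) hA
        have h3 : N2 ≤ N + ∑ j ∈ S1,
            ((U.filter fun ω => A j ω ∧ ∀ j ∈ S2, ¬ A j ω).card : ℝ) := by
          rw [hN2, hN]
          exact_mod_cast (Finset.card_le_card hun).trans ((Finset.card_union_le _ _).trans
            (Nat.add_le_add_left Finset.card_biUnion_le _))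
        rcases S1.eq_empty_or_nonempty with he | hne
        · rw [he, Finset.sum_empty] at h3
          nlinarith [show (0 : ℝ) ≤ N2 from Nat.cast_nonneg _]
        · have h4 : ∀ j ∈ S1, ((U.filter fun ω => A j ω ∧ ∀ j ∈ S2, ¬ A j ω).card : ℝ) ≤
              2 * (p j * N2) := by
            intro j hj
            have := ih S2.card (by have := hne.card_pos; omega) S2 rfl (hS2S.trans hSI) j
              (hSI (Finset.mem_filter.1 hj).1)
            nlinarith [show (0 : ℝ) ≤
              ((U.filter fun ω => A j ω ∧ ∀ j ∈ S2, ¬ A j ω).card : ℝ) from Nat.cast_nonneg _]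
          have h5 : ∑ j ∈ S1, p j ≤ η := by
            refine le_trans (Finset.sum_le_sum_of_subset_of_nonneg ?_ fun j _ _ => hp0 j)
              (hsum i hi)
            exact Finset.filter_subset_filter _ hSI
          have h6 := Finset.sum_le_sum h4
          rw [← Finset.mul_sum, ← Finset.sum_mul] at h6
          nlinarith [show (0 : ℝ) ≤ N2 from Nat.cast_nonneg _]
      have h7 : ((U.filter fun ω => A i ω ∧ ∀ j ∈ S, ¬ A j ω).card : ℝ) ≤
          ((U.filter fun ω => A i ω ∧ ∀ j ∈ S2, ¬ A j ω).card : ℝ) := by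
        exact_mod_cast Finset.card_le_card fun ω h => by
          rw [Finset.mem_filter] at h ⊢
          exact ⟨h.1, h.2.1, fun j hj => h.2.2 j (hS2S hj)⟩
      calc _ ≤ p i * N2 * (1 - 2 * η) :=
            mul_le_mul_of_nonneg_right (h7.trans h2) (by linarith)
        _ = p i * (N2 * (1 - 2 * η)) := by ring
        _ ≤ _ := mul_le_mul_of_nonneg_left hN2' (hp0 i)
  have main : ∀ S ⊆ I, Real.exp (-(∑ i ∈ S, p i) / (1 - 3 * η)) * U.card ≤
      (U.filter fun ω => ∀ j ∈ S, ¬ A j ω).card := by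
    intro S
    induction S using Finset.induction_on with
    | empty => intro _; simp
    | insert i S hiS ih =>
      intro hSI
      have hi : i ∈ I := hSI (Finset.mem_insert_self _ _)
      have hS : S ⊆ I := (Finset.subset_insert _ _).trans hSI
      have h1 := ih hS
      have h2 := key _ S rfl hS i hi
      have h3 : ((U.filter fun ω => ∀ j ∈ S, ¬ A j ω).card : ℝ) =
          (U.filter fun ω => A i ω ∧ ∀ j ∈ S, ¬ A j ω).card +
          (U.filter fun ω => ∀ j ∈ insert i S, ¬ A j ω).card := by
        rw [← Finset.card_filter_add_card_filter_not (s := U.filter fun ω => ∀ j ∈ S, ¬ A j ω)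
          (fun ω => A i ω), Finset.filter_filter, Finset.filter_filter]
        push_cast
        congr 3
        · ext ω; simp only [and_comm]
        · ext ω
          simp only [Finset.forall_mem_insert, and_comm]
      set N : ℝ := ((U.filter fun ω => ∀ j ∈ S, ¬ A j ω).card : ℝ) with hN
      have hN0 : 0 ≤ N := Nat.cast_nonneg _
      have hpi := hpη i hi
      have hpi0 := hp0 i
      have h5 : N * (1 - p i / (1 - 2 * η)) ≤
          (U.filter fun ω => ∀ j ∈ insert i S, ¬ A j ω).card := by
        have : ((U.filter fun ω => A i ω ∧ ∀ j ∈ S, ¬ A j ω).card : ℝ) ≤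
            p i * N / (1 - 2 * η) := (le_div_iff₀ (by linarith)).2 h2
        have e : N * (1 - p i / (1 - 2 * η)) = N - p i * N / (1 - 2 * η) := by ring
        rw [e]
        linarith
      -- Writing the right side as the inverse of `1 + p / (1 - 2η - p)` reduces this to `1 + x ≤
      -- exp x`, with `p ≤ η` in the denominator.
      have h6 : Real.exp (-p i / (1 - 3 * η)) ≤ 1 - p i / (1 - 2 * η) := by
        have e1 : 1 - p i / (1 - 2 * η) = (1 + p i / (1 - 2 * η - p i))⁻¹ := by
          have : 1 - 2 * η ≠ 0 := by linarith
          have : 1 - 2 * η - p i ≠ 0 := by linarith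
          have e2 : 1 + p i / (1 - 2 * η - p i) = (1 - 2 * η) / (1 - 2 * η - p i) := by
            field_simp; ring
          rw [e2, inv_div]
          field_simp
        have hpos : 0 < 1 + p i / (1 - 2 * η - p i) := by
          have : 0 ≤ p i / (1 - 2 * η - p i) := div_nonneg hpi0 (by linarith)
          linarith
        rw [e1, neg_div, Real.exp_neg]
        refine inv_anti₀ hpos ?_
        have h7 : p i / (1 - 2 * η - p i) ≤ p i / (1 - 3 * η) :=
          div_le_div_of_nonneg_left hpi0 (by linarith) (by linarith)
        have h8 := Real.add_one_le_exp (p i / (1 - 3 * η))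
        linarith
      rw [Finset.sum_insert hiS]
      have e3 : -(p i + ∑ i ∈ S, p i) / (1 - 3 * η) =
          -p i / (1 - 3 * η) + -(∑ i ∈ S, p i) / (1 - 3 * η) := by ring
      rw [e3, Real.exp_add]
      calc _ = Real.exp (-p i / (1 - 3 * η)) *
            (Real.exp (-(∑ i ∈ S, p i) / (1 - 3 * η)) * U.card) := by ring
        _ ≤ Real.exp (-p i / (1 - 3 * η)) * N :=
            mul_le_mul_of_nonneg_left h1 (Real.exp_pos _).le
        _ ≤ (1 - p i / (1 - 2 * η)) * N := mul_le_mul_of_nonneg_right h6 hN0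
        _ ≤ _ := by rw [mul_comm]; exact h5
  exact main I subset_rfl

end

/-! ### A lower bound for the number of matchings without a core -/

section

variable {X V : Type*} [Fintype X]

/-- The number `(M - 1) (M - 3) ⋯` of ways to match `n` given half-edges one after the other. -/
def matchWeight (M n : ℕ) : ℕ := ∏ l ∈ Finset.range n, (M - 1 - 2 * l)

theorem matchWeight_pos {M n : ℕ} (h : 2 * n ≤ M) : 0 < matchWeight M n :=
  Finset.prod_pos fun l hl => by
    have := Finset.mem_range.1 hl
    omega

/-- Factor by factor, `(S - 2l) / (M - 1 - 2l) ≤ S / (M - 1)` because `S ≤ M - 1`. The expected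
number of cycles is thus bounded by a power of one ratio for every length, including lengths
comparable with `M`. -/
theorem prod_sub_le {S M n : ℕ} (hS : S ≤ M - 1) (h : 2 * n ≤ M) :
    ((∏ l ∈ Finset.range n, (S - 2 * l) : ℕ) : ℝ) ≤
      (S / ((M : ℝ) - 1)) ^ n * matchWeight M n := by
  rw [matchWeight]
  push_cast
  have hpow : ((S : ℝ) / ((M : ℝ) - 1)) ^ n = ∏ _l ∈ Finset.range n, (S : ℝ) / ((M : ℝ) - 1) := by
    rw [Finset.prod_const, Finset.card_range]
  rw [hpow, ← Finset.prod_mul_distrib]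
  refine Finset.prod_le_prod (fun l _ => Nat.cast_nonneg _) fun l hl => ?_
  have hl := Finset.mem_range.1 hl
  have hM : (1 : ℝ) < M := by exact_mod_cast (by omega : 1 < M)
  have h1 : ((M - 1 - 2 * l : ℕ) : ℝ) = M - 1 - 2 * l := by
    rw [Nat.cast_sub (by omega), Nat.cast_sub (by omega)]; simp
  have hSM : (S : ℝ) ≤ M - 1 := by
    have : S + 1 ≤ M := by omega
    have : (S : ℝ) + 1 ≤ M := by exact_mod_cast this
    linarith
  rw [h1, div_mul_eq_mul_div, le_div_iff₀ (by linarith)]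
  rcases le_total (2 * l) S with h2 | h2
  · rw [Nat.cast_sub h2]
    push_cast
    nlinarith [show (0 : ℝ) ≤ l from Nat.cast_nonneg _]
  · rw [Nat.sub_eq_zero_of_le h2]
    have h3 : (2 * l : ℝ) ≤ M - 1 := by
      have : 2 * l + 1 ≤ M := by omega
      have : (2 * l : ℝ) + 1 ≤ M := by exact_mod_cast this
      linarith
    have : (0 : ℝ) ≤ S := Nat.cast_nonneg _
    simp only [Nat.cast_zero, zero_mul]
    nlinarith

/-- The negative correlation bound with no forbidden cycle. -/
theorem mcount_follows_le {f : X → V} {k : ℕ} {s : Fin (k + 1) → X × X} (hs : IsPairSeq f s) :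
    mcount (fun m => Follows m s) * matchWeight (Fintype.card X) (k + 1) ≤
      mcount (fun _ : Equiv.Perm X => True) := by
  have := card_filter_follows_le hs (∅ : Finset Empty) (fun _ => 0) (fun i => i.elim) (by simp)
  simp only [Finset.notMem_empty, IsEmpty.forall_iff, and_true,
    card_matchings_filter] at this
  exact this

/-- A lower bound for the probability that the configuration model is a forest. -/
theorem mcount_not_hasCore_ge (f : X → V) {K D : ℕ} {η : ℝ} (hK : 2 * K ≤ Fintype.card X)
    (hS : (pairs f).card ≤ Fintype.card X - 1)
    (hD : ∀ v, (Finset.univ.filter fun x => f x = v).card ≤ D)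
    (hη0 : 0 ≤ η) (hη : η ≤ 1 / 4)
    (hsum : 2 * K * ∑ k ∈ Finset.range K, (2 * (k + 1) * (D * (pairs f).card ^ k) : ℝ) /
      matchWeight (Fintype.card X) (k + 1) ≤ η) :
    mcount (fun _ : Equiv.Perm X => True) *
      (Real.exp (-(∑ k ∈ Finset.range K,
        ((pairs f).card / ((Fintype.card X : ℝ) - 1)) ^ (k + 1) / (2 * (k + 1))) / (1 - 3 * η)) -
        ∑ k ∈ Finset.Ico K (Fintype.card X),
          ((pairs f).card / ((Fintype.card X : ℝ) - 1)) ^ (k + 1) / (2 * (k + 1))) ≤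
      mcount fun m => ¬ HasCore f m := by
  set M := Fintype.card X with hMdef
  set S := (pairs f).card with hSdef
  set r : ℝ := S / ((M : ℝ) - 1) with hr
  -- `R k` lists the cycles of length `k + 1`, one sequence for each.
  choose R hR1 hR2 hR3 using exists_transversal f
  have hRs : ∀ k, ∀ s ∈ R k, IsPairSeq f s := fun k s hs => mem_pairSeqs.1 (hR1 k hs)
  have hRle : ∀ k, ∀ s ∈ R k, 2 * (k + 1) ≤ M := by
    intro k s hs
    rw [← (hRs k s hs).card_seqSupport]
    exact Finset.card_le_univ _
  have hRw : ∀ k, 2 * (k + 1) ≤ M → ((R k).card : ℝ) ≤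
      r ^ (k + 1) / (2 * (k + 1)) * matchWeight M (k + 1) := by
    intro k hk
    have h1 := (hR2 k).trans (card_pairSeqs_le f (k + 1))
    have h2 := prod_sub_le hS hk
    have h3 : ((R k).card : ℝ) * (2 * (k + 1)) ≤ r ^ (k + 1) * matchWeight M (k + 1) := by
      refine le_trans ?_ h2
      exact_mod_cast h1
    rw [div_mul_eq_mul_div, le_div_iff₀ (by positivity)]
    exact h3
  let I : Finset ((k : ℕ) × (Fin (k + 1) → X × X)) := (Finset.range K).sigma R
  have hI : ∀ i ∈ I, i.1 < K ∧ i.2 ∈ R i.1 := fun i hi => by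
    rw [Finset.mem_sigma, Finset.mem_range] at hi
    exact hi
  let p : ((k : ℕ) × (Fin (k + 1) → X × X)) → ℝ := fun i => 1 / matchWeight M (i.1 + 1)
  have hp0 : ∀ i, 0 ≤ p i := fun i => by positivity
  -- Cycles are dependent when they share a half-edge. A neighbourhood sum is bounded by summing
  -- over the at most `2 * K` half-edges of the given cycle.
  let adj : ((k : ℕ) × (Fin (k + 1) → X × X)) → ((k : ℕ) × (Fin (k + 1) → X × X)) → Prop :=
    fun i j => ¬ Disjoint (seqSupport i.2) (seqSupport j.2)
  have hadj : ∀ i ∈ I, ∑ j ∈ I.filter (adj i), p j ≤ η := by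
    intro i hi
    obtain ⟨hiK, hiR⟩ := hI i hi
    have hx : ∀ x, ∑ j ∈ I, (if x ∈ seqSupport j.2 then p j else 0) ≤
        ∑ k ∈ Finset.range K, (2 * (k + 1) * (D * S ^ k) : ℝ) / matchWeight M (k + 1) := by
      intro x
      rw [Finset.sum_sigma]
      refine Finset.sum_le_sum fun k _ => ?_
      rw [← Finset.sum_filter]
      change ∑ a ∈ (R k).filter (fun s => x ∈ seqSupport s), (1 : ℝ) / matchWeight M (k + 1) ≤ _
      rw [Finset.sum_const, nsmul_eq_mul, mul_one_div]
      refine div_le_div_of_nonneg_right ?_ (Nat.cast_nonneg _)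
      have h1 : ((R k).filter fun s => x ∈ seqSupport s).card ≤
          2 * (k + 1) * (D * S ^ k) :=
        (Finset.card_le_card (Finset.filter_subset_filter _ (hR1 k))).trans
          (card_pairSeqs_through_le f hD k x)
      exact_mod_cast h1
    refine le_trans ?_ hsum
    calc ∑ j ∈ I.filter (adj i), p j
        ≤ ∑ j ∈ I.filter (adj i), ∑ x ∈ seqSupport i.2,
            (if x ∈ seqSupport j.2 then p j else 0) := by
          refine Finset.sum_le_sum fun j hj => ?_
          obtain ⟨x, hx1, hx2⟩ := Finset.not_disjoint_iff.1 (Finset.mem_filter.1 hj).2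
          refine le_trans ?_ (Finset.single_le_sum (fun x _ => ?_) hx1)
          · rw [if_pos hx2]
          · split_ifs
            · exact hp0 j
            · exact le_rfl
      _ ≤ ∑ j ∈ I, ∑ x ∈ seqSupport i.2, (if x ∈ seqSupport j.2 then p j else 0) := by
          refine Finset.sum_le_sum_of_subset_of_nonneg (Finset.filter_subset _ _) fun j _ _ => ?_
          refine Finset.sum_nonneg fun x _ => ?_
          split_ifs
          · exact hp0 j
          · exact le_rfl
      _ = ∑ x ∈ seqSupport i.2, ∑ j ∈ I, (if x ∈ seqSupport j.2 then p j else 0) :=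
          Finset.sum_comm
      _ ≤ ∑ x ∈ seqSupport i.2, ∑ k ∈ Finset.range K,
            (2 * (k + 1) * (D * S ^ k) : ℝ) / matchWeight M (k + 1) :=
          Finset.sum_le_sum fun x _ => hx x
      _ ≤ _ := by
          rw [Finset.sum_const, nsmul_eq_mul, (hRs _ _ hiR).card_seqSupport]
          refine mul_le_mul_of_nonneg_right ?_ (Finset.sum_nonneg fun k _ => by positivity)
          exact_mod_cast (by omega : 2 * (i.1 + 1) ≤ 2 * K)
  have hLL := local_lemma (matchings X) (fun i m => Follows m i.2) I adj p hη0 hη hp0 ?_ ?_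
    (by convert hadj)
  · have hps : ∑ i ∈ I, p i ≤ ∑ k ∈ Finset.range K, r ^ (k + 1) / (2 * (k + 1)) := by
      rw [Finset.sum_sigma]
      refine Finset.sum_le_sum fun k hk => ?_
      have hk' : 2 * (k + 1) ≤ M := by have := Finset.mem_range.1 hk; omega
      have hw := matchWeight_pos hk'
      change ∑ s ∈ R k, (1 : ℝ) / matchWeight M (k + 1) ≤ _
      rw [Finset.sum_const, nsmul_eq_mul, mul_one_div, div_le_iff₀ (by exact_mod_cast hw)]
      exact hRw k hk'
    have hmM : (matchings X).card = mcount fun _ : Equiv.Perm X => True := by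
      rw [← card_matchings_filter, Finset.filter_true]
    -- A matching without a cycle of length at most `K` either has no core or contains a longer
    -- cycle, and the latter is handled by a union bound.
    have hcov : ((matchings X).filter fun m => ∀ i ∈ I, ¬ Follows m i.2) ⊆
        ((matchings X).filter fun m => ¬ HasCore f m) ∪
        (Finset.Ico K M).biUnion fun k => (R k).biUnion fun s =>
          (matchings X).filter fun m => Follows m s := by
      intro m hm
      rw [Finset.mem_filter] at hm
      rw [Finset.mem_union]
      by_cases hc : HasCore f m
      · right
        have hmm := mem_matchings.1 hm.1
        obtain ⟨k, s, hs, hsm⟩ := hc.exists_follows hmm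
        obtain ⟨s', hs', hiff⟩ := hR3 k s (mem_pairSeqs.2 hs)
        have hf := (hiff m hmm).2 hsm
        refine Finset.mem_biUnion.2 ⟨k, ?_, Finset.mem_biUnion.2 ⟨s', hs',
          Finset.mem_filter.2 ⟨hm.1, hf⟩⟩⟩
        rw [Finset.mem_Ico]
        constructor
        · by_contra hlt
          exact hm.2 ⟨k, s'⟩ (Finset.mem_sigma.2 ⟨Finset.mem_range.2 (not_le.1 hlt), hs'⟩) hf
        · have := hRle k s' hs'
          omega
      · exact Or.inl (Finset.mem_filter.2 ⟨hm.1, hc⟩)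
    set N := mcount fun _ : Equiv.Perm X => True with hN
    have hN0 : (0 : ℝ) ≤ N := Nat.cast_nonneg _
    have hlong : ∀ k, ((∑ s ∈ R k, mcount fun m => Follows m s : ℕ) : ℝ) ≤
        N * (r ^ (k + 1) / (2 * (k + 1))) := by
      intro k
      by_cases hk : 2 * (k + 1) ≤ M
      · have hw : (0 : ℝ) < matchWeight M (k + 1) := by exact_mod_cast matchWeight_pos hk
        have h1 : ∀ s ∈ R k, ((mcount fun m => Follows m s : ℕ) : ℝ) ≤
            N / matchWeight M (k + 1) := by
          intro s hs
          rw [le_div_iff₀ hw]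
          exact_mod_cast mcount_follows_le (hRs k s hs)
        push_cast
        refine (Finset.sum_le_sum h1).trans ?_
        rw [Finset.sum_const, nsmul_eq_mul, mul_div_assoc', div_le_iff₀ hw]
        nlinarith [mul_le_mul_of_nonneg_left (hRw k hk) hN0]
      · have : R k = ∅ := Finset.eq_empty_of_forall_notMem fun s hs => hk (hRle k s hs)
        rw [this]
        have hr0 : 0 ≤ r := by
          by_cases hM0 : M = 0
          · have : (S : ℝ) = 0 := by
              have : S = 0 := by omega
              exact_mod_cast this
            rw [hr, this, zero_div]
          · have : (1 : ℝ) ≤ M := by exact_mod_cast Nat.one_le_iff_ne_zero.2 hM0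
            exact div_nonneg (Nat.cast_nonneg _) (by linarith)
        simp only [Finset.sum_empty, Nat.cast_zero]
        positivity
    have hcard : (((matchings X).filter fun m => ∀ i ∈ I, ¬ Follows m i.2).card : ℝ) ≤
        (mcount fun m => ¬ HasCore f m : ℕ) +
          N * ∑ k ∈ Finset.Ico K M, r ^ (k + 1) / (2 * (k + 1)) := by
      have h1 : ((matchings X).filter fun m => ∀ i ∈ I, ¬ Follows m i.2).card ≤
          (mcount fun m => ¬ HasCore f m) +
            ∑ k ∈ Finset.Ico K M, ∑ s ∈ R k, mcount fun m => Follows m s := by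
        refine (Finset.card_le_card hcov).trans ((Finset.card_union_le _ _).trans ?_)
        rw [card_matchings_filter]
        refine Nat.add_le_add_left (Finset.card_biUnion_le.trans
          (Finset.sum_le_sum fun k _ => Finset.card_biUnion_le.trans
            (Finset.sum_le_sum fun s _ => ?_))) _
        rw [card_matchings_filter]
      rw [Finset.mul_sum]
      calc (((matchings X).filter fun m => ∀ i ∈ I, ¬ Follows m i.2).card : ℝ)
          ≤ (mcount fun m => ¬ HasCore f m : ℕ) + ∑ k ∈ Finset.Ico K M,
            ((∑ s ∈ R k, mcount fun m => Follows m s : ℕ) : ℝ) := by exact_mod_cast h1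
        _ ≤ _ := by
          gcongr with k hk
          exact hlong k
    rw [hmM] at hLL
    have hexp : Real.exp (-(∑ k ∈ Finset.range K, r ^ (k + 1) / (2 * (k + 1))) / (1 - 3 * η)) ≤
        Real.exp (-(∑ i ∈ I, p i) / (1 - 3 * η)) := by
      rw [Real.exp_le_exp]
      exact div_le_div_of_nonneg_right (neg_le_neg hps) (by linarith)
    nlinarith [mul_le_mul_of_nonneg_left hexp hN0]
  · intro i hi T hTI hT
    obtain ⟨hiK, hiR⟩ := hI i hi
    have h1 := card_filter_follows_le (hRs _ _ hiR) T (fun i => i.1) (fun i => i.2)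
      (fun j hj => not_not.1 (hT j hj))
    have hw : (0 : ℝ) < matchWeight M (i.1 + 1) := by
      exact_mod_cast matchWeight_pos (by omega)
    change _ ≤ (1 : ℝ) / matchWeight M (i.1 + 1) * _
    rw [one_div, inv_mul_eq_div, le_div_iff₀ hw]
    exact_mod_cast h1
  -- A cycle meets itself, so `p i` is one term of its own neighbourhood sum.
  · intro i hi
    refine le_trans ?_ (hadj i hi)
    refine Finset.single_le_sum (f := p) (fun j _ => hp0 j) (Finset.mem_filter.2 ⟨hi, ?_⟩)
    refine Finset.not_disjoint_iff.2 ⟨(i.2 0).1, ?_, ?_⟩ <;>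
      exact mem_seqSupport.2 ⟨0, Or.inl rfl⟩

end

/-! ### Degree sequences close to the limiting regime -/

section

/-- Half-edges `X` at vertices `V` form a degree sequence that is `δ`-close to the limiting regime
with parameter `ν`. -/
structure IsNearRegime (ν δ : ℝ) {X V : Type*} [Fintype X] (f : X → V) : Prop where
  even : Even (Fintype.card X)
  large : 1 ≤ δ * Fintype.card X
  card_pairs : |((pairs f).card : ℝ) - ν * Fintype.card X| ≤ δ * Fintype.card X
  degree : ∀ v, ((Finset.univ.filter fun x => f x = v).card : ℝ) ^ 2 ≤ δ * Fintype.card X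

/-- Half of the series of `-log (1 - ν)`, truncated; its terms are nonnegative. -/
theorem sqrt_le_exp_neg_sum {ν : ℝ} (h0 : 0 ≤ ν) (h1 : ν < 1) (K : ℕ) :
    Real.sqrt (1 - ν) ≤ Real.exp (-∑ k ∈ Finset.range K, ν ^ (k + 1) / (2 * (k + 1))) := by
  have h := Real.hasSum_pow_div_log_of_abs_lt_one (x := ν) (by rwa [abs_of_nonneg h0])
  have h2 := sum_le_hasSum (Finset.range K) (fun k _ => by positivity) h
  have h3 : ∑ k ∈ Finset.range K, ν ^ (k + 1) / (2 * ((k : ℝ) + 1)) =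
      (∑ k ∈ Finset.range K, ν ^ (k + 1) / ((k : ℝ) + 1)) / 2 := by
    rw [Finset.sum_div]
    refine Finset.sum_congr rfl fun k _ => ?_
    rw [div_div, mul_comm]
  rw [Real.sqrt_eq_rpow, Real.rpow_def_of_pos (by linarith), Real.exp_le_exp, h3]
  linarith

theorem half_pow_le_matchWeight {M n : ℕ} (h : 4 * n + 2 ≤ M) :
    ((M : ℝ) / 2) ^ n ≤ matchWeight M n := by
  rw [matchWeight]
  push_cast
  have hpow : ((M : ℝ) / 2) ^ n = ∏ _l ∈ Finset.range n, (M : ℝ) / 2 := by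
    rw [Finset.prod_const, Finset.card_range]
  rw [hpow]
  refine Finset.prod_le_prod (fun l _ => by positivity) fun l hl => ?_
  have hl := Finset.mem_range.1 hl
  rw [div_le_iff₀ (by norm_num)]
  exact_mod_cast (by omega : M ≤ (M - 1 - 2 * l) * 2)

set_option maxHeartbeats 1000000 in
/-- Near the limiting regime, the configuration model is a forest with probability at least
`√(1 - ν) - ε`. -/
theorem exists_forest_lower {ν : ℝ} (h0 : 0 ≤ ν) (h1 : ν < 1) {ε : ℝ} (hε : 0 < ε) :
    ∃ δ > 0, ∀ (X V : Type) [Fintype X] (f : X → V), IsNearRegime ν δ f →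
      (Real.sqrt (1 - ν) - ε) * mcount (fun _ : Equiv.Perm X => True) ≤
        mcount fun m => ¬ HasCore f m := by
  -- The midpoint `r₀` of ν and 1 dominates the perturbed ratio, making the sum over long cycles
  -- geometric; `K` is chosen to make that tail small.
  set r₀ := (1 + ν) / 2 with hr₀
  have hr₀1 : r₀ < 1 := by rw [hr₀]; linarith
  have hr₀0 : 0 < r₀ := by rw [hr₀]; linarith
  obtain ⟨K, hK⟩ : ∃ K : ℕ, r₀ ^ K < ε / 2 * (1 - r₀) :=
    exists_pow_lt_of_lt_one (mul_pos (by linarith) (by linarith)) hr₀1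
  let G : ℝ × ℝ → ℝ := fun q =>
    Real.exp (-(∑ k ∈ Finset.range K, q.1 ^ (k + 1) / (2 * (k + 1))) / (1 - 3 * q.2))
  have hG : ContinuousAt G (ν, 0) := by
    refine Real.continuous_exp.continuousAt.comp (ContinuousAt.div ?_ ?_ (by norm_num))
    · exact Continuous.continuousAt (by fun_prop)
    · exact Continuous.continuousAt (by fun_prop)
  have hG0 : Real.sqrt (1 - ν) ≤ G (ν, 0) := by
    have := sqrt_le_exp_neg_sum h0 h1 K
    simpa [G] using this
  have hev := hG.eventually (lt_mem_nhds (show Real.sqrt (1 - ν) - ε / 2 < G (ν, 0) by linarith))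
  obtain ⟨γ, hγ, hball⟩ := Metric.eventually_nhds_iff.1 hev
  set C : ℝ := 2 * K * ∑ k ∈ Finset.range K, (2 * (k + 1) * 2 ^ (k + 1) : ℝ) with hC
  have hC0 : 0 ≤ C := by positivity
  -- The entries ensure, in order: `4 * δ < γ` and `C * δ < γ` for the continuity of `G`, `C * δ ≤ 1
  -- / 4` for the local lemma, `ν + 4 * δ ≤ r₀`, and `M ≥ 4 * K + 4`.
  set δ := min (min (γ / 8) (γ / (2 * (C + 1)))) (min (min (1 / (4 * (C + 1))) ((1 - ν) / 8))
    (1 / (4 * K + 4))) with hδ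
  have hδpos : 0 < δ := by
    refine lt_min (lt_min (by positivity) (by positivity)) (lt_min (lt_min (by positivity) ?_)
      (by positivity))
    linarith
  have d1 : δ ≤ γ / 8 := (min_le_left _ _).trans (min_le_left _ _)
  have d2 : δ ≤ γ / (2 * (C + 1)) := (min_le_left _ _).trans (min_le_right _ _)
  have d3 : δ ≤ 1 / (4 * (C + 1)) :=
    (min_le_right _ _).trans ((min_le_left _ _).trans (min_le_left _ _))
  have d4 : δ ≤ (1 - ν) / 8 :=
    (min_le_right _ _).trans ((min_le_left _ _).trans (min_le_right _ _))
  have d5 : δ ≤ 1 / (4 * K + 4) := (min_le_right _ _).trans (min_le_right _ _)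
  clear_value δ
  have e2 : C * δ < γ := by
    rw [le_div_iff₀ (by positivity)] at d2
    nlinarith
  have e3 : C * δ ≤ 1 / 4 := by
    rw [le_div_iff₀ (by positivity)] at d3
    nlinarith
  refine ⟨δ, hδpos, fun X V _ f hf => ?_⟩
  set M := Fintype.card X with hM
  set S := (pairs f).card with hS
  have hlarge := hf.large
  have hMK : (4 * K + 4 : ℝ) ≤ M := by
    rw [le_div_iff₀ (by positivity)] at d5
    by_contra hlt
    push Not at hlt
    nlinarith
  have hMKn : 4 * K + 4 ≤ M := by exact_mod_cast hMK
  have hM4 : (4 : ℝ) ≤ M := by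
    have : (0 : ℝ) ≤ K := Nat.cast_nonneg _
    linarith
  have hp := abs_le.1 hf.card_pairs
  have hM1 : (0 : ℝ) < (M : ℝ) - 1 := by linarith
  have hrν : |(S : ℝ) / ((M : ℝ) - 1) - ν| ≤ 4 * δ := by
    rw [abs_le]
    constructor
    · rw [neg_le_sub_iff_le_add, ← sub_le_iff_le_add, le_div_iff₀ hM1]
      nlinarith
    · rw [sub_le_iff_le_add, div_le_iff₀ hM1]
      nlinarith
  have hrr := abs_le.1 hrν
  set r := (S : ℝ) / ((M : ℝ) - 1) with hr
  have hr0 : 0 ≤ r := div_nonneg (Nat.cast_nonneg _) hM1.le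
  have hrr₀ : r ≤ r₀ := by rw [hr₀]; linarith
  have hSM : S ≤ M - 1 := by
    have h2 : r ≤ 1 := by linarith
    rw [hr, div_le_one hM1] at h2
    have : (S : ℝ) + 1 ≤ M := by linarith
    have : S + 1 ≤ M := by exact_mod_cast this
    omega
  set D := ⌊δ * M⌋₊ with hD
  have hDδ : (D : ℝ) ≤ δ * M := Nat.floor_le (by positivity)
  have hdeg : ∀ v, (Finset.univ.filter fun x => f x = v).card ≤ D := by
    intro v
    refine Nat.le_floor ?_
    have h2 := hf.degree v
    nlinarith [show (0 : ℝ) ≤ ((Finset.univ.filter fun x => f x = v).card : ℝ) from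
      Nat.cast_nonneg _]
  have hmain := mcount_not_hasCore_ge f (K := K) (D := D) (η := C * δ) (by omega) hSM hdeg
    (by positivity) e3 ?_
  · have hGr := hball (y := (r, C * δ)) (by
      rw [Prod.dist_eq, max_lt_iff, Real.dist_eq, Real.dist_eq]
      refine ⟨by simp only; linarith, ?_⟩
      simp only [sub_zero]
      rwa [abs_of_nonneg (by positivity)])
    simp only [G] at hGr
    have htail : ∑ k ∈ Finset.Ico K M, r ^ (k + 1) / (2 * ((k : ℝ) + 1)) ≤ ε / 2 := by
      calc ∑ k ∈ Finset.Ico K M, r ^ (k + 1) / (2 * ((k : ℝ) + 1))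
          ≤ ∑ k ∈ Finset.Ico K M, r₀ ^ k := by
            refine Finset.sum_le_sum fun k _ => ?_
            have h2 : r ^ (k + 1) ≤ r₀ ^ (k + 1) := pow_le_pow_left₀ hr0 hrr₀ _
            have h3 : r₀ ^ (k + 1) ≤ r₀ ^ k := pow_le_pow_of_le_one hr₀0.le hr₀1.le (by omega)
            rw [div_le_iff₀ (by positivity)]
            have : (0 : ℝ) ≤ k := Nat.cast_nonneg _
            nlinarith [pow_pos hr₀0 k]
        _ ≤ r₀ ^ K / (1 - r₀) := geom_sum_Ico_le_of_lt_one hr₀0.le hr₀1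
        _ ≤ ε / 2 := by
            rw [div_le_iff₀ (by linarith)]
            exact hK.le
    refine le_trans ?_ hmain
    rw [mul_comm]
    refine mul_le_mul_of_nonneg_left ?_ (Nat.cast_nonneg _)
    rw [← hM, ← hS]
    linarith
  -- A cycle through a given half-edge has at most `D ≤ δ M` choices where one without this
  -- constraint has order `M`; hence each term is of order δ.
  · rw [hC, mul_assoc (2 * (K : ℝ)) _ δ, Finset.sum_mul]
    refine mul_le_mul_of_nonneg_left (Finset.sum_le_sum fun k hk => ?_) (by positivity)
    have hk := Finset.mem_range.1 hk
    have hw := half_pow_le_matchWeight (M := M) (n := k + 1) (by omega)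
    have hMp : (0 : ℝ) < ((M : ℝ) / 2) ^ (k + 1) := by positivity
    rw [div_le_iff₀ (hMp.trans_le hw)]
    have hSMr : (S : ℝ) ≤ M := by exact_mod_cast (by omega : S ≤ M)
    have h4 : (D : ℝ) * S ^ k ≤ δ * M * M ^ k :=
      mul_le_mul hDδ (pow_le_pow_left₀ (Nat.cast_nonneg _) hSMr _) (by positivity) (by positivity)
    have h5 : (2 : ℝ) ^ (k + 1) * (M / 2) ^ (k + 1) = M * M ^ k := by
      rw [← mul_pow, ← pow_succ']
      congr 1
      ring
    calc (2 * ((k : ℝ) + 1) * (D * S ^ k) : ℝ) ≤ 2 * (k + 1) * (δ * M * M ^ k) :=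
          mul_le_mul_of_nonneg_left h4 (by positivity)
      _ = 2 * (k + 1) * 2 ^ (k + 1) * δ * (M / 2) ^ (k + 1) := by
          rw [mul_assoc δ, ← h5]; ring
      _ ≤ _ := mul_le_mul_of_nonneg_left hw (by positivity)

end

/-! ### Two-regular sets of half-edges -/

section

section TwoRegular

variable {X V : Type*} [Fintype X]

/-- The two-regular sets of half-edges at `k` vertices. -/
noncomputable def twoRegularSets (f : X → V) (k : ℕ) : Finset (Finset X) :=
  Finset.univ.filter fun Y => IsTwoRegular f Y ∧ Y.card = 2 * k

theorem mem_twoRegularSets {f : X → V} {k : ℕ} {Y : Finset X} :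
    Y ∈ twoRegularSets f k ↔ IsTwoRegular f Y ∧ Y.card = 2 * k := by simp [twoRegularSets]

theorem card_filter_image_le (f : X → V) {D : ℕ}
    (hD : ∀ v, (Finset.univ.filter fun x => f x = v).card ≤ D) (A : Finset V) :
    (Finset.univ.filter fun x => f x ∈ A).card ≤ A.card * D := by
  have h : (Finset.univ.filter fun x => f x ∈ A) =
      A.biUnion fun v => Finset.univ.filter fun x => f x = v := by
    ext x; simp
  rw [h]
  exact Finset.card_biUnion_le_card_mul _ _ _ fun v _ => hD v

/-- Each vertex of `A` carries at most `D ^ 2` ordered pairs. -/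
theorem pairs_card_le_filter (f : X → V) {D : ℕ}
    (hD : ∀ v, (Finset.univ.filter fun x => f x = v).card ≤ D) (A : Finset V) :
    (pairs f).card ≤ ((pairs f).filter fun p => f p.1 ∉ A).card + A.card * D ^ 2 := by
  have h1 := Finset.card_filter_add_card_filter_not (s := pairs f) (fun p => f p.1 ∉ A)
  have h2 : ((pairs f).filter fun p => ¬ f p.1 ∉ A).card ≤ A.card * D ^ 2 := by
    have h : ((pairs f).filter fun p => ¬ f p.1 ∉ A) ⊆ A.biUnion fun v =>
        (Finset.univ.filter fun x => f x = v) ×ˢ (Finset.univ.filter fun x => f x = v) := by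
      intro p hp
      rw [Finset.mem_filter, mem_pairs, not_not] at hp
      simp [hp.2, hp.1.1.symm]
    refine (Finset.card_le_card h).trans (Finset.card_biUnion_le_card_mul _ _ _ fun v _ => ?_)
    rw [Finset.card_product, sq]
    exact Nat.mul_le_mul (hD v) (hD v)
  omega

/-- Double counting of a two-regular set together with an ordered pair at a new vertex. The enlarged
set and the first element of the pair determine everything: its companion is the only other element
there, so at most `2 * (k + 1)` sources exist. -/
theorem card_twoRegularSets_succ (f : X → V) {D : ℕ}
    (hD : ∀ v, (Finset.univ.filter fun x => f x = v).card ≤ D) (k : ℕ) :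
    (twoRegularSets f k).card * ((pairs f).card - k * D ^ 2) ≤
      2 * (k + 1) * (twoRegularSets f (k + 1)).card := by
  set B := (twoRegularSets f k ×ˢ pairs f).filter fun q => f q.2.1 ∉ q.1.image f with hB
  have hBmem : ∀ q, q ∈ B ↔ (IsTwoRegular f q.1 ∧ q.1.card = 2 * k) ∧
      (f q.2.1 = f q.2.2 ∧ q.2.1 ≠ q.2.2) ∧ f q.2.1 ∉ q.1.image f := by
    intro q
    rw [hB, Finset.mem_filter, Finset.mem_product, mem_twoRegularSets, mem_pairs, and_assoc]
  have h1 : (twoRegularSets f k).card * ((pairs f).card - k * D ^ 2) ≤ B.card := by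
    have : B.card = ∑ Y ∈ twoRegularSets f k,
        ((pairs f).filter fun p => f p.1 ∉ Y.image f).card := by
      rw [hB, Finset.card_filter, Finset.sum_product]
      exact Finset.sum_congr rfl fun Y _ => (Finset.card_filter _ _).symm
    rw [this, ← smul_eq_mul]
    refine Finset.card_nsmul_le_sum _ _ _ fun Y hY => ?_
    rw [mem_twoRegularSets] at hY
    have h2 := pairs_card_le_filter f hD (Y.image f)
    have h3 := hY.1.card_eq
    have h4 : (Y.image f).card = k := by omega
    rw [h4] at h2
    omega
  refine h1.trans (Finset.card_le_mul_card_image_of_maps_to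
    (f := fun q => insert q.2.1 (insert q.2.2 q.1)) ?_ _ ?_)
  · intro q hq
    obtain ⟨⟨hr, hc⟩, ⟨hv, hne⟩, hout⟩ := (hBmem q).1 hq
    have hn1 : q.2.1 ∉ q.1 := fun h => hout (Finset.mem_image_of_mem f h)
    have hn2 : q.2.2 ∉ q.1 := fun h => hout (hv ▸ Finset.mem_image_of_mem f h)
    have hn3 : q.2.1 ∉ insert q.2.2 q.1 := by
      rw [Finset.mem_insert, not_or]; exact ⟨hne, hn1⟩
    rw [mem_twoRegularSets, Finset.card_insert_of_notMem hn3, Finset.card_insert_of_notMem hn2]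
    refine ⟨fun x hx => ?_, by omega⟩
    by_cases hxv : f x = f q.2.1
    · have : (insert q.2.1 (insert q.2.2 q.1)).filter (fun y => f y = f x) =
          {q.2.1, q.2.2} := by
        ext y
        simp only [Finset.mem_filter, Finset.mem_insert, Finset.mem_singleton]
        constructor
        · rintro ⟨h | h | h, e⟩
          · exact Or.inl h
          · exact Or.inr h
          · exact absurd (Finset.mem_image.2 ⟨y, h, e.trans hxv⟩) hout
        · rintro (rfl | rfl)
          · exact ⟨Or.inl rfl, hxv.symm⟩
          · exact ⟨Or.inr (Or.inl rfl), hv.symm.trans hxv.symm⟩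
      rw [this, Finset.card_pair hne]
    · have hx1 : x ∈ q.1 := by
        rw [Finset.mem_insert, Finset.mem_insert] at hx
        rcases hx with rfl | rfl | h
        · exact absurd rfl hxv
        · exact absurd hv.symm hxv
        · exact h
      rw [← hr x hx1]
      congr 1
      ext y
      simp only [Finset.mem_filter, Finset.mem_insert]
      constructor
      · rintro ⟨h | h | h, e⟩
        · exact absurd (e.symm.trans (by rw [h])) hxv
        · exact absurd (e.symm.trans (by rw [h, hv])) hxv
        · exact ⟨h, e⟩
      · rintro ⟨h, e⟩
        exact ⟨Or.inr (Or.inr h), e⟩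
  · intro Y' hY'
    rw [mem_twoRegularSets] at hY'
    have : 2 * (k + 1) = Y'.card := hY'.2.symm
    rw [this]
    refine Finset.card_le_card_of_injOn (fun q => q.2.1) ?_ ?_
    · intro q hq
      rw [Finset.mem_coe, Finset.mem_filter] at hq
      rw [Finset.mem_coe, ← hq.2]
      exact Finset.mem_insert_self _ _
    · intro q hq q' hq' e
      rw [Finset.mem_coe, Finset.mem_filter, hBmem] at hq hq'
      obtain ⟨⟨_, ⟨hv, hne⟩, hout⟩, hY1⟩ := hq
      obtain ⟨⟨_, ⟨hv', hne'⟩, hout'⟩, hY2⟩ := hq'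
      simp only at e
      have m1 : q.2.1 ∈ Y' := by rw [← hY1]; exact Finset.mem_insert_self _ _
      have m2 : q.2.2 ∈ Y' := by
        rw [← hY1]; exact Finset.mem_insert_of_mem (Finset.mem_insert_self _ _)
      have m3 : q'.2.2 ∈ Y' := by
        rw [← hY2]; exact Finset.mem_insert_of_mem (Finset.mem_insert_self _ _)
      have e2 : q.2.2 = q'.2.2 := by
        by_contra h23
        have h3 : ({q.2.1, q.2.2, q'.2.2} : Finset X) ⊆ Y'.filter fun y => f y = f q.2.1 := by
          intro y hy
          simp only [Finset.mem_insert, Finset.mem_singleton] at hy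
          rw [Finset.mem_filter]
          rcases hy with rfl | rfl | rfl
          · exact ⟨m1, rfl⟩
          · exact ⟨m2, hv.symm⟩
          · exact ⟨m3, by rw [e, hv']⟩
        have h4 := Finset.card_le_card h3
        rw [hY'.1 _ m1, Finset.card_eq_three.2 ⟨_, _, _, hne, by rw [e]; exact hne', h23, rfl⟩] at h4
        omega
      have e3 : q.2 = q'.2 := Prod.ext e e2
      have e4 : ∀ r : Finset X × (X × X), f r.2.1 = f r.2.2 → f r.2.1 ∉ r.1.image f →
          r.1 = (insert r.2.1 (insert r.2.2 r.1)) \ {r.2.1, r.2.2} := by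
        intro r h1 h2
        ext y
        simp only [Finset.mem_sdiff, Finset.mem_insert, Finset.mem_singleton]
        constructor
        · intro hy
          refine ⟨Or.inr (Or.inr hy), ?_⟩
          rintro (rfl | rfl)
          · exact h2 (Finset.mem_image_of_mem f hy)
          · exact h2 (h1 ▸ Finset.mem_image_of_mem f hy)
        · tauto
      refine Prod.ext ?_ e3
      rw [e4 q hv hout, e4 q' hv' hout', hY1, hY2, e3]

theorem card_twoRegularSets_ge (f : X → V) {D : ℕ}
    (hD : ∀ v, (Finset.univ.filter fun x => f x = v).card ≤ D) (K : ℕ) :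
    ∀ k ≤ K, ((pairs f).card - K * D ^ 2) ^ k ≤
      2 ^ k * k.factorial * (twoRegularSets f k).card := by
  intro k
  induction k with
  | zero =>
    intro _
    have : (∅ : Finset X) ∈ twoRegularSets f 0 :=
      mem_twoRegularSets.2 ⟨fun x hx => by simp at hx, by simp⟩
    have := Finset.card_pos.2 ⟨_, this⟩
    simp only [pow_zero, Nat.factorial_zero, mul_one, one_mul]
    omega
  | succ k ih =>
    intro hk
    have h1 := ih (by omega)
    have h2 := card_twoRegularSets_succ f hD k
    have h3 : (pairs f).card - K * D ^ 2 ≤ (pairs f).card - k * D ^ 2 := by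
      have : k * D ^ 2 ≤ K * D ^ 2 := Nat.mul_le_mul_right _ (by omega)
      omega
    calc ((pairs f).card - K * D ^ 2) ^ (k + 1)
        ≤ (2 ^ k * k.factorial * (twoRegularSets f k).card) * ((pairs f).card - k * D ^ 2) := by
          rw [pow_succ]; exact Nat.mul_le_mul h1 h3
      _ = 2 ^ k * k.factorial * ((twoRegularSets f k).card * ((pairs f).card - k * D ^ 2)) := by
          ring
      _ ≤ 2 ^ k * k.factorial * (2 * (k + 1) * (twoRegularSets f (k + 1)).card) :=
          Nat.mul_le_mul_left _ h2
      _ = _ := by rw [Nat.factorial_succ]; ring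

/-- Disjointness of the events that the cycles are exactly those on a given set of half-edges. -/
theorem sum_contract_le_mcount_hasUnicyclic [Finite V] (f : X → V) (K : ℕ) (x₀ : Finset X → X)
    (hx₀ : ∀ Y : Finset X, Y.Nonempty → x₀ Y ∈ Y) :
    ∑ k ∈ Finset.Icc 1 K, ∑ Y ∈ twoRegularSets f k, pm (2 * k) *
      mcount (fun m => ¬ HasCore (contract f Y (f (x₀ Y))) m) ≤
      mcount fun m => HasUnicyclic f m := by
  -- In the event `E Y`, the set `Y` carries all the cycles and no component has more than one.
  let E : Finset X → Equiv.Perm X → Prop := fun Y m => ∃ h : ∀ x, m x ∈ Y ↔ x ∈ Y,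
    ¬ HasCore (contract f Y (f (x₀ Y))) (m.subtypePerm fun x => not_congr (h x))
  have hE : ∀ k, ∀ Y ∈ twoRegularSets f k, mcount (E Y) =
      pm (2 * k) * mcount (fun m => ¬ HasCore (contract f Y (f (x₀ Y))) m) := by
    intro k Y hY
    rw [mem_twoRegularSets] at hY
    have h1 := mcount_split (fun x => x ∈ Y) (fun _ => True)
      (fun m => ¬ HasCore (contract f Y (f (x₀ Y))) m)
    rw [mcount_true, Nat.card_eq_fintype_card, Fintype.card_coe, hY.2] at h1
    rw [← h1]
    exact mcount_congr fun m _ => ⟨fun ⟨h, h'⟩ => ⟨h, trivial, h'⟩, fun ⟨h, _, h'⟩ => ⟨h, h'⟩⟩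
  have hdisj : ∀ Y Y', IsTwoRegular f Y → IsTwoRegular f Y' → ∀ m, IsMatching m → E Y m →
      E Y' m → Y = Y' := by
    rintro Y Y' hY hY' m hm ⟨h, hno⟩ ⟨h', hno'⟩
    refine Finset.Subset.antisymm ?_ ?_
    · by_contra hne
      exact hno' (hasCore_contract hm _ hY h' h hne)
    · by_contra hne
      exact hno (hasCore_contract hm _ hY' h h' hne)
  set I := (Finset.Icc 1 K).biUnion fun k => twoRegularSets f k with hI
  have hpd : Set.PairwiseDisjoint (↑(Finset.Icc 1 K)) fun k => twoRegularSets f k := by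
    intro k _ k' _ hkk'
    refine Finset.disjoint_left.2 fun Y hY hY' => hkk' ?_
    rw [mem_twoRegularSets] at hY hY'
    omega
  have hIr : ∀ Y ∈ I, IsTwoRegular f Y ∧ Y.Nonempty := by
    intro Y hY
    rw [hI, Finset.mem_biUnion] at hY
    obtain ⟨k, hk, hY⟩ := hY
    rw [mem_twoRegularSets] at hY
    rw [Finset.mem_Icc] at hk
    exact ⟨hY.1, Finset.card_pos.1 (by omega)⟩
  have hsum : ∑ k ∈ Finset.Icc 1 K, ∑ Y ∈ twoRegularSets f k, pm (2 * k) *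
      mcount (fun m => ¬ HasCore (contract f Y (f (x₀ Y))) m) = ∑ Y ∈ I, mcount (E Y) := by
    rw [hI, Finset.sum_biUnion hpd]
    exact Finset.sum_congr rfl fun k _ => Finset.sum_congr rfl fun Y hY => (hE k Y hY).symm
  rw [hsum]
  simp only [← card_matchings_filter]
  rw [← Finset.card_biUnion]
  · refine Finset.card_le_card fun m hm => ?_
    obtain ⟨Y, hY, hm⟩ := Finset.mem_biUnion.1 hm
    rw [Finset.mem_filter] at hm ⊢
    obtain ⟨hmm, h, hno⟩ := hm
    obtain ⟨hr, hne⟩ := hIr Y hY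
    exact ⟨hmm, hr.hasUnicyclic (mem_matchings.1 hmm) (hx₀ Y hne) h hno⟩
  · intro Y hY Y' hY' hne
    refine Finset.disjoint_left.2 fun m hm hm' => hne ?_
    rw [Finset.mem_filter] at hm hm'
    exact hdisj Y Y' (hIr Y hY).1 (hIr Y' hY').1 m (mem_matchings.1 hm.1) hm.2 hm'.2

end TwoRegular

end

/-! ### Perturbations of a degree sequence -/

section

/-- The double factorial quotient is the coefficient of `x ^ n` in `(1 - x) ^ (-1/2)`. -/
theorem pm_two_mul_div (n : ℕ) :
    (pm (2 * n) : ℝ) / (2 ^ n * n.factorial) = Ring.choose ((1 / 2 : ℝ) + n - 1) n := by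
  have h1 : (pm (2 * n) : ℝ) / 2 ^ n = (ascPochhammer ℝ n).eval (1 / 2) := by
    induction n with
    | zero => simp [pm]
    | succ n ih =>
      rw [ascPochhammer_succ_eval, ← ih, show 2 * (n + 1) = 2 * n + 2 from by ring, pm, pow_succ]
      push_cast
      field_simp
      ring
  rw [← div_div, h1, ← Ring.multichoose_eq, div_eq_iff (by positivity), mul_comm, ← nsmul_eq_mul,
    Ring.factorial_nsmul_multichoose_eq_ascPochhammer, Polynomial.ascPochhammer_smeval_eq_eval]

theorem hasSum_pm {ν : ℝ} (h0 : 0 ≤ ν) (h1 : ν < 1) :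
    HasSum (fun k : ℕ => (pm (2 * k) : ℝ) / (2 ^ k * k.factorial) * ν ^ k)
      (1 / Real.sqrt (1 - ν)) := by
  have h := (Real.one_div_one_sub_rpow_hasFPowerSeriesOnBall_zero (1 / 2)).hasSum (y := ν) (by
    rw [Metric.mem_eball, edist_zero_right, Real.enorm_eq_ofReal h0]
    exact ENNReal.ofReal_lt_one.2 h1)
  rw [zero_add, ← Real.sqrt_eq_rpow] at h
  have e : (fun k : ℕ => (pm (2 * k) : ℝ) / (2 ^ k * k.factorial) * ν ^ k) = fun n =>
      (FormalMultilinearSeries.ofScalars ℝ (fun n => Ring.choose ((1 / 2 : ℝ) + n - 1) n) n)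
        fun _ => ν := by
    funext k
    rw [FormalMultilinearSeries.ofScalars_apply_eq, pm_two_mul_div, smul_eq_mul]
  rw [e]
  exact h

/-- Bounded perturbations of a degree sequence stay near the limiting regime. -/
theorem IsNearRegime.perturb {ν δ δ' : ℝ} (h0 : 0 ≤ ν) (h1 : ν < 1) {X V X' V' : Type}
    [Fintype X] [Fintype X'] {f : X → V} {g : X' → V'} {L j : ℕ} (hf : IsNearRegime ν δ f)
    (hδ : 0 < δ) (hδ' : 2 * (1 + L) ^ 2 * δ ≤ δ') (hδL : (4 * L + 4) * δ ≤ 1) (hj : j ≤ L)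
    (hc : Fintype.card X' + 2 * j = Fintype.card X)
    (hp : |((pairs g).card : ℝ) - (pairs f).card| ≤ L ^ 2 * (δ * Fintype.card X))
    (hd : ∀ v, ((Finset.univ.filter fun x => g x = v).card : ℝ) ^ 2 ≤
      L ^ 2 * (δ * Fintype.card X)) : IsNearRegime ν δ' g := by
  set M := Fintype.card X with hM
  set M' := Fintype.card X' with hM'
  have hlarge := hf.large
  have hcr : (M' : ℝ) = M - 2 * j := by
    have : (M' : ℝ) + 2 * j = M := by exact_mod_cast hc
    linarith
  have hjL : (j : ℝ) ≤ L := by exact_mod_cast hj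
  have hj0 : (0 : ℝ) ≤ j := Nat.cast_nonneg _
  have hML : (4 * L + 4 : ℝ) ≤ M := by
    by_contra hlt
    push Not at hlt
    nlinarith
  have hM2 : (M : ℝ) / 2 ≤ M' := by rw [hcr]; linarith
  have hL0 : (0 : ℝ) ≤ L := Nat.cast_nonneg _
  -- The errors add up to `(L ^ 2 + 1 + 2 * L) δ M`; the factor 2 in `hδ'` pays for `M' ≥ M / 2`.
  have hkey : (1 + L : ℝ) ^ 2 * (δ * M) ≤ δ' * M' := by
    have : δ' * (M / 2) ≤ δ' * M' := by
      refine mul_le_mul_of_nonneg_left hM2 (le_trans ?_ hδ')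
      positivity
    have h2 := mul_le_mul_of_nonneg_right hδ' (show (0 : ℝ) ≤ M / 2 by linarith)
    nlinarith
  refine ⟨?_, ?_, ?_, fun v => ?_⟩
  · have h := hf.even
    rw [← hM, ← hc] at h
    rw [← hM']
    simpa [parity_simps] using h
  · nlinarith [hlarge]
  · rw [← hM']
    refine le_trans ?_ hkey
    have h2 := hf.card_pairs
    rw [← hM] at h2
    have h3 : ((pairs g).card : ℝ) - ν * M' =
        (((pairs g).card : ℝ) - (pairs f).card) + (((pairs f).card : ℝ) - ν * M) + ν * (2 * j) := by
      rw [hcr]; ring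
    have h4 : ν * (2 * j) ≤ 2 * L * (δ * M) := by
      have h5 : ν * (2 * j) ≤ 1 * (2 * j) := mul_le_mul_of_nonneg_right h1.le (by positivity)
      have h6 : 2 * (L : ℝ) * 1 ≤ 2 * L * (δ * M) := mul_le_mul_of_nonneg_left hlarge (by positivity)
      linarith
    have h7 : |ν * (2 * j)| = ν * (2 * j) := abs_of_nonneg (by positivity)
    rw [h3]
    refine (abs_add_le _ _).trans ?_
    refine (add_le_add_left (abs_add_le _ _) _).trans ?_
    rw [h7]
    nlinarith
  · rw [← hM']
    refine (hd v).trans (le_trans ?_ hkey)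
    refine mul_le_mul_of_nonneg_right ?_ (by positivity)
    nlinarith

/-- An integer bound for all degrees with the same quadratic estimate, so that counts of pairs at
boundedly many vertices are `O(δ M)`. -/
theorem exists_degree_bound {X V : Type*} [Fintype X] {f : X → V} {ν δ : ℝ}
    (hf : IsNearRegime ν δ f) : ∃ D : ℕ,
      (∀ v, (Finset.univ.filter fun x => f x = v).card ≤ D) ∧
      (D : ℝ) ^ 2 ≤ δ * Fintype.card X := by
  have h0 : (0 : ℝ) ≤ δ * Fintype.card X := zero_le_one.trans hf.large
  refine ⟨⌊Real.sqrt (δ * Fintype.card X)⌋₊, fun v => ?_, ?_⟩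
  · refine Nat.le_floor (Real.le_sqrt_of_sq_le (hf.degree v))
  · calc ((⌊Real.sqrt (δ * Fintype.card X)⌋₊ : ℕ) : ℝ) ^ 2
        ≤ (Real.sqrt (δ * Fintype.card X)) ^ 2 :=
          pow_le_pow_left₀ (Nat.cast_nonneg _) (Nat.floor_le (Real.sqrt_nonneg _)) 2
      _ = _ := Real.sq_sqrt h0

/-- At most `K * D` half-edges sit at touched vertices. Contraction thus creates a vertex of degree
at most `K * D` and changes the number of pairs by at most `(K * D) ^ 2`, which is at most `K ^ 2 *
δ * M`. -/
theorem isNearRegime_contract {ν δ δ' : ℝ} (h0 : 0 ≤ ν) (h1 : ν < 1) {X V : Type}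
    [Fintype X] {f : X → V} {K k : ℕ} (hf : IsNearRegime ν δ f)
    (hδ : 0 < δ) (hδ' : 2 * (1 + (K + 1 : ℕ)) ^ 2 * δ ≤ δ')
    (hδL : (4 * (K + 1 : ℕ) + 4) * δ ≤ 1) (hk : k ≤ K)
    {Y : Finset X} (hY : Y ∈ twoRegularSets f k) (x₀ : X) (hx₀ : x₀ ∈ Y) :
    IsNearRegime ν δ' (contract f Y (f x₀)) := by
  obtain ⟨D, hD, hDsq⟩ := exists_degree_bound hf
  rw [mem_twoRegularSets] at hY
  have himg : (Y.image f).card = k := by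
    have := hY.1.card_eq
    omega
  set T := Finset.univ.filter fun x => f x ∈ Y.image f with hT
  have hTc : T.card ≤ K * D := by
    have := card_filter_image_le f hD (Y.image f)
    rw [himg] at this
    exact this.trans (Nat.mul_le_mul_right _ hk)
  have hKD : ((K * D : ℕ) : ℝ) ^ 2 ≤ ((K + 1 : ℕ) : ℝ) ^ 2 * (δ * Fintype.card X) := by
    push_cast
    rw [mul_pow]
    refine mul_le_mul ?_ hDsq (by positivity) (by positivity)
    have : (0 : ℝ) ≤ K := Nat.cast_nonneg _
    nlinarith
  have himp : ∀ x : {x // ¬ x ∈ Y}, contract f Y (f x₀) x = f x₀ → x.1 ∈ T := by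
    intro x hx
    rw [hT, Finset.mem_filter]
    refine ⟨Finset.mem_univ _, ?_⟩
    by_contra h
    rw [contract, if_neg h] at hx
    exact h (hx ▸ Finset.mem_image_of_mem f hx₀)
  refine hf.perturb h0 h1 hδ hδ' hδL (j := k) (by omega) ?_ ?_ ?_
  · rw [← hY.2, Fintype.card_subtype_compl, Fintype.card_coe]
    have := Finset.card_le_univ Y
    omega
  · refine le_trans ?_ hKD
    have e1 : (pairs (contract f Y (f x₀))).card ≤
        (pairs f).card + (K * D) ^ 2 := by
      have hsub : (pairs (contract f Y (f x₀))).map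
          ((Function.Embedding.subtype _).prodMap (Function.Embedding.subtype _)) ⊆
          pairs f ∪ T ×ˢ T := by
        intro p hp
        obtain ⟨q, hq, rfl⟩ := Finset.mem_map.1 hp
        rw [mem_pairs] at hq
        obtain ⟨hq1, hq2⟩ := hq
        rw [Finset.mem_union, mem_pairs, Finset.mem_product]
        change (f q.1.1 = f q.2.1 ∧ q.1.1 ≠ q.2.1) ∨ (q.1.1 ∈ T ∧ q.2.1 ∈ T)
        have hq2' : q.1.1 ≠ q.2.1 := fun e => hq2 (Subtype.ext e)
        by_cases ha : f q.1.1 ∈ Y.image f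
        · right
          refine ⟨Finset.mem_filter.2 ⟨Finset.mem_univ _, ha⟩, himp _ ?_⟩
          rw [← hq1, contract, if_pos ha]
        · by_cases hb : f q.2.1 ∈ Y.image f
          · right
            refine ⟨himp _ ?_, Finset.mem_filter.2 ⟨Finset.mem_univ _, hb⟩⟩
            rw [hq1, contract, if_pos hb]
          · left
            rw [contract, contract, if_neg ha,
              if_neg hb] at hq1
            exact ⟨hq1, hq2'⟩
      have := Finset.card_le_card hsub
      rw [Finset.card_map] at this
      refine this.trans ((Finset.card_union_le _ _).trans ?_)
      rw [Finset.card_product, sq]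
      exact Nat.add_le_add_left (Nat.mul_le_mul hTc hTc) _
    have e2 : (pairs f).card ≤
        (pairs (contract f Y (f x₀))).card + (K * D) ^ 2 := by
      have hsub : pairs f ⊆ (pairs (contract f Y (f x₀))).map
          ((Function.Embedding.subtype _).prodMap (Function.Embedding.subtype _)) ∪ T ×ˢ T := by
        intro p hp
        rw [mem_pairs] at hp
        rw [Finset.mem_union, Finset.mem_product]
        by_cases ha : f p.1 ∈ Y.image f
        · right
          exact ⟨Finset.mem_filter.2 ⟨Finset.mem_univ _, ha⟩,
            Finset.mem_filter.2 ⟨Finset.mem_univ _, hp.1 ▸ ha⟩⟩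
        · left
          have hb : f p.2 ∉ Y.image f := hp.1 ▸ ha
          refine Finset.mem_map.2 ⟨(⟨p.1, fun h => ha (Finset.mem_image_of_mem f h)⟩,
            ⟨p.2, fun h => hb (Finset.mem_image_of_mem f h)⟩), mem_pairs.2 ⟨?_, ?_⟩, rfl⟩
          · simp only [contract, if_neg hb, hp.1]
          · exact fun e => hp.2 (congrArg Subtype.val e)
      have := Finset.card_le_card hsub
      refine this.trans ((Finset.card_union_le _ _).trans ?_)
      rw [Finset.card_map, Finset.card_product, sq (K * D)]
      exact Nat.add_le_add_left (Nat.mul_le_mul hTc hTc) _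
    have e1' : ((pairs (contract f Y (f x₀))).card : ℝ) ≤
        (pairs f).card + ((K * D : ℕ) : ℝ) ^ 2 := by exact_mod_cast e1
    have e2' : ((pairs f).card : ℝ) ≤
        (pairs (contract f Y (f x₀))).card + ((K * D : ℕ) : ℝ) ^ 2 := by
      exact_mod_cast e2
    rw [abs_le]
    constructor <;> linarith
  · intro v
    by_cases hv : v = f x₀
    · refine le_trans (pow_le_pow_left₀ (Nat.cast_nonneg _) ?_ 2) hKD
      refine Nat.cast_le.2 (le_trans ?_ hTc)
      refine Finset.card_le_card_of_injOn Subtype.val ?_ Subtype.val_injective.injOn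
      intro x hx
      rw [Finset.mem_coe, Finset.mem_filter] at hx
      exact himp x (hx.2.trans hv)
    · have hL : (1 : ℝ) ≤ ((K + 1 : ℕ) : ℝ) ^ 2 := by
        refine one_le_pow₀ ?_
        exact_mod_cast Nat.succ_le_succ (Nat.zero_le K)
      have hdv := hf.degree v
      refine le_trans (pow_le_pow_left₀ (Nat.cast_nonneg _) ?_ 2)
        (hdv.trans (le_mul_of_one_le_left (by positivity) hL))
      refine Nat.cast_le.2 ?_
      refine Finset.card_le_card_of_injOn Subtype.val ?_ Subtype.val_injective.injOn
      intro x hx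
      rw [Finset.mem_coe, Finset.mem_filter] at hx
      rw [Finset.mem_coe, Finset.mem_filter]
      refine ⟨Finset.mem_univ _, ?_⟩
      have hx2 := hx.2
      unfold contract at hx2
      split_ifs at hx2 with h
      · exact absurd hx2.symm hv
      · exact hx2

end

/-! ### The probability of having no unicyclic component -/

section

/-- Match `k` half-edges one after the other, then the rest arbitrarily. -/
theorem pm_eq_matchWeight_mul {n : ℕ} : ∀ k, 2 * k ≤ n → pm n = matchWeight n k * pm (n - 2 * k) := by
  intro k
  induction k with
  | zero => intro _; simp [matchWeight]
  | succ k ih =>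
    intro hk
    obtain ⟨j, hj⟩ : ∃ j, n - 2 * k = j + 2 := ⟨n - 2 * k - 2, by omega⟩
    have e1 : n - 2 * (k + 1) = j := by omega
    have e2 : n - 1 - 2 * k = j + 1 := by omega
    rw [ih (by omega), hj, pm, matchWeight, matchWeight, Finset.prod_range_succ, e1, e2, mul_assoc]

theorem matchWeight_le_pow (M n : ℕ) : matchWeight M n ≤ M ^ n := by
  have : M ^ n = ∏ _l ∈ Finset.range n, M := by rw [Finset.prod_const, Finset.card_range]
  rw [this]
  exact Finset.prod_le_prod' fun l _ => by omega

theorem IsNearRegime.mono {ν δ δ' : ℝ} {X V : Type*} [Fintype X] {f : X → V}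
    (h : IsNearRegime ν δ f) (hδ : δ ≤ δ') : IsNearRegime ν δ' f := by
  have : δ * Fintype.card X ≤ δ' * Fintype.card X :=
    mul_le_mul_of_nonneg_right hδ (Nat.cast_nonneg _)
  exact ⟨h.even, h.large.trans this, h.card_pairs.trans this, fun v => (h.degree v).trans this⟩

theorem mcount_not {X : Type*} [Finite X] (P : Equiv.Perm X → Prop) :
    mcount P + mcount (fun m => ¬ P m) = mcount (fun _ : Equiv.Perm X => True) := by
  have := Fintype.ofFinite X
  simp only [← card_matchings_filter]
  rw [Finset.card_filter_add_card_filter_not, Finset.filter_true]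

/-- The contribution of cycles covering exactly `k` vertices: the number of two-regular sets, times
the matchings of each, times the forest bound for the contracted remainder. -/
theorem sum_twoRegular_ge {ν δ δ₁ ε₁ s : ℝ} (h0 : 0 ≤ ν) (h1 : ν < 1) {X V : Type} [Fintype X]
    {f : X → V} (hf : IsNearRegime ν δ f) (hδ : 0 < δ) (hs : 0 ≤ s - ε₁) {K : ℕ}
    (hδ₁ : ∀ (X V : Type) [Fintype X] (f : X → V), IsNearRegime ν δ₁ f →
      (s - ε₁) * mcount (fun _ : Equiv.Perm X => True) ≤ mcount fun m => ¬ HasCore f m)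
    (hδ' : 2 * (1 + (K + 1 : ℕ)) ^ 2 * δ ≤ δ₁) (hδL : (4 * (K + 1 : ℕ) + 4) * δ ≤ 1)
    (x₀ : Finset X → X) (hx₀ : ∀ Y : Finset X, Y.Nonempty → x₀ Y ∈ Y) {k : ℕ}
    (hk : k ∈ Finset.Icc 1 K) :
    (s - ε₁) * ((pm (2 * k) : ℝ) / (2 ^ k * k.factorial) * (max 0 (ν - (K + 1) * δ)) ^ k) *
      mcount (fun _ : Equiv.Perm X => True) ≤
    ((∑ Y ∈ twoRegularSets f k, pm (2 * k) *
      mcount (fun m => ¬ HasCore (contract f Y (f (x₀ Y))) m) : ℕ) : ℝ) := by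
  rw [Finset.mem_Icc] at hk
  set t := max 0 (ν - (K + 1) * δ) with ht
  set M := Fintype.card X with hM
  have hlarge := hf.large
  have hMK : 2 * k ≤ M := by
    have h2 : (4 * (K + 1 : ℕ) + 4 : ℝ) ≤ M := by
      by_contra hlt
      push Not at hlt
      nlinarith
    have h3 : 4 * (K + 1) + 4 ≤ M := by exact_mod_cast h2
    omega
  have hterm : ∀ Y ∈ twoRegularSets f k, (pm (2 * k) : ℝ) * ((s - ε₁) * pm (M - 2 * k)) ≤
      ((pm (2 * k) * mcount (fun m => ¬ HasCore (contract f Y (f (x₀ Y))) m) : ℕ) : ℝ) := by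
    intro Y hY
    have hYc := (mem_twoRegularSets.1 hY).2
    have hYne : Y.Nonempty := Finset.card_pos.1 (by omega)
    have hnear := isNearRegime_contract h0 h1 hf hδ hδ' hδL hk.2 hY _ (hx₀ Y hYne)
    have h2 := hδ₁ _ _ _ hnear
    rw [mcount_true, Nat.card_eq_fintype_card, Fintype.card_subtype_compl, Fintype.card_coe,
      hYc] at h2
    push_cast
    exact mul_le_mul_of_nonneg_left h2 (Nat.cast_nonneg _)
  obtain ⟨D, hD, hDsq⟩ := exists_degree_bound hf
  have hcount := card_twoRegularSets_ge f hD K k hk.2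
  -- `S - K * D ^ 2` is at least `(ν - δ) M - K δ M`, which is where `(K + 1) * δ` comes from; the
  -- maximum with 0 covers small ν.
  have htM : (t * M) ^ k ≤ 2 ^ k * k.factorial * (twoRegularSets f k).card := by
    rcases le_total (ν - (K + 1) * δ) 0 with hle | hge
    · rw [ht, max_eq_left hle, zero_mul, zero_pow (by omega)]
      positivity
    · have hcast : (((pairs f).card - K * D ^ 2 : ℕ) : ℝ) ^ k ≤
          2 ^ k * k.factorial * (twoRegularSets f k).card := by exact_mod_cast hcount
      refine le_trans (pow_le_pow_left₀ (by positivity) ?_ k) hcast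
      have h2 : ((pairs f).card : ℝ) ≤ (((pairs f).card - K * D ^ 2 : ℕ) : ℝ) + K * (D : ℝ) ^ 2 := by
        exact_mod_cast (by omega : (pairs f).card ≤ (pairs f).card - K * D ^ 2 + K * D ^ 2)
      have h3 := (abs_le.1 hf.card_pairs).1
      have h4 : (K : ℝ) * (D : ℝ) ^ 2 ≤ K * (δ * M) :=
        mul_le_mul_of_nonneg_left hDsq (Nat.cast_nonneg _)
      rw [ht, max_eq_right hge]
      nlinarith
  push_cast
  push_cast at hterm
  refine le_trans ?_ (Finset.card_nsmul_le_sum _ _ _ hterm)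
  rw [nsmul_eq_mul, mcount_true, Nat.card_eq_fintype_card, ← hM, pm_eq_matchWeight_mul k hMK]
  push_cast
  have hw : (matchWeight M k : ℝ) ≤ (M : ℝ) ^ k := by exact_mod_cast matchWeight_le_pow M k
  have hq : t ^ k * (matchWeight M k : ℝ) / (2 ^ k * k.factorial) ≤ (twoRegularSets f k).card := by
    rw [div_le_iff₀ (by positivity)]
    have ht0 : 0 ≤ t := le_max_left _ _
    calc t ^ k * (matchWeight M k : ℝ) ≤ t ^ k * (M : ℝ) ^ k :=
          mul_le_mul_of_nonneg_left hw (by positivity)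
      _ = (t * M) ^ k := (mul_pow _ _ _).symm
      _ ≤ _ := htM
      _ = _ := mul_comm _ _
  have hc : (0 : ℝ) ≤ pm (2 * k) * ((s - ε₁) * pm (M - 2 * k)) := by positivity
  calc _ = (t ^ k * (matchWeight M k : ℝ) / (2 ^ k * k.factorial)) *
        (pm (2 * k) * ((s - ε₁) * pm (M - 2 * k))) := by ring
    _ ≤ _ := mul_le_mul_of_nonneg_right hq hc

/-- Near the limiting regime, the configuration model has no unicyclic component with probability
close to `√(1 - ν)`. -/
theorem exists_not_hasUnicyclic_near {ν : ℝ} (h0 : 0 ≤ ν) (h1 : ν < 1) {ε : ℝ} (hε : 0 < ε) :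
    ∃ δ > 0, ∀ (X V : Type) [Fintype X] [Finite V] (f : X → V), IsNearRegime ν δ f →
      |(mcount (fun m => ¬ HasUnicyclic f m) : ℝ) -
        Real.sqrt (1 - ν) * mcount (fun _ : Equiv.Perm X => True)| ≤
      ε * mcount (fun _ : Equiv.Perm X => True) := by
  set s := Real.sqrt (1 - ν) with hs
  have hs0 : 0 < s := Real.sqrt_pos.2 (by linarith)
  have hs1 : s ≤ 1 := by
    exact Real.sqrt_le_iff.2 ⟨by norm_num, by linarith⟩
  let a : ℕ → ℝ := fun k => (pm (2 * k) : ℝ) / (2 ^ k * k.factorial)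
  have ha0 : ∀ k, 0 ≤ a k := fun k => by positivity
  have hsum : HasSum (fun k => a k * ν ^ k) (1 / s) := hasSum_pm h0 h1
  let b : ℕ → ℝ → ℝ := fun K t => ∑ k ∈ Finset.Icc 1 K, a k * t ^ k
  have hb : ∀ K, b K ν = ∑ k ∈ Finset.range (K + 1), a k * ν ^ k - 1 := by
    intro K
    rw [Finset.range_eq_Ico, Finset.sum_eq_sum_Ico_succ_bot (by omega)]
    have : Finset.Ico (0 + 1) (K + 1) = Finset.Icc 1 K := by
      ext; simp only [Finset.mem_Ico, Finset.mem_Icc]; omega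
    rw [this]
    simp [a, b, pm]
  obtain ⟨K, hK⟩ : ∃ K, 1 / s - 1 - ε / 2 < b K ν := by
    have h2 := (hsum.tendsto_sum_nat.comp (tendsto_add_atTop_nat 1)).eventually
      (lt_mem_nhds (show 1 / s - ε / 2 < 1 / s by linarith))
    obtain ⟨K, hK⟩ := h2.exists
    refine ⟨K, ?_⟩
    rw [hb]
    simp only [Function.comp_apply] at hK
    linarith
  have hbc : Continuous (b K) := by
    refine continuous_finsetSum _ fun k _ => ?_
    fun_prop
  obtain ⟨γ, hγ, hball⟩ := Metric.eventually_nhds_iff.1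
    (hbc.continuousAt.eventually (lt_mem_nhds hK))
  -- With this choice `ε₁ / s ≤ ε / 2`, while the minimum keeps `s - ε₁` nonnegative.
  set ε₁ := s * min ε 1 / 2 with hε₁
  have hmin : min ε 1 ≤ 1 := min_le_right _ _
  have hmin' : min ε 1 ≤ ε := min_le_left _ _
  have hmin0 : 0 < min ε 1 := lt_min hε one_pos
  have hε₁0 : 0 < ε₁ := by positivity
  have hε₁s : 0 ≤ s - ε₁ := by rw [hε₁]; nlinarith
  have hε₁ε : ε₁ ≤ ε := by rw [hε₁]; nlinarith
  obtain ⟨δ₁, hδ₁0, hδ₁⟩ := exists_forest_lower h0 h1 hε₁0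
  set δ := min (min δ₁ (δ₁ / (2 * (1 + (K + 1 : ℕ)) ^ 2)))
    (min (1 / (4 * (K + 1 : ℕ) + 4)) (γ / (2 * (K + 1)))) with hδ
  have hδ0 : 0 < δ :=
    lt_min (lt_min hδ₁0 (by positivity)) (lt_min (by positivity) (by positivity))
  have d1 : δ ≤ δ₁ := (min_le_left _ _).trans (min_le_left _ _)
  have d2 : δ ≤ δ₁ / (2 * (1 + (K + 1 : ℕ)) ^ 2) := (min_le_left _ _).trans (min_le_right _ _)
  have d3 : δ ≤ 1 / (4 * (K + 1 : ℕ) + 4) := (min_le_right _ _).trans (min_le_left _ _)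
  have d4 : δ ≤ γ / (2 * (K + 1)) := (min_le_right _ _).trans (min_le_right _ _)
  clear_value δ
  rw [le_div_iff₀ (by positivity)] at d2 d3 d4
  refine ⟨δ, hδ0, fun X V _ _ f hf => ?_⟩
  set N := mcount (fun _ : Equiv.Perm X => True) with hN
  have hN0 : (0 : ℝ) ≤ N := Nat.cast_nonneg _
  have hlow : (s - ε) * N ≤ (mcount (fun m => ¬ HasUnicyclic f m) : ℝ) := by
    have h2 := hδ₁ X V f (hf.mono d1)
    have h3 : mcount (fun m => ¬ HasCore f m) ≤ mcount fun m => ¬ HasUnicyclic f m :=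
      mcount_mono fun m hm h hu => h (hu.hasCore hm)
    have h4 : ((mcount (fun m => ¬ HasCore f m) : ℕ) : ℝ) ≤ mcount fun m => ¬ HasUnicyclic f m :=
      by exact_mod_cast h3
    nlinarith
  have hup : (mcount (fun m => ¬ HasUnicyclic f m) : ℝ) ≤ (s + ε) * N := by
    have hXne : Nonempty X := by
      by_contra hne
      rw [not_nonempty_iff] at hne
      have := hf.large
      rw [Fintype.card_eq_zero] at this
      norm_num at this
    let x₀ : Finset X → X := fun Y => if h : Y.Nonempty then h.choose else hXne.some
    have hx₀ : ∀ Y : Finset X, Y.Nonempty → x₀ Y ∈ Y := fun Y h => by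
      simp only [x₀, dif_pos h]
      exact h.choose_spec
    set t := max 0 (ν - (K + 1) * δ) with ht
    have ht0 : 0 ≤ t := le_max_left _ _
    have htν : t ≤ ν := max_le h0 (by nlinarith [show (0 : ℝ) ≤ K from Nat.cast_nonneg _])
    have htd : dist t ν < γ := by
      rw [Real.dist_eq, abs_of_nonpos (by linarith)]
      have : ν - (K + 1) * δ ≤ t := le_max_right _ _
      nlinarith
    have hbt := hball htd
    have hbt' : b K t ≤ 1 / s := by
      have h2 : b K t ≤ b K ν := Finset.sum_le_sum fun k _ =>
        mul_le_mul_of_nonneg_left (pow_le_pow_left₀ ht0 htν k) (ha0 k)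
      have h3 := sum_le_hasSum (Finset.range (K + 1))
        (fun k _ => mul_nonneg (ha0 k) (pow_nonneg h0 k)) hsum
      rw [hb] at h2
      linarith
    have hU := sum_contract_le_mcount_hasUnicyclic f K x₀ hx₀
    have hU' : (s - ε₁) * b K t * N ≤ (mcount (fun m => HasUnicyclic f m) : ℝ) := by
      refine le_trans ?_ (Nat.cast_le.2 hU)
      rw [Nat.cast_sum, Finset.mul_sum, Finset.sum_mul]
      exact Finset.sum_le_sum fun k hk =>
        sum_twoRegular_ge h0 h1 hf hδ0 hε₁s hδ₁ (by linarith) (by linarith) x₀ hx₀ hk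
    have hnot : (mcount (fun m => HasUnicyclic f m) : ℝ) +
        (mcount (fun m => ¬ HasUnicyclic f m) : ℝ) = N := by
      exact_mod_cast mcount_not fun m => HasUnicyclic f m
    -- The truncated series is nearly `1 / s - 1`, so multiplying it by `s` gives nearly `1 - s`.
    have hfin : 1 - s - ε ≤ (s - ε₁) * b K t := by
      have e1 : ε₁ * b K t ≤ ε / 2 := by
        calc ε₁ * b K t ≤ ε₁ * (1 / s) := mul_le_mul_of_nonneg_left hbt' hε₁0.le
          _ = min ε 1 / 2 := by rw [hε₁]; field_simp
          _ ≤ ε / 2 := by linarith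
      have e2 : s * (1 / s - 1 - ε / 2) ≤ s * b K t := mul_le_mul_of_nonneg_left hbt.le hs0.le
      have e3 : s * (1 / s - 1 - ε / 2) = 1 - s - s * (ε / 2) := by field_simp
      nlinarith
    nlinarith [mul_le_mul_of_nonneg_right hfin hN0]
  rw [abs_le]
  constructor <;> linarith

end

/-! ### The multigraph of a matching -/

section

variable {X V : Type*}

/-- The pairs of a matching. -/
noncomputable def edgeSet [Fintype X] (m : Equiv.Perm X) : Finset (Sym2 X) :=
  Finset.univ.image fun x => s(x, m x)

/-- The multigraph of a matching of half-edges. -/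
noncomputable def graph [Fintype X] (f : X → V) (m : Equiv.Perm X) : Multigraph V where
  mult e := ((edgeSet m).filter fun p => p.map f = e).card

/-! ### Involutions and sets of unordered pairs -/

section EdgeSet

variable [Fintype X]

theorem mem_edgeSet {m : Equiv.Perm X} {e : Sym2 X} : e ∈ edgeSet m ↔ ∃ x, s(x, m x) = e := by
  simp [edgeSet]

theorem mk_mem_edgeSet {m : Equiv.Perm X} (hm : IsMatching m) {x y : X} :
    s(x, y) ∈ edgeSet m ↔ m x = y := by
  rw [mem_edgeSet]
  constructor
  · rintro ⟨z, hz⟩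
    rw [Sym2.eq_iff] at hz
    rcases hz with ⟨rfl, h⟩ | ⟨rfl, h⟩
    · exact h
    · rw [← h, (hm _).1]
  · rintro rfl
    exact ⟨x, rfl⟩

/-- Every pair contains two half-edges. -/
theorem two_mul_card_filter_edgeSet {m : Equiv.Perm X} (hm : IsMatching m) (P : Sym2 X → Prop)
    [DecidablePred P] [DecidablePred fun x => P s(x, m x)] :
    2 * ((edgeSet m).filter P).card = (Finset.univ.filter fun x => P s(x, m x)).card := by
  rw [Finset.card_eq_sum_card_fiberwise (f := fun x => s(x, m x)) (t := (edgeSet m).filter P)]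
  · rw [Finset.sum_congr rfl (g := fun _ => 2), Finset.sum_const, smul_eq_mul, mul_comm]
    intro e he
    rw [Finset.mem_filter, mem_edgeSet] at he
    obtain ⟨⟨x, rfl⟩, hP⟩ := he
    have : ((Finset.univ.filter fun x => P s(x, m x)).filter fun y => s(y, m y) = s(x, m x)) =
        {x, m x} := by
      ext y
      simp only [Finset.mem_filter, Finset.mem_univ, true_and, Finset.mem_insert,
        Finset.mem_singleton]
      constructor
      · rintro ⟨_, h⟩
        rw [Sym2.eq_iff] at h
        rcases h with ⟨h, _⟩ | ⟨h, _⟩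
        · exact Or.inl h
        · exact Or.inr h
      · rintro (rfl | rfl)
        · exact ⟨hP, rfl⟩
        · rw [(hm x).1, Sym2.eq_swap]
          exact ⟨hP, rfl⟩
    rw [this, Finset.card_pair (hm x).2.symm]
  · intro x hx
    rw [Finset.mem_coe, Finset.mem_filter] at hx
    rw [Finset.mem_coe, Finset.mem_filter, mem_edgeSet]
    exact ⟨⟨x, rfl⟩, hx.2⟩

theorem two_mul_mult (f : X → V) {m : Equiv.Perm X} (hm : IsMatching m) (e : Sym2 V) :
    2 * (graph f m).mult e = (Finset.univ.filter fun x => s(f x, f (m x)) = e).card :=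
  two_mul_card_filter_edgeSet hm fun p => p.map f = e

theorem edgeSet_injective {m m' : Equiv.Perm X} (hm : IsMatching m) (hm' : IsMatching m')
    (h : edgeSet m = edgeSet m') : m = m' := by
  ext x
  have : s(x, m x) ∈ edgeSet m' := by
    rw [← h, mk_mem_edgeSet hm]
  exact ((mk_mem_edgeSet hm').1 this).symm

theorem isPerfectMatchingOn_edgeSet {m : Equiv.Perm X} (hm : IsMatching m) :
    IsPerfectMatchingOn (edgeSet m) := by
  constructor
  · intro e he
    obtain ⟨x, rfl⟩ := mem_edgeSet.1 he
    rw [Sym2.mk_isDiag_iff]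
    exact (hm x).2.symm
  · intro x
    refine ⟨s(x, m x), ⟨mem_edgeSet.2 ⟨x, rfl⟩, Sym2.mem_mk_left _ _⟩, ?_⟩
    rintro e ⟨he, hx⟩
    obtain ⟨y, rfl⟩ := Sym2.mem_iff_exists.1 hx
    rw [mk_mem_edgeSet hm] at he
    rw [he]

theorem exists_edgeSet_eq {M : Finset (Sym2 X)} (hM : IsPerfectMatchingOn M) :
    ∃ m, IsMatching m ∧ edgeSet m = M := by
  have hex : ∀ x, ∃ y, s(x, y) ∈ M := fun x => by
    obtain ⟨e, ⟨he, hx⟩, _⟩ := hM.2 x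
    obtain ⟨y, rfl⟩ := Sym2.mem_iff_exists.1 hx
    exact ⟨y, he⟩
  choose o ho using hex
  have hun : ∀ x y, s(x, y) ∈ M → y = o x := fun x y h => by
    have := (hM.2 x).unique ⟨h, Sym2.mem_mk_left _ _⟩ ⟨ho x, Sym2.mem_mk_left _ _⟩
    exact Sym2.congr_right.1 this
  have hinv : Function.Involutive o := fun x => by
    refine (hun (o x) x ?_).symm
    rw [Sym2.eq_swap]
    exact ho x
  have hmm : IsMatching hinv.toPerm := fun x => by
    refine ⟨hinv x, fun e => hM.1 _ (ho x) ?_⟩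
    rw [Sym2.mk_isDiag_iff]
    exact e.symm
  refine ⟨hinv.toPerm, hmm, ?_⟩
  ext e
  induction e using Sym2.ind with
  | _ x y =>
    rw [mk_mem_edgeSet hmm]
    constructor
    · rintro rfl
      exact ho x
    · intro h
      exact (hun x y h).symm

/-- `edgeSet` is a bijection from fixed-point-free involutions to perfect matchings, so the uniform
measures agree. -/
theorem ncard_isPerfectMatchingOn (P : Finset (Sym2 X) → Prop) :
    {M | IsPerfectMatchingOn M ∧ P M}.ncard = mcount fun m : Equiv.Perm X => P (edgeSet m) := by
  rw [mcount, ← Set.InjOn.ncard_image (f := edgeSet)]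
  · congr 1
    ext M
    constructor
    · rintro ⟨hM, hP⟩
      obtain ⟨m, hm, rfl⟩ := exists_edgeSet_eq hM
      exact ⟨m, ⟨hm, hP⟩, rfl⟩
    · rintro ⟨m, ⟨hm, hP⟩, rfl⟩
      exact ⟨isPerfectMatchingOn_edgeSet hm, hP⟩
  · exact fun m hm m' hm' h => edgeSet_injective hm.1 hm'.1 h

end EdgeSet

theorem card_configurations_filter {n : ℕ} (d : Fin n → ℕ) (P : Multigraph (Fin n) → Prop) :
    ((configurations d).filter fun M => P (underlyingMultigraph d M)).card =
      mcount fun m : Equiv.Perm (HalfEdge d) => P (graph Sigma.fst m) := by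
  have hgr : ∀ m : Equiv.Perm (HalfEdge d),
      underlyingMultigraph d (edgeSet m) = graph Sigma.fst m := fun m => by
    unfold underlyingMultigraph graph
    congr!
  have h := ncard_isPerfectMatchingOn fun M : Finset (Sym2 (HalfEdge d)) =>
    P (underlyingMultigraph d M)
  simp only [hgr] at h
  rw [← h, ← Set.ncard_coe_finset]
  congr 1
  ext M
  simp [configurations]

theorem cmProb_eq {n : ℕ} (d : Fin n → ℕ) (P : Multigraph (Fin n) → Prop) :
    cmProb d P = (mcount fun m : Equiv.Perm (HalfEdge d) => P (graph Sigma.fst m)) /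
      mcount fun _ : Equiv.Perm (HalfEdge d) => True := by
  have h := card_configurations_filter d fun _ => True
  rw [Finset.filter_true] at h
  rw [cmProb, card_configurations_filter, h]

theorem degree_graph [Fintype X] [Fintype V] (f : X → V) {m : Equiv.Perm X} (hm : IsMatching m)
    (v : V) : (graph f m).degree v = (Finset.univ.filter fun x => f x = v).card := by
  have hsplit : (Finset.univ.filter fun x => f x = v).card =
      ∑ u, (Finset.univ.filter fun x => f x = v ∧ f (m x) = u).card := by
    rw [Finset.card_eq_sum_card_fiberwise (f := fun x => f (m x)) (t := Finset.univ)
      (fun x _ => Finset.mem_univ _)]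
    exact Finset.sum_congr rfl fun u _ => by rw [Finset.filter_filter]
  have hswap : ∀ u, (Finset.univ.filter fun x => f x = u ∧ f (m x) = v).card =
      (Finset.univ.filter fun x => f x = v ∧ f (m x) = u).card := fun u => by
    refine Finset.card_bij (fun x _ => m x) ?_ (fun x _ y _ h => m.injective h) ?_
    · intro x hx
      simp only [Finset.mem_filter, Finset.mem_univ, true_and] at hx ⊢
      rw [(hm x).1]; exact hx.symm
    · intro y hy
      simp only [Finset.mem_filter, Finset.mem_univ, true_and] at hy
      refine ⟨m y, ?_, (hm y).1⟩
      simp only [Finset.mem_filter, Finset.mem_univ, true_and]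
      rw [(hm y).1]; exact hy.symm
  have hloop : 2 * (graph f m).mult s(v, v) =
      (Finset.univ.filter fun x => f x = v ∧ f (m x) = v).card := by
    rw [two_mul_mult f hm]
    congr 1
    ext x
    simp
  have hedge : ∀ u, u ≠ v → (graph f m).mult s(u, v) =
      (Finset.univ.filter fun x => f x = v ∧ f (m x) = u).card := by
    intro u huv
    have h := two_mul_mult f hm s(u, v)
    have hu : (Finset.univ.filter fun x => s(f x, f (m x)) = s(u, v)) =
        (Finset.univ.filter fun x => f x = u ∧ f (m x) = v) ∪
        (Finset.univ.filter fun x => f x = v ∧ f (m x) = u) := by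
      ext x
      simp
    rw [hu, Finset.card_union_of_disjoint, hswap] at h
    · omega
    · refine Finset.disjoint_left.2 fun x h1 h2 => huv ?_
      rw [Finset.mem_filter] at h1 h2
      rw [← h1.2.1, h2.2.1]
  rw [hsplit, Multigraph.degree, hloop, ← Finset.sum_erase_add _ _ (Finset.mem_univ v)]
  congr 1
  exact Finset.sum_congr rfl fun u hu => hedge u (Finset.ne_of_mem_erase hu)

theorem skeleton_adj [Fintype X] (f : X → V) {m : Equiv.Perm X} (hm : IsMatching m) (u v : V) :
    (graph f m).skeleton.Adj u v ↔ (∃ x, f x = u ∧ f (m x) = v) ∧ u ≠ v := by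
  rw [Multigraph.skeleton, SimpleGraph.fromEdgeSet_adj]
  refine and_congr_left fun _ => ?_
  simp only [Set.mem_ofPred_eq, graph, Finset.card_ne_zero]
  constructor
  · rintro ⟨p, hp⟩
    rw [Finset.mem_filter, mem_edgeSet] at hp
    obtain ⟨⟨x, rfl⟩, hx⟩ := hp
    rw [Sym2.map_mk, Sym2.eq_iff] at hx
    rcases hx with ⟨h1, h2⟩ | ⟨h1, h2⟩
    · exact ⟨x, h1, h2⟩
    · exact ⟨m x, h2, by rw [(hm x).1, h1]⟩
  · rintro ⟨x, rfl, rfl⟩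
    exact ⟨s(x, m x), Finset.mem_filter.2 ⟨mem_edgeSet.2 ⟨x, rfl⟩, rfl⟩⟩

/-- A walk from `v` cannot leave a closed set; conversely the vertices of `S` reachable from `v`
form a closed set, which minimality makes all of `S`. -/
theorem IsComponent.supp_eq [Fintype X] {f : X → V} {m : Equiv.Perm X} (hm : IsMatching m)
    {S : Finset V} (hS : IsComponent f m S) {v : V} (hv : v ∈ S) :
    ((graph f m).skeleton.connectedComponentMk v).supp = (S : Set V) := by
  ext u
  rw [SimpleGraph.ConnectedComponent.mem_supp_iff, SimpleGraph.ConnectedComponent.eq,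
    Finset.mem_coe]
  constructor
  · rintro h
    obtain ⟨w⟩ := h.symm
    clear h
    induction w with
    | nil => exact hv
    | cons hadj _ ih =>
      obtain ⟨⟨x, rfl, rfl⟩, _⟩ := (skeleton_adj f hm _ _).1 hadj
      exact ih (hS.closed x hv)
  · intro hu
    set T := S.filter fun u => (graph f m).skeleton.Reachable u v with hT
    have hTS : T = S := by
      refine hS.minimal T (Finset.filter_subset _ _)
        ⟨v, Finset.mem_filter.2 ⟨hv, SimpleGraph.Reachable.refl _⟩⟩ fun x hx => ?_
      rw [hT, Finset.mem_filter] at hx ⊢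
      refine ⟨hS.closed x hx.1, ?_⟩
      by_cases he : f x = f (m x)
      · rw [← he]; exact hx.2
      · have : (graph f m).skeleton.Adj (f x) (f (m x)) :=
          (skeleton_adj f hm _ _).2 ⟨⟨x, rfl, rfl⟩, he⟩
        exact this.symm.reachable.trans hx.2
    rw [← hTS, hT, Finset.mem_filter] at hu
    exact hu.2

theorem two_mul_numEdges_induce [Fintype X] (f : X → V) {m : Equiv.Perm X} (hm : IsMatching m)
    (A : Set V) [Fintype A] : 2 * ((graph f m).induce A).numEdges =
      {x | f x ∈ A ∧ f (m x) ∈ A}.ncard := by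
  have hinj : Function.Injective (Sym2.map (Subtype.val : A → V)) :=
    Sym2.map.injective Subtype.val_injective
  have h1 : ((graph f m).induce A).numEdges =
      ((edgeSet m).filter fun p => ∃ e : Sym2 A, e.map Subtype.val = p.map f).card := by
    have h2 : ((edgeSet m).filter fun p => ∃ e : Sym2 A, e.map Subtype.val = p.map f) =
        Finset.univ.biUnion fun e : Sym2 A =>
          (edgeSet m).filter fun p => p.map f = e.map Subtype.val := by
      ext p
      simp only [Finset.mem_filter, Finset.mem_biUnion, Finset.mem_univ, true_and]
      constructor
      · rintro ⟨hp, e, he⟩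
        exact ⟨e, hp, he.symm⟩
      · rintro ⟨e, hp, he⟩
        exact ⟨hp, e, he.symm⟩
    rw [h2, Finset.card_biUnion]
    · rfl
    · intro e _ e' _ hne
      refine Finset.disjoint_left.2 fun p hp hp' => hne (hinj ?_)
      rw [Finset.mem_filter] at hp hp'
      rw [← hp.2, ← hp'.2]
  rw [h1, two_mul_card_filter_edgeSet hm, Set.ncard_eq_toFinset_card']
  congr 1
  ext x
  simp only [Finset.mem_filter, Finset.mem_univ, true_and, Set.mem_toFinset, Set.mem_ofPred_eq]
  constructor
  · rintro ⟨e, he⟩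
    have ha : ∀ v ∈ e.map (Subtype.val : A → V), v ∈ A := by
      intro v hv
      obtain ⟨a, _, rfl⟩ := Sym2.mem_map.1 hv
      exact a.2
    rw [he] at ha
    exact ⟨ha _ (Sym2.mem_mk_left _ _), ha _ (Sym2.mem_mk_right _ _)⟩
  · rintro ⟨h1, h2⟩
    exact ⟨s(⟨f x, h1⟩, ⟨f (m x), h2⟩), rfl⟩

theorem skeleton_induce (G : Multigraph V) (A : Set V) :
    (G.induce A).skeleton = G.skeleton.induce A := by
  ext u v
  simp only [Multigraph.skeleton, Multigraph.induce, SimpleGraph.fromEdgeSet_adj,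
    SimpleGraph.comap_adj, Set.mem_ofPred_eq, Sym2.map_mk, Function.Embedding.subtype_apply]
  rw [Ne, Ne, Ne, Subtype.ext_iff]

/-- A component is automatically connected, and being closed it has twice as many half-edges as
edges, so excess zero becomes the half-edge count in `IsUnicyclicPart`. -/
theorem inUnicyclicComponent_iff [Fintype X] [Fintype V] (f : X → V) {m : Equiv.Perm X}
    (hm : IsMatching m) (v : V) :
    (graph f m).InUnicyclicComponent v ↔ ∃ S, v ∈ S ∧ IsUnicyclicPart f m S := by
  obtain ⟨S, hvS, hS⟩ := exists_isComponent (f := f) hm v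
  have hsupp := hS.supp_eq hm hvS
  have h1 : (graph f m).InUnicyclicComponent v ↔ {x | f x ∈ S}.ncard = 2 * S.card := by
    unfold Multigraph.InUnicyclicComponent Multigraph.IsUnicyclic Multigraph.excess
    have hcon : ((graph f m).induce
        ((graph f m).skeleton.connectedComponentMk v).supp).skeleton.Connected := by
      rw [skeleton_induce]
      exact SimpleGraph.ConnectedComponent.connected_toSimpleGraph _
    have hcard : Fintype.card ((graph f m).skeleton.connectedComponentMk v).supp = S.card := by
      rw [← Nat.card_eq_fintype_card, hsupp, Nat.card_coe_set_eq, Set.ncard_coe_finset]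
    have hnum := two_mul_numEdges_induce f hm ((graph f m).skeleton.connectedComponentMk v).supp
    have hset : {x | f x ∈ ((graph f m).skeleton.connectedComponentMk v).supp ∧
        f (m x) ∈ ((graph f m).skeleton.connectedComponentMk v).supp} = {x | f x ∈ S} := by
      rw [hsupp]
      exact hS.closed.inner_eq
    rw [hset] at hnum
    constructor
    · rintro ⟨_, h⟩
      rw [hcard] at h
      rw [← hnum]
      omega
    · intro h
      refine ⟨hcon, ?_⟩
      rw [hcard]
      omega
  rw [h1]
  constructor
  · intro h
    exact ⟨S, hvS, ⟨hS, h⟩⟩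
  · rintro ⟨T, hvT, hT⟩
    rw [hS.eq_of_mem hT.toIsComponent hvS hvT]
    exact hT.card

end

/-! ### Matchings with a given multigraph -/

section

variable {X V : Type*}

theorem multigraph_ext {G H : Multigraph V} (h : ∀ e, G.mult e = H.mult e) : G = H := by
  cases G; cases H
  congr
  exact funext h

/-- The multigraph `G` with one more edge. -/
noncomputable def addEdge (G : Multigraph V) (e₀ : Sym2 V) : Multigraph V where
  mult e := G.mult e + if e = e₀ then 1 else 0

theorem addEdge_injective (e₀ : Sym2 V) : Function.Injective fun G => addEdge G e₀ := by
  intro G H h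
  refine multigraph_ext fun e => ?_
  have := congrArg (fun G => Multigraph.mult G e) h
  simpa [addEdge] using this

theorem exists_eq_addEdge {G : Multigraph V} {e₀ : Sym2 V} (h : G.mult e₀ ≠ 0) :
    ∃ G', G = addEdge G' e₀ := by
  refine ⟨⟨fun e => G.mult e - if e = e₀ then 1 else 0⟩, multigraph_ext fun e => ?_⟩
  simp only [addEdge]
  split_ifs with he
  · subst he; omega
  · simp

/-- The contribution to the degree of `v` of the edges to `u`. -/
noncomputable def edgeWeight (G : Multigraph V) (u v : V) : ℕ :=
  G.mult s(u, v) * if u = v then 2 else 1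

section Degree

variable [Fintype V]

theorem degree_eq_sum (G : Multigraph V) (v : V) : G.degree v = ∑ u, edgeWeight G u v := by
  rw [Multigraph.degree, ← Finset.sum_erase_add _ _ (Finset.mem_univ v)]
  congr 1
  · refine Finset.sum_congr rfl fun u hu => ?_
    rw [edgeWeight, if_neg (Finset.ne_of_mem_erase hu), mul_one]
  · rw [edgeWeight, if_pos rfl, mul_comm]

theorem degree_addEdge (G : Multigraph V) (a b v : V) :
    (addEdge G s(a, b)).degree v =
      G.degree v + ((if v = a then 1 else 0) + if v = b then 1 else 0) := by
  rw [degree_eq_sum, degree_eq_sum]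
  have h : ∀ u, edgeWeight (addEdge G s(a, b)) u v =
      edgeWeight G u v + if s(u, v) = s(a, b) then (if u = v then 2 else 1) else 0 := fun u => by
    simp only [edgeWeight, addEdge, add_mul, ite_mul, one_mul, zero_mul]
  rw [Finset.sum_congr rfl fun u _ => h u, Finset.sum_add_distrib]
  congr 1
  by_cases hb : v = b
  · subst hb
    rw [Finset.sum_eq_single a]
    · by_cases hva : v = a
      · simp [hva]
      · simp [hva, Ne.symm hva]
    · intro u _ hu
      rw [if_neg]
      rw [Sym2.eq_iff]
      rintro (⟨h, _⟩ | ⟨h1, h2⟩)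
      · exact hu h
      · exact hu (h1.trans h2)
    · simp
  · by_cases ha : v = a
    · subst ha
      rw [Finset.sum_eq_single b]
      · simp [hb, Ne.symm hb, Sym2.eq_swap]
      · intro u _ hu
        rw [if_neg]
        rw [Sym2.eq_iff]
        rintro (⟨_, h⟩ | ⟨h, _⟩)
        · exact hb h
        · exact hu h
      · simp
    · rw [Finset.sum_eq_zero]
      · simp [ha, hb]
      · intro u _
        rw [if_neg]
        rw [Sym2.eq_iff]
        rintro (⟨_, h⟩ | ⟨_, h⟩)
        · exact hb h
        · exact ha h

theorem prod_update_mul {ι : Type*} [Fintype ι] (g h : ι → ℕ) (i : ι) (c : ℕ)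
    (hi : g i = h i * c) (hne : ∀ j, j ≠ i → g j = h j) : ∏ j, g j = (∏ j, h j) * c := by
  rw [← Finset.prod_erase_mul _ _ (Finset.mem_univ i), hi, ← Finset.prod_erase_mul _ h
    (Finset.mem_univ i), mul_assoc]
  congr 1
  exact Finset.prod_congr rfl fun j hj => hne j (Finset.ne_of_mem_erase hj)

theorem prod_factorial_degree_addEdge (G : Multigraph V) (a b : V) :
    ∏ v, ((addEdge G s(a, b)).degree v).factorial = (∏ v, (G.degree v).factorial) *
      ((addEdge G s(a, b)).degree a * ((addEdge G s(a, b)).degree b - if a = b then 1 else 0)) := by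
  simp only [degree_addEdge]
  by_cases hab : a = b
  · subst hab
    refine prod_update_mul _ _ a _ ?_ fun j hj => ?_
    · simp only [if_true]
      rw [show G.degree a + (1 + 1) = G.degree a + 1 + 1 by ring, Nat.factorial_succ,
        Nat.factorial_succ, Nat.add_sub_cancel]
      ring
    · simp [hj]
  · simp only [if_neg hab, if_neg (Ne.symm hab), if_true]
    rw [← mul_assoc]
    rw [prod_update_mul _ (fun v => (G.degree v + if v = a then 1 else 0).factorial) b
      (G.degree b + 1), prod_update_mul _ (fun v => (G.degree v).factorial) a (G.degree a + 1)]
    · simp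
    · simp [Nat.factorial_succ, mul_comm]
    · intro j hj; simp [hj]
    · simp [Ne.symm hab, Nat.factorial_succ, mul_comm]
    · intro j hj; simp [hj]

/-- The number of symmetries of the half-edges that fix all the vertices. -/
noncomputable def edgeSymmetries (G : Multigraph V) : ℕ :=
  2 ^ G.numLoops * ∏ e : Sym2 V, (G.mult e).factorial

/-- Raising a multiplicity to m multiplies its factorial by m, and a new loop contributes a further
2; together these are the `edgeWeight`. -/
theorem edgeSymmetries_addEdge (G : Multigraph V) (a b : V) :
    edgeSymmetries (addEdge G s(a, b)) =
      edgeSymmetries G * edgeWeight (addEdge G s(a, b)) b a := by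
  have h1 : ∏ e : Sym2 V, ((addEdge G s(a, b)).mult e).factorial =
      (∏ e : Sym2 V, (G.mult e).factorial) * (addEdge G s(a, b)).mult s(a, b) := by
    refine prod_update_mul _ _ s(a, b) _ ?_ fun e he => ?_
    · simp [addEdge, Nat.factorial_succ, mul_comm]
    · simp [addEdge, he]
  have h2 : (addEdge G s(a, b)).numLoops = G.numLoops + if b = a then 1 else 0 := by
    simp only [Multigraph.numLoops, addEdge]
    rw [Finset.sum_add_distrib]
    congr 1
    by_cases hab : b = a
    · subst hab; simp
    · rw [if_neg hab]
      refine Finset.sum_eq_zero fun v _ => if_neg ?_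
      rw [Sym2.eq_iff]
      rintro (⟨h, h'⟩ | ⟨h, h'⟩)
      · exact hab (h'.symm.trans h)
      · exact hab (h.symm.trans h')
  rw [edgeSymmetries, h1, h2, edgeWeight, Sym2.eq_swap (a := b), pow_add, edgeSymmetries]
  split_ifs <;> ring

end Degree

theorem graph_eq_addEdge [Fintype X] (f : X → V) {m : Equiv.Perm X} (hm : IsMatching m) {x y : X}
    (h : m x = y) (h' : ∀ z, (m z = x ∨ m z = y) ↔ (z = x ∨ z = y)) :
    graph f m = addEdge (graph (fun z : {z // ¬ (z = x ∨ z = y)} => f z)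
      (m.subtypePerm fun z => not_congr (h' z))) s(f x, f y) := by
  refine multigraph_ext fun e => ?_
  have h1 := two_mul_mult f hm e
  have h2 := two_mul_mult (fun z : {z // ¬ (z = x ∨ z = y)} => f z)
    (hm.restrict fun z => not_congr (h' z)) e
  have hxy : x ≠ y := fun e => (hm x).2 (h.trans e.symm)
  have hyx : m y = x := by rw [← h, (hm x).1]
  have h3 : (Finset.univ.filter fun z => s(f z, f (m z)) = e).card =
      ((Finset.univ.filter fun z => s(f z, f (m z)) = e).filter fun z => z = x ∨ z = y).card +
      ((Finset.univ.filter fun z => s(f z, f (m z)) = e).filter fun z => ¬ (z = x ∨ z = y)).card :=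
    (Finset.card_filter_add_card_filter_not _).symm
  have h4 : ((Finset.univ.filter fun z => s(f z, f (m z)) = e).filter
      fun z => ¬ (z = x ∨ z = y)).card = 2 * (graph (fun z : {z // ¬ (z = x ∨ z = y)} => f z)
      (m.subtypePerm fun z => not_congr (h' z))).mult e := by
    rw [h2, ← Finset.card_map (Function.Embedding.subtype _)]
    congr 1
    ext z
    simp only [Finset.mem_filter, Finset.mem_univ, true_and, Finset.mem_map,
      Function.Embedding.subtype_apply, Subtype.exists, exists_and_right, exists_eq_right,
      Equiv.Perm.subtypePerm_apply]
    constructor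
    · rintro ⟨ha, hb⟩; exact ⟨hb, Finset.mem_filter.2 ⟨Finset.mem_univ _, ha⟩⟩
    · rintro ⟨ha, hb⟩; exact ⟨(Finset.mem_filter.1 hb).2, ha⟩
  have h5 : ((Finset.univ.filter fun z => s(f z, f (m z)) = e).filter
      fun z => z = x ∨ z = y).card = if e = s(f x, f y) then 2 else 0 := by
    split_ifs with he
    · rw [← Finset.card_pair hxy]
      congr 1
      ext z
      simp only [Finset.mem_filter, Finset.mem_univ, true_and, Finset.mem_insert,
        Finset.mem_singleton, and_iff_right_iff_imp]
      rintro (rfl | rfl)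
      · rw [h, he]
      · rw [hyx, he, Sym2.eq_swap]
    · rw [Finset.card_eq_zero, Finset.filter_eq_empty_iff]
      intro z hz
      rw [Finset.mem_filter] at hz
      rintro (rfl | rfl)
      · exact he (by rw [← hz.2, h])
      · exact he (by rw [← hz.2, hyx, Sym2.eq_swap])
  simp only [addEdge]
  split_ifs at h5 ⊢ <;> omega

theorem card_filter_compl_pair [Fintype X] (f : X → V) {x y : X} (hxy : x ≠ y) (v : V) :
    (Finset.univ.filter fun z => f z = v).card =
      (Finset.univ.filter fun z : {z // ¬ (z = x ∨ z = y)} => f z = v).card +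
        ((if v = f x then 1 else 0) + if v = f y then 1 else 0) := by
  rw [← Finset.card_map (Function.Embedding.subtype _)]
  have : (Finset.univ.filter fun z : {z // ¬ (z = x ∨ z = y)} => f z = v).map
      (Function.Embedding.subtype _) = ((Finset.univ.filter fun z => f z = v).erase x).erase y := by
    ext z
    simp only [Finset.mem_filter, Finset.mem_univ, true_and, Finset.mem_map,
      Function.Embedding.subtype_apply, Subtype.exists, exists_and_right, exists_eq_right,
      Finset.mem_erase, exists_prop]
    tauto
  rw [this, Finset.card_erase_eq_ite, Finset.card_erase_eq_ite]
  simp only [Finset.mem_erase, Finset.mem_filter, Finset.mem_univ, true_and]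
  have hpos : ∀ w, f w = v → 0 < (Finset.univ.filter fun z => f z = v).card := fun w hw =>
    Finset.card_pos.2 ⟨w, by simpa using hw⟩
  have hpos2 : f x = v → f y = v → 1 < (Finset.univ.filter fun z => f z = v).card := fun h1 h2 =>
    Finset.one_lt_card.2 ⟨x, by simpa using h1, y, by simpa using h2, hxy⟩
  by_cases h1 : f x = v <;> by_cases h2 : f y = v
  · have := hpos2 h1 h2
    simp [h1, h2, hxy.symm]; omega
  · have := hpos x h1
    simp [h1, h2, Ne.symm h2]; omega
  · have := hpos y h2
    simp [h1, h2, Ne.symm h1, hxy.symm]; omega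
  · simp [h1, h2, Ne.symm h1, Ne.symm h2]

/-- Remove a half-edge `x` at `v` with its partner and induct on the multigraph with one edge fewer.
The resulting weights `edgeWeight H u v` sum over `u` to the degree of `v`, which cancels. The
identity is kept multiplied out to stay in ℕ. -/
theorem mcount_graph_aux [Fintype V] (n : ℕ) : ∀ (X : Type u) [Fintype X] (f : X → V)
    (H : Multigraph V), Fintype.card X = n →
    (∀ v, (Finset.univ.filter fun x => f x = v).card = H.degree v) →
    (mcount fun m => graph f m = H) * edgeSymmetries H = ∏ v, (H.degree v).factorial := by
  induction n using Nat.strong_induction_on with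
  | _ n ih =>
    intro X _ f H hX hdeg
    rcases isEmpty_or_nonempty X with hemp | ⟨⟨x⟩⟩
    · have hd0 : ∀ v, H.degree v = 0 := fun v => by rw [← hdeg]; simp
      have hm0 : ∀ e, H.mult e = 0 := fun e => by
        induction e using Sym2.ind with
        | _ u v =>
          have h := hd0 v
          rw [degree_eq_sum, Finset.sum_eq_zero_iff] at h
          have := h u (Finset.mem_univ _)
          rw [edgeWeight, Nat.mul_eq_zero] at this
          rcases this with h | h
          · exact h
          · split_ifs at h
      have h1 : (mcount fun m => graph f m = H) = 1 := by
        rw [mcount_congr (Q := fun _ => True), mcount_true, Nat.card_of_isEmpty, pm]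
        intro m hm
        refine ⟨fun _ => trivial, fun _ => multigraph_ext fun e => ?_⟩
        have := two_mul_mult f hm e
        rw [hm0]
        simp only [Finset.univ_eq_empty, Finset.filter_empty, Finset.card_empty] at this
        omega
      rw [h1, edgeSymmetries, Multigraph.numLoops]
      simp [hm0, hd0]
    · set v := f x with hv
      set c : X → ℕ := fun y => mcount fun m => graph f m = H ∧ m x = y with hc
      have hN : ∀ u, (((Finset.univ.erase x).filter fun y => f y = u).card : ℕ) =
          H.degree u - if v = u then 1 else 0 := by
        intro u
        rw [← hdeg, Finset.filter_erase, Finset.card_erase_eq_ite]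
        simp only [Finset.mem_filter, Finset.mem_univ, true_and]
        split_ifs <;> rfl
      have hdv : 0 < H.degree v := by
        rw [← hdeg]
        exact Finset.card_pos.2 ⟨x, by simp [hv]⟩
      -- The truncated difference is the number of candidates `y` at a vertex: `x` itself is
      -- excluded when that vertex is `v`.
      have key : ∀ y ∈ Finset.univ.erase x, c y * edgeSymmetries H * (H.degree v *
          (H.degree (f y) - if v = f y then 1 else 0)) =
          (∏ v, (H.degree v).factorial) * edgeWeight H (f y) v := by
        intro y hy
        have hxy : x ≠ y := (Finset.ne_of_mem_erase hy).symm
        by_cases h0 : H.mult s(v, f y) = 0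
        · have hc0 : c y = 0 := by
            rw [hc]
            simp only
            rw [mcount, Set.ncard_eq_zero]
            refine Set.eq_empty_of_forall_notMem fun m hm => ?_
            obtain ⟨hm, rfl, hmx⟩ := hm
            rw [graph_eq_addEdge f hm hmx (hm.pair_iff hmx), addEdge] at h0
            simp [hv] at h0
          rw [hc0, edgeWeight, Sym2.eq_swap, h0]
          simp
        · obtain ⟨H', rfl⟩ := exists_eq_addEdge h0
          have hcy : c y = mcount fun m => graph (fun z : {z // ¬ (z = x ∨ z = y)} => f z) m = H' := by
            rw [← mcount_apply_eq hxy]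
            refine mcount_congr fun m hm => ?_
            constructor
            · rintro ⟨h1, h2⟩
              refine ⟨h2, hm.pair_iff h2, addEdge_injective s(v, f y) ?_⟩
              change addEdge _ _ = addEdge _ _
              rw [← h1, graph_eq_addEdge f hm h2 (hm.pair_iff h2)]
            · rintro ⟨h2, h3, h1⟩
              refine ⟨?_, h2⟩
              rw [graph_eq_addEdge f hm h2 h3, h1]
          have hcard := card_compl_pair hxy
          rw [Nat.card_eq_fintype_card, Nat.card_eq_fintype_card] at hcard
          have hi := ih _ (by omega) {z // ¬ (z = x ∨ z = y)} (fun z => f z) H' rfl fun w => by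
            have h1 := card_filter_compl_pair f hxy w
            rw [hdeg, degree_addEdge, ← hv] at h1
            omega
          rw [hcy, edgeSymmetries_addEdge, prod_factorial_degree_addEdge, ← hi]
          ring
      have hfib : ∀ u, (∑ y ∈ (Finset.univ.erase x).filter fun y => f y = u, c y) *
          edgeSymmetries H * H.degree v = (∏ v, (H.degree v).factorial) * edgeWeight H u v := by
        intro u
        have h1 : ((∑ y ∈ (Finset.univ.erase x).filter fun y => f y = u, c y) *
            edgeSymmetries H * H.degree v) * (H.degree u - if v = u then 1 else 0) =
            ((∏ v, (H.degree v).factorial) * edgeWeight H u v) *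
              (H.degree u - if v = u then 1 else 0) := by
          conv_rhs => rw [mul_comm, ← hN u, ← smul_eq_mul, ← Finset.sum_const]
          rw [mul_assoc, mul_assoc, Finset.sum_mul]
          refine Finset.sum_congr rfl fun y hy => ?_
          rw [Finset.mem_filter] at hy
          rw [← hy.2, ← key y hy.1]
          ring
        -- When this factor vanishes there is no candidate at `u`, and the degree condition rules
        -- out an edge of `H` between `u` and `v`, so both sides are zero.
        rcases Nat.eq_zero_or_pos (H.degree u - if v = u then 1 else 0) with h0 | h0
        · rw [← hN, Finset.card_eq_zero] at h0
          rw [h0, Finset.sum_empty, zero_mul, zero_mul]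
          have h2 := hN u
          rw [h0, Finset.card_empty] at h2
          suffices edgeWeight H u v = 0 by rw [this, mul_zero]
          by_cases hvu : v = u
          · subst hvu
            have h3 := Finset.single_le_sum (f := fun u => edgeWeight H u v)
              (fun _ _ => Nat.zero_le _) (Finset.mem_univ v)
            rw [← degree_eq_sum] at h3
            simp only [edgeWeight, if_true] at h3 h2 ⊢
            omega
          · have h3 := Finset.single_le_sum (f := fun w => edgeWeight H w u)
              (fun _ _ => Nat.zero_le _) (Finset.mem_univ v)
            rw [← degree_eq_sum] at h3
            simp only [edgeWeight, if_neg hvu, if_neg (Ne.symm hvu)] at h3 h2 ⊢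
            rw [Sym2.eq_swap]
            omega
        · exact Nat.eq_of_mul_eq_mul_right h0 h1
      have hsum : (mcount fun m => graph f m = H) =
          ∑ u, ∑ y ∈ (Finset.univ.erase x).filter fun y => f y = u, c y := by
        rw [Finset.sum_fiberwise (Finset.univ.erase x) f c]
        refine mcount_eq_sum _ (fun m => m x) _ fun m hm _ => ?_
        exact Finset.mem_erase.2 ⟨(hm x).2, Finset.mem_univ _⟩
      refine Nat.eq_of_mul_eq_mul_right hdv ?_
      rw [hsum, Finset.sum_mul, Finset.sum_mul, Finset.sum_congr rfl fun u _ => hfib u,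
        ← Finset.mul_sum, ← degree_eq_sum]

/-- The number of matchings with a given multigraph. -/
theorem mcount_graph_eq [Fintype X] [Fintype V] (f : X → V) (H : Multigraph V)
    (h : ∀ v, (Finset.univ.filter fun x => f x = v).card = H.degree v) :
    (mcount fun m => graph f m = H) * edgeSymmetries H = ∏ v, (H.degree v).factorial :=
  mcount_graph_aux _ X f H rfl h

end

/-! ### Decomposition along the fragment -/

section

variable {X V W : Type*}

/-- These embeddings are the isomorphisms from `H` to the fragment. Once one exists, composing with
it identifies them with the automorphisms of `H`. -/
theorem card_embeddings [Fintype V] [Fintype W] (G : Multigraph V) (H : Multigraph W) :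
    Nat.card {φ : W ↪ V // (∀ v, G.InUnicyclicComponent v ↔ v ∈ Set.range φ) ∧
      ∀ e : Sym2 W, G.mult (e.map φ) = H.mult e} =
    if Nonempty (Multigraph.Iso G.frag H) then H.aut else 0 := by
  have e1 : {φ : W ↪ V // (∀ v, G.InUnicyclicComponent v ↔ v ∈ Set.range φ) ∧
      ∀ e : Sym2 W, G.mult (e.map φ) = H.mult e} ≃ Multigraph.Iso H G.frag :=
    { toFun := fun φ => ⟨Equiv.ofBijective
          (fun w => ⟨φ.1 w, (φ.2.1 _).2 ⟨w, rfl⟩⟩ : W → {v | G.InUnicyclicComponent v})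
          ⟨fun a b h => φ.1.injective (congrArg Subtype.val h), fun v => by
            obtain ⟨w, hw⟩ := (φ.2.1 v).1 v.2
            exact ⟨w, Subtype.ext hw⟩⟩, fun e => by
          rw [← φ.2.2 e]
          change G.mult ((e.map _).map _) = _
          rw [Sym2.map_map]
          rfl⟩
      invFun := fun g => ⟨⟨fun w => (g.1 w).1, fun a b h => g.1.injective (Subtype.ext h)⟩,
        fun v => ⟨fun hv => ⟨g.1.symm ⟨v, hv⟩,
            congrArg Subtype.val (g.1.apply_symm_apply ⟨v, hv⟩)⟩, by
          rintro ⟨w, rfl⟩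
          exact (g.1 w).2⟩, fun e => by
          rw [← g.2 e]
          change _ = G.mult ((e.map _).map _)
          rw [Sym2.map_map]
          rfl⟩
      left_inv := fun φ => by ext; rfl
      right_inv := fun g => by
        apply Subtype.ext
        ext
        rfl }
  rw [Nat.card_congr e1]
  split_ifs with h
  · obtain ⟨g⟩ := h
    refine Nat.card_congr
      { toFun := fun k => ⟨k.1.trans g.1, fun e => ?_⟩
        invFun := fun k => ⟨k.1.trans g.1.symm, fun e => ?_⟩
        left_inv := fun k => by apply Subtype.ext; ext; simp
        right_inv := fun k => by apply Subtype.ext; ext; simp }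
    · rw [← k.2 e, ← g.2 (e.map k.1), Sym2.map_map]
      rfl
    · rw [← k.2, ← g.2, Sym2.map_map]
      congr 2
      ext w
      simp
  · rw [Nat.card_eq_zero]
    left
    refine ⟨fun k => h ⟨⟨k.1.symm, fun e => ?_⟩⟩⟩
    rw [← k.2, Sym2.map_map]
    simp

/-- The embeddings of `H` onto the fragment. -/
def IsFragEmbedding [Fintype V] (G : Multigraph V) (H : Multigraph W) (φ : W ↪ V) : Prop :=
  (∀ v, G.InUnicyclicComponent v ↔ v ∈ Set.range φ) ∧ ∀ e : Sym2 W, G.mult (e.map φ) = H.mult e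

/-- Count pairs of a matching and an embedding onto its fragment in two ways. -/
theorem aut_mul_mcount [Fintype X] [Fintype V] [Fintype W] (f : X → V) (H : Multigraph W) :
    H.aut * (mcount fun m => Nonempty (Multigraph.Iso (graph f m).frag H)) =
      ∑ φ : W ↪ V, mcount fun m => IsFragEmbedding (graph f m) H φ := by
  have h : ∀ m : Equiv.Perm X, ∑ φ : W ↪ V, (if IsFragEmbedding (graph f m) H φ then 1 else 0) =
      if Nonempty (Multigraph.Iso (graph f m).frag H) then H.aut else 0 := fun m => by
    rw [← card_embeddings, Nat.card_eq_fintype_card, Fintype.card_subtype, Finset.card_filter]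
    unfold IsFragEmbedding
    exact Finset.sum_congr rfl fun φ _ => by congr
  simp only [mcount_eq_card, ← Finset.filter_filter, Finset.card_filter _ (Finset.filter _ _)]
  rw [Finset.sum_comm, Finset.sum_congr rfl fun m _ => h m, Finset.mul_sum]
  refine Finset.sum_congr rfl fun m _ => ?_
  split_ifs <;> simp

/-! ### Half-edges inside and outside an embedded copy -/

section Restrict

variable {f : X → V} {m : Equiv.Perm X}

theorem isUnicyclicPart_restrict_iff {p : X → Prop} (h : ∀ x, p (m x) ↔ p x) {S : Finset V}
    (hS : ∀ x, f x ∈ S → p x) :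
    IsUnicyclicPart (fun x : {x // p x} => f x) (m.subtypePerm h) S ↔ IsUnicyclicPart f m S := by
  have hcl : ∀ T ⊆ S, IsClosedSet (fun x : {x // p x} => f x) (m.subtypePerm h) T ↔
      IsClosedSet f m T := fun T hT =>
    ⟨fun hc x hx => hc ⟨x, hS x (hT hx)⟩ hx, fun hc x hx => hc x.1 hx⟩
  have hcard : {x : {x // p x} | f x ∈ S}.ncard = {x | f x ∈ S}.ncard := by
    rw [← Set.ncard_image_of_injective _ Subtype.val_injective]
    congr 1
    ext x
    simp only [Set.mem_image, Set.mem_ofPred_eq, Subtype.exists, exists_and_left, exists_prop,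
      exists_eq_right_right, and_iff_left_iff_imp]
    exact hS x
  constructor
  · intro hu
    exact ⟨⟨hu.nonempty, (hcl S subset_rfl).1 hu.closed, fun T hT hne hc =>
      hu.minimal T hT hne ((hcl T hT).2 hc)⟩, hcard.symm.trans hu.card⟩
  · intro hu
    exact ⟨⟨hu.nonempty, (hcl S subset_rfl).2 hu.closed, fun T hT hne hc =>
      hu.minimal T hT hne ((hcl T hT).1 hc)⟩, hcard.trans hu.card⟩

/-- The incidence map of the half-edges at the vertices of the image of `φ`. -/
noncomputable def pullback (f : X → V) (φ : W ↪ V) : {x // f x ∈ Set.range φ} → W :=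
  fun x => x.2.choose

theorem map_pullback (f : X → V) (φ : W ↪ V) (x : {x // f x ∈ Set.range φ}) :
    φ (pullback f φ x) = f x := x.2.choose_spec

theorem card_pullback_eq [Fintype X] (f : X → V) (φ : W ↪ V)
    [Fintype {x // f x ∈ Set.range φ}] (w : W) :
    (Finset.univ.filter fun x => pullback f φ x = w).card =
      (Finset.univ.filter fun x => f x = φ w).card := by
  rw [← Finset.card_map (Function.Embedding.subtype _)]
  congr 1
  ext x
  simp only [Finset.mem_map, Finset.mem_filter, Finset.mem_univ, true_and,
    Function.Embedding.subtype_apply, Subtype.exists, exists_and_right, exists_eq_right]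
  constructor
  · rintro ⟨h, rfl⟩
    exact (map_pullback f φ ⟨x, h⟩).symm
  · intro h
    exact ⟨⟨w, h.symm⟩, φ.injective ((map_pullback f φ ⟨x, ⟨w, h.symm⟩⟩).trans h)⟩

theorem mult_graph_pullback [Fintype X] (hm : IsMatching m) (φ : W ↪ V)
    [Fintype {x // f x ∈ Set.range φ}]
    (h : ∀ x, f (m x) ∈ Set.range φ ↔ f x ∈ Set.range φ) (e : Sym2 W) :
    (graph (pullback f φ) (m.subtypePerm h)).mult e = (graph f m).mult (e.map φ) := by
  have h1 := two_mul_mult f hm (e.map φ)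
  have h2 := two_mul_mult (pullback f φ) (hm.restrict h) e
  have h3 : (Finset.univ.filter fun x => s(f x, f (m x)) = e.map φ).card =
      (Finset.univ.filter fun x =>
        s(pullback f φ x, pullback f φ (m.subtypePerm h x)) = e).card := by
    symm
    rw [← Finset.card_map (Function.Embedding.subtype _)]
    congr 1
    ext x
    have hkey : ∀ hx : f x ∈ Set.range φ,
        s(pullback f φ ⟨x, hx⟩, pullback f φ (m.subtypePerm h ⟨x, hx⟩)) = e ↔
        s(f x, f (m x)) = e.map φ := fun hx => by
      rw [← (Sym2.map.injective φ.injective).eq_iff, Sym2.map_mk, map_pullback, map_pullback]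
      rfl
    simp only [Finset.mem_map, Finset.mem_filter, Finset.mem_univ, true_and,
      Function.Embedding.subtype_apply, Subtype.exists, exists_and_right, exists_eq_right]
    constructor
    · rintro ⟨hx, he⟩
      exact (hkey hx).1 he
    · intro he
      have hx : f x ∈ e.map φ := by
        rw [← he]; exact Sym2.mem_mk_left _ _
      obtain ⟨w, _, hw⟩ := Sym2.mem_map.1 hx
      exact ⟨⟨w, hw⟩, (hkey _).2 he⟩
  omega

theorem IsUnicyclicPart.map_of_pullback {φ : W ↪ V}
    {h : ∀ x, f (m x) ∈ Set.range φ ↔ f x ∈ Set.range φ} {S : Finset W}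
    (hS : IsUnicyclicPart (pullback f φ) (m.subtypePerm h) S) :
    IsUnicyclicPart f m (S.map φ) := by
  have hmem : ∀ (T : Finset W) (x : {x // f x ∈ Set.range φ}),
      f x ∈ T.map φ ↔ pullback f φ x ∈ T := fun T x => by
    rw [← map_pullback f φ x, Finset.mem_map']
  have hran : ∀ (T : Finset W) (x : X), f x ∈ T.map φ → f x ∈ Set.range φ := fun T x hx => by
    obtain ⟨w, _, hw⟩ := Finset.mem_map.1 hx
    exact ⟨w, hw⟩
  have hcl : ∀ T, IsClosedSet (pullback f φ) (m.subtypePerm h) T ↔ IsClosedSet f m (T.map φ) :=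
    fun T => ⟨fun hc x hx => (hmem T (m.subtypePerm h ⟨x, hran T x hx⟩)).2
        (hc ⟨x, hran T x hx⟩ ((hmem T ⟨x, hran T x hx⟩).1 hx)),
      fun hc x hx => (hmem T _).1 (hc x.1 ((hmem T x).2 hx))⟩
  refine ⟨⟨hS.nonempty.map, (hcl S).1 hS.closed, fun T hT hne hc => ?_⟩, ?_⟩
  · obtain ⟨T', hT', rfl⟩ := Finset.subset_map_iff.1 hT
    rw [hS.minimal T' hT' (Finset.map_nonempty.1 hne) ((hcl T').2 hc)]
  · rw [Finset.card_map, ← hS.card, ← Set.ncard_image_of_injective _ Subtype.val_injective]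
    congr 1
    ext x
    simp only [Set.mem_image, Set.mem_ofPred_eq, Subtype.exists, exists_and_right,
      exists_eq_right]
    exact ⟨fun hx => ⟨hran S x hx, (hmem S ⟨x, hran S x hx⟩).1 hx⟩,
      fun ⟨hx, hx'⟩ => (hmem S ⟨x, hx⟩).2 hx'⟩

end Restrict

/-- Unicyclic components are closed, so the image of `φ` is a union of components and the matching
splits there. The outside must contribute no further unicyclic component; the inside contributes
only such components because `H` is a fragment. -/
theorem isFragEmbedding_iff [Fintype X] [Fintype V] [Fintype W] {f : X → V} {m : Equiv.Perm X}
    (hm : IsMatching m) {H : Multigraph W} (hH : H.IsFragment) (φ : W ↪ V) :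
    IsFragEmbedding (graph f m) H φ ↔ ∃ h : ∀ x, f (m x) ∈ Set.range φ ↔ f x ∈ Set.range φ,
      graph (pullback f φ) (m.subtypePerm h) = H ∧
      ¬ HasUnicyclic (fun x : {x // ¬ f x ∈ Set.range φ} => f x)
        (m.subtypePerm fun x => not_congr (h x)) := by
  constructor
  · rintro ⟨h1, h2⟩
    have hcl : ∀ x, f x ∈ Set.range φ → f (m x) ∈ Set.range φ := fun x hx => by
      rw [← h1, inUnicyclicComponent_iff f hm] at hx ⊢
      obtain ⟨S, hxS, hS⟩ := hx
      exact ⟨S, hS.closed x hxS, hS⟩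
    have h : ∀ x, f (m x) ∈ Set.range φ ↔ f x ∈ Set.range φ := fun x =>
      ⟨fun hx => by
        have := hcl _ hx
        rwa [(hm x).1] at this, hcl x⟩
    refine ⟨h, multigraph_ext fun e => ?_, ?_⟩
    · rw [mult_graph_pullback hm, h2]
    · rintro ⟨S, hS⟩
      -- The outer incidence map still has all of `V` as vertices. Those in the range of `φ` have
      -- become isolated, and an isolated vertex has zero half-edges rather than the two required.
      have hdisj : ∀ v ∈ S, v ∉ Set.range φ := by
        intro v hv hr
        have hno : ∀ x : {x // ¬ f x ∈ Set.range φ}, f x ∈ ({v} : Finset V) → False :=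
          fun x hx => x.2 (by rw [Finset.mem_singleton.1 hx]; exact hr)
        have h3 := hS.minimal {v} (Finset.singleton_subset_iff.2 hv)
          (Finset.singleton_nonempty v) fun x hx => (hno x hx).elim
        have h4 := hS.card
        rw [← h3, Finset.card_singleton] at h4
        have h5 : {x : {x // ¬ f x ∈ Set.range φ} | f x ∈ ({v} : Finset V)} = ∅ :=
          Set.eq_empty_of_forall_notMem fun x hx => hno x hx
        rw [h5, Set.ncard_empty] at h4
        omega
      have hS' := (isUnicyclicPart_restrict_iff (p := fun x => ¬ f x ∈ Set.range φ)
        (fun x => not_congr (h x)) fun x hx => hdisj _ hx).1 hS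
      obtain ⟨v, hv⟩ := hS.nonempty
      exact hdisj v hv ((h1 v).1 ((inUnicyclicComponent_iff f hm v).2 ⟨S, hv, hS'⟩))
  · rintro ⟨h, h1, h2⟩
    refine ⟨fun v => ⟨fun hv => ?_, ?_⟩, fun e => ?_⟩
    · by_contra hvr
      obtain ⟨S, hvS, hS⟩ := (inUnicyclicComponent_iff f hm v).1 hv
      refine h2 ⟨S, (isUnicyclicPart_restrict_iff (p := fun x => ¬ f x ∈ Set.range φ)
        (fun x => not_congr (h x)) fun x hx hr => hvr ?_).2 hS⟩
      have h3 := hS.minimal (S.filter fun v => v ∈ Set.range φ) (Finset.filter_subset _ _)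
        ⟨f x, Finset.mem_filter.2 ⟨hx, hr⟩⟩ fun y hy => by
          rw [Finset.mem_filter] at hy ⊢
          exact ⟨hS.closed y hy.1, (h y).2 hy.2⟩
      rw [← h3] at hvS
      exact (Finset.mem_filter.1 hvS).2
    · rintro ⟨w, rfl⟩
      have hw := hH w
      rw [← h1, inUnicyclicComponent_iff _ (hm.restrict h)] at hw
      obtain ⟨S, hwS, hS⟩ := hw
      exact (inUnicyclicComponent_iff f hm _).2
        ⟨S.map φ, Finset.mem_map_of_mem φ hwS, hS.map_of_pullback⟩
    · rw [← h1, mult_graph_pullback hm]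

theorem mcount_isFragEmbedding [Fintype X] [Fintype V] [Fintype W] (f : X → V) {H : Multigraph W}
    (hH : H.IsFragment) (φ : W ↪ V) :
    edgeSymmetries H * (mcount fun m => IsFragEmbedding (graph f m) H φ) =
      if ∀ w, (Finset.univ.filter fun x => f x = φ w).card = H.degree w then
        (∏ w, (H.degree w).factorial) * mcount fun m =>
          ¬ HasUnicyclic (fun x : {x // ¬ f x ∈ Set.range φ} => f x) m
      else 0 := by
  rw [mcount_congr fun m hm => isFragEmbedding_iff hm hH φ,
    mcount_split (fun x => f x ∈ Set.range φ) (fun m => graph (pullback f φ) m = H)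
      fun m => ¬ HasUnicyclic (fun x : {x // ¬ f x ∈ Set.range φ} => f x) m]
  split_ifs with h
  · rw [← mcount_graph_eq (pullback f φ) H fun w => (card_pullback_eq f φ w).trans (h w)]
    ring
  · have : (mcount fun m => graph (pullback f φ) m = H) = 0 := by
      rw [mcount, Set.ncard_eq_zero]
      refine Set.eq_empty_of_forall_notMem fun m hm => h fun w => ?_
      rw [← card_pullback_eq, ← degree_graph _ hm.1, hm.2]
    rw [this]
    ring

/-- The embeddings that preserve the degrees. -/
noncomputable def degreeEmbeddings [Fintype X] [Fintype V] [Fintype W] (f : X → V)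
    (H : Multigraph W) : Finset (W ↪ V) :=
  Finset.univ.filter fun φ => ∀ w, (Finset.univ.filter fun x => f x = φ w).card = H.degree w

theorem authe_mul_mcount [Fintype X] [Fintype V] [Fintype W] (f : X → V) {H : Multigraph W}
    (hH : H.IsFragment) :
    H.authe * (mcount fun m => Nonempty (Multigraph.Iso (graph f m).frag H)) =
      (∏ w, (H.degree w).factorial) * ∑ φ ∈ degreeEmbeddings f H, mcount fun m =>
        ¬ HasUnicyclic (fun x : {x // ¬ f x ∈ Set.range φ} => f x) m := by
  have h : H.authe = edgeSymmetries H * H.aut := by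
    rw [Multigraph.authe, edgeSymmetries]
    ring
  rw [h, mul_assoc, aut_mul_mcount, Finset.mul_sum, degreeEmbeddings, Finset.sum_filter,
    Finset.mul_sum]
  refine Finset.sum_congr rfl fun φ _ => ?_
  rw [mcount_isFragEmbedding f hH, mul_ite, mul_zero]

theorem card_filter_fst_eq [Fintype V] (d : V → ℕ) (v : V) :
    (Finset.univ.filter fun x : (v : V) × Fin (d v) => x.1 = v).card = d v := by
  rw [← Fintype.card_fin (d v), ← Finset.card_univ,
    ← Finset.card_map (Function.Embedding.sigmaMk (β := fun v => Fin (d v)) v)]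
  congr 1
  ext ⟨u, i⟩
  simp only [Finset.mem_filter, Finset.mem_univ, true_and, Finset.mem_map,
    Function.Embedding.sigmaMk_apply]
  constructor
  · rintro rfl
    exact ⟨i, rfl⟩
  · rintro ⟨j, hj⟩
    exact (congrArg Sigma.fst hj).symm

/-- `mcount_graph_eq` shows that `H` is the multigraph of some matching of its own half-edges; its
vertices are then partitioned into unicyclic parts, each with twice as many half-edges as vertices.
-/
theorem sum_degree_of_isFragment [Fintype W] {H : Multigraph W} (hH : H.IsFragment) :
    ∑ w, H.degree w = 2 * Fintype.card W := by
  have hdeg := card_filter_fst_eq H.degree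
  have hpos : 0 < mcount fun m : Equiv.Perm ((w : W) × Fin (H.degree w)) =>
      graph Sigma.fst m = H := by
    have h := mcount_graph_eq (Sigma.fst : (w : W) × Fin (H.degree w) → W) H hdeg
    refine Nat.pos_of_ne_zero fun h0 => ?_
    rw [h0, zero_mul] at h
    exact (Finset.prod_pos fun w _ => Nat.factorial_pos (H.degree w)).ne h
  obtain ⟨m, hm, hmH⟩ := Set.nonempty_of_ncard_ne_zero hpos.ne'
  set f : (w : W) × Fin (H.degree w) → W := Sigma.fst
  set P : Finset (Finset W) := Finset.univ.filter fun S => IsUnicyclicPart f m S with hP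
  have hcov : ∀ w, ∃ S ∈ P, w ∈ S := fun w => by
    have h := hH w
    rw [← hmH, inUnicyclicComponent_iff f hm] at h
    obtain ⟨S, hw, hS⟩ := h
    exact ⟨S, Finset.mem_filter.2 ⟨Finset.mem_univ _, hS⟩, hw⟩
  have hdisj : ∀ S ∈ P, ∀ T ∈ P, S ≠ T → Disjoint S T := fun S hS T hT hne => by
    rw [hP, Finset.mem_filter] at hS hT
    exact Finset.disjoint_left.2 fun w hw hw' =>
      hne (hS.2.toIsComponent.eq_of_mem hT.2.toIsComponent hw hw')
  have h1 : ∀ S ∈ P, ∑ w ∈ S, H.degree w = ∑ w ∈ S, 2 := fun S hS => by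
    rw [hP, Finset.mem_filter] at hS
    rw [Finset.sum_const, smul_eq_mul, mul_comm, ← hS.2.card, Set.ncard_eq_toFinset_card',
      Finset.card_eq_sum_card_fiberwise (f := f) (t := S)]
    · refine Finset.sum_congr rfl fun w hw => ?_
      rw [← hdeg w]
      congr 1
      ext x
      simp only [Finset.mem_filter, Finset.mem_univ, true_and, Set.mem_toFinset, Set.mem_ofPred_eq]
      constructor
      · intro h
        exact ⟨by rw [h]; exact hw, h⟩
      · rintro ⟨_, h⟩
        exact h
    · intro x hx
      simpa using hx
  have h2 : (Finset.univ : Finset W) = P.biUnion fun S => S := by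
    ext w
    simpa using hcov w
  calc ∑ w, H.degree w = ∑ S ∈ P, ∑ w ∈ S, H.degree w := by
        rw [h2, Finset.sum_biUnion hdisj]
    _ = ∑ S ∈ P, ∑ w ∈ S, 2 := Finset.sum_congr rfl h1
    _ = ∑ w : W, 2 := by rw [h2, Finset.sum_biUnion hdisj]
    _ = 2 * Fintype.card W := by simp [mul_comm]

theorem card_compl_range [Fintype X] [Fintype V] [Fintype W] {f : X → V} {H : Multigraph W}
    (hH : H.IsFragment) {φ : W ↪ V} [Fintype {x // ¬ f x ∈ Set.range φ}] (hφ : φ ∈ degreeEmbeddings f H) :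
    Fintype.card {x // ¬ f x ∈ Set.range φ} + 2 * Fintype.card W = Fintype.card X := by
  have h1 : Fintype.card {x // f x ∈ Set.range φ} = 2 * Fintype.card W := by
    rw [← sum_degree_of_isFragment hH, ← Finset.card_univ,
      Finset.card_eq_sum_card_fiberwise (f := pullback f φ) (t := Finset.univ)
        fun x _ => Finset.mem_univ _]
    refine Finset.sum_congr rfl fun w _ => ?_
    rw [card_pullback_eq]
    exact (Finset.mem_filter.1 hφ).2 w
  rw [← h1, add_comm]
  exact Fintype.card_congr (Equiv.sumCompl fun x => f x ∈ Set.range φ) ▸ Fintype.card_sum.symm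

end

/-! ### Half-edges outside a copy of the fragment -/

section

variable {X V W : Type*}

/-- The diagonal supplies the missing pairs, so the count of `pairs` is controlled by the first two
moments. -/
theorem card_pairs_add [Fintype X] [Fintype V] (f : X → V) :
    (pairs f).card + Fintype.card X = ∑ v, (Finset.univ.filter fun x => f x = v).card ^ 2 := by
  have h1 : (Finset.univ.filter fun p : X × X => f p.1 = f p.2).card =
      ∑ v, (Finset.univ.filter fun x => f x = v).card ^ 2 := by
    rw [Finset.card_eq_sum_card_fiberwise (f := fun p => f p.1) (t := Finset.univ)
      fun x _ => Finset.mem_univ _]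
    refine Finset.sum_congr rfl fun v _ => ?_
    rw [sq, ← Finset.card_product]
    congr 1
    ext p
    simp only [Finset.mem_filter, Finset.mem_univ, true_and, Finset.mem_product]
    constructor
    · rintro ⟨h, h'⟩
      exact ⟨h', by rw [← h, h']⟩
    · rintro ⟨h, h'⟩
      exact ⟨by rw [h, h'], h⟩
  rw [← h1, ← Finset.card_filter_add_card_filter_not (s := Finset.univ.filter fun p => f p.1 = f p.2)
      (fun p : X × X => p.1 ≠ p.2),
    Finset.filter_filter, pairs]
  congr 1
  rw [← Finset.card_univ, ← Finset.card_map ⟨fun x => (x, x), fun a b h => congrArg Prod.fst h⟩]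
  congr 1
  ext ⟨a, b⟩
  rw [Finset.mem_filter, Finset.mem_filter, Finset.mem_map, not_ne_iff]
  constructor
  · rintro ⟨x, _, h⟩
    obtain ⟨rfl, rfl⟩ := Prod.mk.inj h
    exact ⟨⟨Finset.mem_univ _, rfl⟩, rfl⟩
  · rintro ⟨_, h⟩
    exact ⟨a, Finset.mem_univ _, Prod.ext rfl h⟩

theorem card_pairs_restrict [Fintype X] (f : X → V) (p : X → Prop) [Fintype {x // p x}] :
    (pairs fun x : {x // p x} => f x).card ≤ (pairs f).card := by
  rw [← Finset.card_map ((Function.Embedding.subtype p).prodMap (Function.Embedding.subtype p))]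
  refine Finset.card_le_card fun q hq => ?_
  obtain ⟨⟨a, b⟩, hab, rfl⟩ := Finset.mem_map.1 hq
  simp only [pairs, Finset.mem_filter, Finset.mem_univ, true_and] at hab ⊢
  exact ⟨hab.1, fun h => hab.2 (Subtype.ext h)⟩

theorem card_pairs_le_restrict [Fintype X] (f : X → V) (A : Set V) [Fintype {x // ¬ f x ∈ A}]
    [Fintype {x // f x ∈ A}] : (pairs f).card ≤
      (pairs fun x : {x // ¬ f x ∈ A} => f x).card + Fintype.card {x // f x ∈ A} ^ 2 := by
  rw [← Finset.card_map ((Function.Embedding.subtype fun x => ¬ f x ∈ A).prodMap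
      (Function.Embedding.subtype _)), sq, ← Fintype.card_prod, ← Finset.card_univ,
    ← Finset.card_map ((Function.Embedding.subtype fun x => f x ∈ A).prodMap
      (Function.Embedding.subtype _))]
  refine (Finset.card_le_card fun q hq => ?_).trans (Finset.card_union_le _ _)
  obtain ⟨a, b⟩ := q
  simp only [pairs, Finset.mem_filter, Finset.mem_univ, true_and] at hq
  rw [Finset.mem_union, Finset.mem_map, Finset.mem_map]
  by_cases ha : f a ∈ A
  · exact Or.inr ⟨(⟨a, ha⟩, ⟨b, hq.1 ▸ ha⟩), Finset.mem_univ _, rfl⟩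
  · refine Or.inl ⟨(⟨a, ha⟩, ⟨b, hq.1 ▸ ha⟩), ?_, rfl⟩
    simp only [pairs, Finset.mem_filter, Finset.mem_univ, true_and]
    exact ⟨hq.1, fun h => hq.2 (congrArg Subtype.val h)⟩

/-- Exactly `2 * Fintype.card W` half-edges disappear. They destroy at most the square of that many
pairs and increase no degree. -/
theorem isNearRegime_compl_range {ν δ δ' : ℝ} (h0 : 0 ≤ ν) (h1 : ν < 1) {X V : Type}
    {W : Type*} [Fintype X] [Fintype V] [Fintype W] {f : X → V} {H : Multigraph W}
    (hH : H.IsFragment) (hf : IsNearRegime ν δ f) (hδ : 0 < δ)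
    (hδ' : 2 * (1 + ((2 * Fintype.card W + 1 : ℕ) : ℝ)) ^ 2 * δ ≤ δ')
    (hδL : (4 * ((2 * Fintype.card W + 1 : ℕ) : ℝ) + 4) * δ ≤ 1) {φ : W ↪ V}
    [Fintype {x // ¬ f x ∈ Set.range φ}] (hφ : φ ∈ degreeEmbeddings f H) :
    IsNearRegime ν δ' fun x : {x // ¬ f x ∈ Set.range φ} => f x := by
  have hc := card_compl_range hH hφ
  have hcA : Fintype.card {x // f x ∈ Set.range φ} = 2 * Fintype.card W := by
    have h2 : Fintype.card {x // f x ∈ Set.range φ} + Fintype.card {x // ¬ f x ∈ Set.range φ} =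
        Fintype.card X := by
      rw [← Fintype.card_sum]
      exact Fintype.card_congr (Equiv.sumCompl fun x => f x ∈ Set.range φ)
    omega
  have hL : (1 : ℝ) ≤ ((2 * Fintype.card W + 1 : ℕ) : ℝ) := by
    exact_mod_cast (by omega : 1 ≤ 2 * Fintype.card W + 1)
  have hbig := hf.large
  refine IsNearRegime.perturb h0 h1 hf hδ hδ' hδL (by omega : Fintype.card W ≤ _) hc ?_ ?_
  · have h3 := card_pairs_restrict f fun x => ¬ f x ∈ Set.range φ
    have h4 := card_pairs_le_restrict f (Set.range φ)
    rw [hcA] at h4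
    have h3' : ((pairs fun x : {x // ¬ f x ∈ Set.range φ} => f x).card : ℝ) ≤ (pairs f).card := by
      exact_mod_cast h3
    have h4' : ((pairs f).card : ℝ) ≤ (pairs fun x : {x // ¬ f x ∈ Set.range φ} => f x).card +
        (2 * Fintype.card W) ^ 2 := by
      exact_mod_cast h4
    rw [abs_sub_comm, abs_of_nonneg (by linarith)]
    have h5 : ((2 * Fintype.card W : ℝ)) ^ 2 ≤ ((2 * Fintype.card W + 1 : ℕ) : ℝ) ^ 2 := by
      push_cast
      gcongr
      linarith
    calc _ ≤ ((2 * Fintype.card W + 1 : ℕ) : ℝ) ^ 2 := by linarith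
      _ ≤ _ := le_mul_of_one_le_right (by positivity) hbig
  · intro v
    have h6 : (Finset.univ.filter fun x : {x // ¬ f x ∈ Set.range φ} => f x = v).card ≤
        (Finset.univ.filter fun x => f x = v).card := by
      rw [← Finset.card_map (Function.Embedding.subtype _)]
      refine Finset.card_le_card fun x hx => ?_
      obtain ⟨y, hy, rfl⟩ := Finset.mem_map.1 hx
      exact Finset.mem_filter.2 ⟨Finset.mem_univ _, (Finset.mem_filter.1 hy).2⟩
    calc _ ≤ ((Finset.univ.filter fun x => f x = v).card : ℝ) ^ 2 := by
          gcongr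
      _ ≤ δ * Fintype.card X := hf.degree v
      _ ≤ _ := le_mul_of_one_le_left (by linarith) (one_le_pow₀ hL)

/-- The number of degree-preserving embeddings, compared with that of degree-preserving maps. -/
theorem card_degreeEmbeddings_bounds [Fintype X] [Fintype V] [Fintype W] (f : X → V)
    (H : Multigraph W) :
    (degreeEmbeddings f H).card ≤ (∏ w, (Finset.univ.filter fun v =>
      (Finset.univ.filter fun x => f x = v).card = H.degree w).card) ∧
    (∏ w, (Finset.univ.filter fun v =>
      (Finset.univ.filter fun x => f x = v).card = H.degree w).card) +
      (Fintype.card V).descFactorial (Fintype.card W) ≤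
      (degreeEmbeddings f H).card + Fintype.card V ^ Fintype.card W := by
  set F := Fintype.piFinset fun w : W => Finset.univ.filter fun v =>
      (Finset.univ.filter fun x => f x = v).card = H.degree w with hF
  have hFc : F.card = ∏ w, (Finset.univ.filter fun v =>
      (Finset.univ.filter fun x => f x = v).card = H.degree w).card := Fintype.card_piFinset _
  have hmem : ∀ ψ : W → V, ψ ∈ F ↔
      ∀ w, (Finset.univ.filter fun x => f x = ψ w).card = H.degree w := fun ψ => by
    simp [hF]
  let ι : (W ↪ V) ↪ (W → V) := ⟨fun φ => φ, DFunLike.coe_injective⟩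
  have hdesc : (Finset.univ.map ι).card = (Fintype.card V).descFactorial (Fintype.card W) := by
    rw [Finset.card_map, Finset.card_univ, Fintype.card_embedding_eq]
  have hE : (degreeEmbeddings f H).map ι = F ∩ Finset.univ.map ι := by
    ext ψ
    rw [Finset.mem_inter, hmem, Finset.mem_map, Finset.mem_map]
    constructor
    · rintro ⟨φ, hφ, rfl⟩
      exact ⟨(Finset.mem_filter.1 hφ).2, φ, Finset.mem_univ _, rfl⟩
    · rintro ⟨h, φ, _, rfl⟩
      exact ⟨φ, Finset.mem_filter.2 ⟨Finset.mem_univ _, h⟩, rfl⟩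
  rw [← hFc, ← hdesc, ← Finset.card_map ι (s := degreeEmbeddings f H), hE]
  refine ⟨Finset.card_le_card Finset.inter_subset_left, ?_⟩
  -- The degree-preserving maps that are not injective number at most all non-injective maps, a
  -- vanishing proportion of the `n ^ k` maps.
  rw [← Finset.card_union_add_card_inter, add_comm]
  refine Nat.add_le_add_left ?_ _
  rw [← Fintype.card_fun, ← Finset.card_univ]
  exact Finset.card_le_card (Finset.subset_univ _)

end

/-! ### Asymptotics -/

section

/-! ### Moments of the limit law -/

section Moments

variable {D : PMF ℕ}

theorem summable_mul_of_summable_sq (h : Summable fun k : ℕ => (k : ℝ) ^ 2 * (D k).toReal) :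
    Summable fun k : ℕ => (k : ℝ) * (D k).toReal := by
  refine h.of_nonneg_of_le (fun k => by positivity) fun k => ?_
  have : (k : ℝ) ≤ (k : ℝ) ^ 2 := by exact_mod_cast Nat.le_self_pow two_ne_zero k
  gcongr

theorem factorialMoment_one : factorialMoment D 1 = limitMoment D 1 := by
  simp [factorialMoment, limitMoment]

theorem factorialMoment_two (h : Summable fun k : ℕ => (k : ℝ) ^ 2 * (D k).toReal) :
    factorialMoment D 2 = limitMoment D 2 - limitMoment D 1 := by
  rw [factorialMoment, limitMoment, limitMoment]
  simp only [pow_one]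
  rw [← h.tsum_sub (summable_mul_of_summable_sq h)]
  refine tsum_congr fun k => ?_
  rw [Nat.cast_descFactorial_two]
  ring

theorem nuParam_nonneg : 0 ≤ nuParam D :=
  div_nonneg (tsum_nonneg fun k => by positivity) (tsum_nonneg fun k => by positivity)

end Moments

/-! ### Limits along the degree sequence -/

section Sequence

variable {d : (n : ℕ) → Fin n → ℕ} {D : PMF ℕ}

theorem card_halfEdge {n : ℕ} (d : Fin n → ℕ) : Fintype.card (HalfEdge d) = ∑ v, d v := by
  simp [HalfEdge]

theorem even_card_halfEdge {n : ℕ} {d : Fin n → ℕ} (h : Feasible d) :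
    Even (Fintype.card (HalfEdge d)) := by
  obtain ⟨G, hG⟩ := h
  rw [card_halfEdge, ← Finset.sum_congr rfl fun v _ => hG v,
    SimpleGraph.sum_degrees_eq_twice_card_edges]
  exact even_two_mul _

theorem tendsto_card_halfEdge (hd : RegularDegrees d D) :
    Tendsto (fun n => (Fintype.card (HalfEdge (d n)) : ℝ) / n) atTop
      (𝓝 (factorialMoment D 1)) := by
  rw [factorialMoment_one]
  refine hd.tendsto_mean.congr fun n => ?_
  rw [empiricalMoment, card_halfEdge]
  simp

theorem tendsto_card_pairs (hd : RegularDegrees d D) :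
    Tendsto (fun n => ((pairs (Sigma.fst : HalfEdge (d n) → Fin n)).card : ℝ) / n) atTop
      (𝓝 (factorialMoment D 2)) := by
  rw [factorialMoment_two hd.summable_sq]
  refine (hd.tendsto_sq.sub hd.tendsto_mean).congr fun n => ?_
  have h := card_pairs_add (Sigma.fst : HalfEdge (d n) → Fin n)
  rw [Finset.sum_congr rfl fun v _ => by rw [card_filter_fst_eq (d n) v], card_halfEdge] at h
  have h' : ((pairs (Sigma.fst : HalfEdge (d n) → Fin n)).card : ℝ) + ∑ v, (d n v : ℝ) =
      ∑ v, (d n v : ℝ) ^ 2 := by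
    exact_mod_cast h
  rw [empiricalMoment, empiricalMoment, ← h']
  simp only [pow_one]
  ring

theorem sum_pow_vertexCount {n : ℕ} (d : Fin n → ℕ) (K : ℕ) :
    ∑ k ∈ Finset.range K, (k : ℝ) ^ 2 * vertexCount d k =
      ∑ v ∈ Finset.univ.filter (fun v => d v < K), (d v : ℝ) ^ 2 := by
  rw [← Finset.sum_fiberwise_of_maps_to (s := Finset.univ.filter fun v => d v < K)
    (t := Finset.range K) (g := d) fun v hv => by simpa using hv]
  refine Finset.sum_congr rfl fun k hk => ?_
  have : (Finset.univ.filter fun v => d v < K).filter (fun v => d v = k) =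
      Finset.univ.filter fun v => d v = k := by
    ext v
    simp only [Finset.mem_filter, Finset.mem_univ, true_and, and_iff_right_iff_imp]
    rintro rfl
    exact Finset.mem_range.1 hk
  rw [this, vertexCount, Finset.sum_congr rfl (g := fun _ => (k : ℝ) ^ 2), Finset.sum_const,
    nsmul_eq_mul, mul_comm]
  intro v hv
  rw [(Finset.mem_filter.1 hv).2]

/-- The largest degree is `o(√n)`. -/
theorem eventually_degree_sq_le (hd : RegularDegrees d D) {δ : ℝ} (hδ : 0 < δ) :
    ∀ᶠ n in atTop, ∀ v, (d n v : ℝ) ^ 2 ≤ δ * n := by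
  -- Convergence of the law and of the second moment makes the part of the second moment from
  -- degrees at least `K` less than δ; a single such vertex then has squared degree at most `δ * n`.
  have hs := hd.summable_sq.hasSum.tendsto_sum_nat
  obtain ⟨K, hK⟩ := (hs.eventually_const_lt (sub_lt_self (limitMoment D 2) hδ)).exists
  have h1 : Tendsto (fun n : ℕ => empiricalMoment (d n) 2 - ∑ k ∈ Finset.range K,
      (k : ℝ) ^ 2 * ((vertexCount (d n) k : ℝ) / n)) atTop
      (𝓝 (limitMoment D 2 - ∑ k ∈ Finset.range K, (k : ℝ) ^ 2 * (D k).toReal)) :=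
    hd.tendsto_sq.sub (tendsto_finsetSum _ fun k _ => (hd.tendsto_law k).const_mul _)
  have h2 : Tendsto (fun n : ℕ => δ * (n : ℝ)) atTop atTop :=
    tendsto_natCast_atTop_atTop.const_mul_atTop hδ
  filter_upwards [h1.eventually_lt_const (by linarith : _ < δ),
    h2.eventually_ge_atTop ((K : ℝ) ^ 2), eventually_gt_atTop 0] with n hn1 hn2 hn0 v
  by_cases hv : d n v < K
  · refine le_trans ?_ hn2
    gcongr
  · have hn0' : (0 : ℝ) < n := by exact_mod_cast hn0
    have h3 : ∑ k ∈ Finset.range K, (k : ℝ) ^ 2 * ((vertexCount (d n) k : ℝ) / n) =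
        (∑ v ∈ Finset.univ.filter (fun v => d n v < K), (d n v : ℝ) ^ 2) / n := by
      rw [← sum_pow_vertexCount, Finset.sum_div]
      exact Finset.sum_congr rfl fun k _ => by rw [mul_div_assoc]
    rw [h3, empiricalMoment, ← sub_div, div_lt_iff₀ hn0',
      ← Finset.sum_filter_add_sum_filter_not _ (fun v => d n v < K), add_sub_cancel_left] at hn1
    refine le_trans ?_ hn1.le
    exact Finset.single_le_sum (f := fun v => (d n v : ℝ) ^ 2) (fun _ _ => by positivity)
      (Finset.mem_filter.2 ⟨Finset.mem_univ _, hv⟩)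

theorem eventually_isNearRegime (hd : RegularDegrees d D) (hmean : 0 < factorialMoment D 1)
    {δ : ℝ} (hδ : 0 < δ) :
    ∀ᶠ n in atTop, IsNearRegime (nuParam D) δ (Sigma.fst : HalfEdge (d n) → Fin n) := by
  set ρ := factorialMoment D 1 with hρ
  have hM := tendsto_card_halfEdge hd
  have hpair : Tendsto (fun n => ((pairs (Sigma.fst : HalfEdge (d n) → Fin n)).card : ℝ) / n -
      nuParam D * ((Fintype.card (HalfEdge (d n)) : ℝ) / n)) atTop (𝓝 0) := by
    have h := (tendsto_card_pairs hd).sub (hM.const_mul (nuParam D))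
    rwa [nuParam, div_mul_cancel₀ _ hmean.ne', sub_self] at h
  -- Eventually `M ≥ ρ n / 2`, which converts bounds relative to `n` into bounds relative to `M`.
  have hη : 0 < δ * (ρ / 2) := by positivity
  have hlarge : Tendsto (fun n : ℕ => (δ * (ρ / 2)) * (n : ℝ)) atTop atTop :=
    tendsto_natCast_atTop_atTop.const_mul_atTop hη
  filter_upwards [hM.eventually_const_lt (half_lt_self hmean), eventually_degree_sq_le hd hη,
    hpair.abs.eventually_lt_const (by rwa [abs_zero] : |(0 : ℝ)| < δ * (ρ / 2)),
    hlarge.eventually_ge_atTop 1, eventually_gt_atTop 0] with n h1 h2 h3 h4 h5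
  have hn : (0 : ℝ) < n := by exact_mod_cast h5
  rw [lt_div_iff₀ hn] at h1
  have hle : δ * (ρ / 2) * n ≤ δ * Fintype.card (HalfEdge (d n)) := by
    rw [mul_assoc]
    exact mul_le_mul_of_nonneg_left h1.le hδ.le
  refine ⟨even_card_halfEdge (hd.feasible n), h4.trans hle, ?_, fun v => ?_⟩
  · refine le_trans ?_ hle
    rw [← div_le_iff₀ hn]
    refine le_trans (le_of_eq ?_) h3.le
    rw [← mul_div_assoc, ← sub_div, abs_div, abs_of_pos hn]
  · rw [card_filter_fst_eq]
    exact (h2 v).trans hle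

theorem tendsto_matchWeight (hd : RegularDegrees d D) (k : ℕ) :
    Tendsto (fun n => (matchWeight (Fintype.card (HalfEdge (d n))) k : ℝ) / (n : ℝ) ^ k) atTop
      (𝓝 (factorialMoment D 1 ^ k)) := by
  have hM := tendsto_card_halfEdge hd
  have h1 : ∀ c : ℕ, Tendsto (fun n => ((Fintype.card (HalfEdge (d n)) - c : ℕ) : ℝ) / n) atTop
      (𝓝 (factorialMoment D 1)) := fun c => by
    have h2 : Tendsto (fun n : ℕ => (Fintype.card (HalfEdge (d n)) : ℝ) / n - c / n) atTop
        (𝓝 (factorialMoment D 1)) := by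
      simpa using hM.sub (tendsto_const_div_atTop_nhds_zero_nat (c : ℝ))
    refine tendsto_of_tendsto_of_tendsto_of_le_of_le h2 hM (fun n => ?_) fun n => ?_
    · change _ / _ - _ / _ ≤ _ / _
      rw [← sub_div]
      gcongr
      rw [sub_le_iff_le_add]
      rw [← Nat.cast_add]
      exact Nat.cast_le.2 le_tsub_add
    · change _ / _ ≤ _ / _
      gcongr
      exact Nat.sub_le _ _
  have h3 := tendsto_finsetProd (Finset.range k) fun l _ => h1 (1 + 2 * l)
  rw [Finset.prod_const, Finset.card_range] at h3
  refine h3.congr fun n => ?_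
  rw [matchWeight, Nat.cast_prod, Finset.prod_div_distrib, Finset.prod_const, Finset.card_range]
  simp only [Nat.sub_sub]

/-- The images of the vertices of `H` may be chosen independently up to the negligible loss from
coincidences. -/
theorem tendsto_card_degreeEmbeddings (hd : RegularDegrees d D) {W : Type*} [Fintype W]
    (H : Multigraph W) :
    Tendsto (fun n => ((degreeEmbeddings (Sigma.fst : HalfEdge (d n) → Fin n) H).card : ℝ) /
      (n : ℝ) ^ Fintype.card W) atTop (𝓝 (∏ w, (D (H.degree w)).toReal)) := by
  set k := Fintype.card W with hk
  have hup : Tendsto (fun n : ℕ => (∏ w, (vertexCount (d n) (H.degree w) : ℝ)) / (n : ℝ) ^ k) atTop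
      (𝓝 (∏ w, (D (H.degree w)).toReal)) := by
    refine (tendsto_finsetProd Finset.univ fun w _ => hd.tendsto_law (H.degree w)).congr
      fun n => ?_
    rw [Finset.prod_div_distrib, Finset.prod_const, Finset.card_univ]
  have hdesc : Tendsto (fun n : ℕ => (n.descFactorial k : ℝ) / (n : ℝ) ^ k) atTop (𝓝 1) := by
    have h1 : Tendsto (fun n : ℕ => (((n : ℝ) - k) / n) ^ k) atTop (𝓝 1) := by
      have h2 : Tendsto (fun n : ℕ => 1 - (k : ℝ) / n) atTop (𝓝 1) := by
        simpa using tendsto_const_nhds.sub (tendsto_const_div_atTop_nhds_zero_nat (k : ℝ))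
      have h3 := h2.pow k
      rw [one_pow] at h3
      refine h3.congr' ?_
      filter_upwards [eventually_gt_atTop 0] with n hn
      have hn' : (n : ℝ) ≠ 0 := by exact_mod_cast hn.ne'
      rw [sub_div, div_self hn']
    refine tendsto_of_tendsto_of_tendsto_of_le_of_le' h1 tendsto_const_nhds ?_ ?_
    · filter_upwards [eventually_ge_atTop k] with n hn
      rw [div_pow]
      gcongr
      have h := Nat.pow_sub_le_descFactorial n k
      have h' : (n - k) ^ k ≤ n.descFactorial k :=
        (Nat.pow_le_pow_left (by omega) k).trans h
      rw [← Nat.cast_sub hn]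
      exact_mod_cast h'
    · refine Eventually.of_forall fun n => div_le_one_of_le₀ ?_ (by positivity)
      exact_mod_cast Nat.descFactorial_le_pow n k
  have hlow : Tendsto (fun n : ℕ => (∏ w, (vertexCount (d n) (H.degree w) : ℝ)) / (n : ℝ) ^ k +
      (n.descFactorial k : ℝ) / (n : ℝ) ^ k - 1) atTop (𝓝 (∏ w, (D (H.degree w)).toReal)) := by
    simpa using (hup.add hdesc).sub_const 1
  have hb : ∀ n, ((degreeEmbeddings (Sigma.fst : HalfEdge (d n) → Fin n) H).card : ℝ) ≤
        ∏ w, (vertexCount (d n) (H.degree w) : ℝ) ∧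
      ∏ w, (vertexCount (d n) (H.degree w) : ℝ) + (n.descFactorial k : ℝ) ≤
        (degreeEmbeddings (Sigma.fst : HalfEdge (d n) → Fin n) H).card + (n : ℝ) ^ k := fun n => by
    have h := card_degreeEmbeddings_bounds (Sigma.fst : HalfEdge (d n) → Fin n) H
    simp only [card_filter_fst_eq, Fintype.card_fin] at h
    have hvc : ∀ w, (Finset.univ.filter fun v => d n v = H.degree w).card =
        vertexCount (d n) (H.degree w) := fun w => rfl
    simp only [hvc] at h
    exact ⟨by exact_mod_cast h.1, by exact_mod_cast h.2⟩
  refine tendsto_of_tendsto_of_tendsto_of_le_of_le' hlow hup ?_ ?_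
  · filter_upwards [eventually_gt_atTop 0] with n hn
    have hn' : (0 : ℝ) < (n : ℝ) ^ k := by positivity
    rw [← add_div, sub_le_iff_le_add, div_add_one hn'.ne', div_le_div_iff_of_pos_right hn']
    exact (hb n).2
  · refine Eventually.of_forall fun n => ?_
    gcongr
    exact (hb n).1

end Sequence

theorem finprod_degreeCount {W : Type*} [Fintype W] (H : Multigraph W) (g : ℕ → ℝ) :
    ∏ᶠ i : ℕ, g i ^ H.degreeCount i = ∏ w, g (H.degree w) := by
  rw [Finset.prod_comp, finprod_eq_prod_of_mulSupport_subset (s := Finset.univ.image H.degree)]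
  · rfl
  · intro i hi
    rw [Finset.coe_image, Finset.coe_univ, Set.image_univ]
    by_contra h
    refine hi ?_
    have : H.degreeCount i = 0 := by
      rw [Multigraph.degreeCount, Finset.card_eq_zero, Finset.filter_eq_empty_iff]
      exact fun w _ hw => h ⟨w, hw⟩
    simp only [this, pow_zero]

theorem authe_pos {W : Type*} [Fintype W] (H : Multigraph W) : 0 < H.authe := by
  refine Nat.mul_pos (Nat.mul_pos ?_ (by positivity))
    (Finset.prod_pos fun e _ => Nat.factorial_pos _)
  rw [Multigraph.aut, Nat.card_pos_iff]
  refine ⟨⟨⟨Equiv.refl W, fun e => ?_⟩⟩, ?_⟩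
  · simp
  · unfold Multigraph.Iso
    infer_instance

/-- A relative error suffices since a convergent sequence is eventually bounded. -/
theorem tendsto_of_eventually_abs_sub_le {a b : ℕ → ℝ} {s B : ℝ} (hb : Tendsto b atTop (𝓝 B))
    (hB : 0 ≤ B) (h : ∀ ε > 0, ∀ᶠ n in atTop, |a n - s * b n| ≤ ε * b n) :
    Tendsto a atTop (𝓝 (s * B)) := by
  have h0 : Tendsto (fun n => a n - s * b n) atTop (𝓝 0) := by
    rw [Metric.tendsto_nhds]
    intro ε hε
    filter_upwards [h (ε / (B + 1)) (by positivity),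
      hb.eventually_lt_const (lt_add_one B)] with n h1 h2
    rw [Real.dist_eq, sub_zero]
    refine h1.trans_lt ?_
    rw [div_mul_eq_mul_div, div_lt_iff₀ (by linarith)]
    gcongr
  simpa using h0.add (hb.const_mul s)

/-- All terms of the sum over embeddings have the same number `pm (M - 2 * k)` of outer matchings,
which cancels against the same factor of the total. -/
theorem authe_mul_cmProb_near {ν ε : ℝ} {n : ℕ} {d : Fin n → ℕ} {W : Type*} [Fintype W]
    {H : Multigraph W} (hH : H.IsFragment) (heven : Even (Fintype.card (HalfEdge d)))
    (hlarge : 2 * Fintype.card W ≤ Fintype.card (HalfEdge d))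
    (h : ∀ φ ∈ degreeEmbeddings (Sigma.fst : HalfEdge d → Fin n) H,
      |(mcount (fun m => ¬ HasUnicyclic
          (fun x : {x : HalfEdge d // ¬ x.1 ∈ Set.range φ} => x.1.1) m) : ℝ) -
        Real.sqrt (1 - ν) *
          mcount (fun _ : Equiv.Perm {x : HalfEdge d // ¬ x.1 ∈ Set.range φ} => True)| ≤
      ε * mcount (fun _ : Equiv.Perm {x : HalfEdge d // ¬ x.1 ∈ Set.range φ} => True)) :
    |H.authe * cmProb d (fun G => Nonempty (Multigraph.Iso G.frag H)) - Real.sqrt (1 - ν) *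
      ((∏ w, ((H.degree w).factorial : ℝ)) *
        ((degreeEmbeddings (Sigma.fst : HalfEdge d → Fin n) H).card /
          matchWeight (Fintype.card (HalfEdge d)) (Fintype.card W)))| ≤
    ε * ((∏ w, ((H.degree w).factorial : ℝ)) *
        ((degreeEmbeddings (Sigma.fst : HalfEdge d → Fin n) H).card /
          matchWeight (Fintype.card (HalfEdge d)) (Fintype.card W))) := by
  set f := (Sigma.fst : HalfEdge d → Fin n) with hf
  set k := Fintype.card W
  set M := Fintype.card (HalfEdge d) with hM
  set P := ∏ w, ((H.degree w).factorial : ℝ) with hP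
  set Φ := degreeEmbeddings f H with hΦ
  set s := Real.sqrt (1 - ν)
  have hw : (0 : ℝ) < matchWeight M k := by exact_mod_cast matchWeight_pos hlarge
  have hq : (0 : ℝ) < pm (M - 2 * k) := by
    exact_mod_cast pm_pos_of_even ((Nat.even_sub hlarge).2 ⟨fun _ => even_two_mul _, fun _ => heven⟩)
  have htot : ((mcount fun _ : Equiv.Perm (HalfEdge d) => True : ℕ) : ℝ) =
      matchWeight M k * pm (M - 2 * k) := by
    rw [mcount_true, Nat.card_eq_fintype_card, pm_eq_matchWeight_mul k hlarge]
    push_cast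
    rfl
  have hrest : ∀ φ ∈ Φ, (mcount fun _ : Equiv.Perm {x // ¬ f x ∈ Set.range φ} => True) =
      pm (M - 2 * k) := fun φ hφ => by
    rw [mcount_true, Nat.card_eq_fintype_card]
    congr 1
    exact Nat.eq_sub_of_add_eq (card_compl_range hH hφ)
  have hcount : (H.authe : ℝ) * (mcount fun m => Nonempty (Multigraph.Iso (graph f m).frag H)) =
      P * ∑ φ ∈ Φ, ((mcount fun m =>
        ¬ HasUnicyclic (fun x : {x // ¬ f x ∈ Set.range φ} => f x) m : ℕ) : ℝ) := by
    have := authe_mul_mcount f hH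
    rw [hP]
    exact_mod_cast this
  have hsum : |∑ φ ∈ Φ, ((mcount fun m =>
      ¬ HasUnicyclic (fun x : {x // ¬ f x ∈ Set.range φ} => f x) m : ℕ) : ℝ) -
      Φ.card * (s * pm (M - 2 * k))| ≤ Φ.card * (ε * pm (M - 2 * k)) := by
    rw [← nsmul_eq_mul, ← nsmul_eq_mul, ← Finset.sum_const, ← Finset.sum_const,
      ← Finset.sum_sub_distrib]
    refine (Finset.abs_sum_le_sum_abs _ _).trans (Finset.sum_le_sum fun φ hφ => ?_)
    have h1 := h φ hφ
    rw [hrest φ hφ] at h1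
    exact h1
  have hP0 : 0 ≤ P := Finset.prod_nonneg fun w _ => by positivity
  have e1 : (H.authe : ℝ) * cmProb d (fun G => Nonempty (Multigraph.Iso G.frag H)) -
      s * (P * (Φ.card / matchWeight M k)) =
      P * (∑ φ ∈ Φ, ((mcount fun m =>
        ¬ HasUnicyclic (fun x : {x // ¬ f x ∈ Set.range φ} => f x) m : ℕ) : ℝ) -
        Φ.card * (s * pm (M - 2 * k))) / (matchWeight M k * pm (M - 2 * k)) := by
    rw [cmProb_eq, htot, ← mul_div_assoc, hcount]
    field_simp
  have e2 : ε * (P * (Φ.card / matchWeight M k)) =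
      P * (Φ.card * (ε * pm (M - 2 * k))) / (matchWeight M k * pm (M - 2 * k)) := by
    field_simp
  rw [e1, e2, abs_div, abs_mul, abs_of_nonneg hP0, abs_of_pos (mul_pos hw hq)]
  gcongr

end

end ConfigurationModel

/-! ### Assembly of the limit -/

theorem mainTheorem9 (d : (n : ℕ) → Fin n → ℕ) (D : PMF ℕ) (hd : RegularDegrees d D)
    (hmean : 0 < factorialMoment D 1) (hnu : nuParam D < 1)
    {W : Type*} [Fintype W] (H : Multigraph W) (hH : H.IsFragment) :
    Tendsto (fun n : ℕ => cmProb (d n) fun G => Nonempty (Multigraph.Iso G.frag H)) atTop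
      (𝓝 (Real.sqrt (1 - nuParam D) / (H.authe : ℝ) *
        ∏ᶠ i : ℕ, ((D i).toReal * (i.factorial : ℝ) / factorialMoment D 1) ^ H.degreeCount i)) := by
  open ConfigurationModel in
  have hauthe : (0 : ℝ) < H.authe := by exact_mod_cast authe_pos H
  set s := Real.sqrt (1 - nuParam D) with hs
  set k := Fintype.card W with hk
  set P := ∏ w, ((H.degree w).factorial : ℝ) with hP
  set A := ∏ w, (D (H.degree w)).toReal with hA
  have hlim : s / H.authe * ∏ᶠ i : ℕ,
      ((D i).toReal * (i.factorial : ℝ) / factorialMoment D 1) ^ H.degreeCount i =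
      s * (P * (A / factorialMoment D 1 ^ k)) / H.authe := by
    rw [finprod_degreeCount H fun i => (D i).toReal * (i.factorial : ℝ) / factorialMoment D 1,
      Finset.prod_div_distrib, Finset.prod_mul_distrib, Finset.prod_const, Finset.card_univ]
    ring
  have hb : Tendsto (fun n => P * (((degreeEmbeddings (Sigma.fst : HalfEdge (d n) → Fin n)
      H).card : ℝ) / matchWeight (Fintype.card (HalfEdge (d n))) k)) atTop
      (𝓝 (P * (A / factorialMoment D 1 ^ k))) := by
    refine Tendsto.const_mul P ?_
    refine ((tendsto_card_degreeEmbeddings hd H).div (tendsto_matchWeight hd k)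
      (by positivity)).congr' ?_
    filter_upwards [eventually_gt_atTop 0] with n hn
    have hn' : (n : ℝ) ^ k ≠ 0 := by positivity
    exact div_div_div_cancel_right₀ hn' _ _
  have ha := tendsto_of_eventually_abs_sub_le (s := s)
    (a := fun n => H.authe * cmProb (d n) fun G => Nonempty (Multigraph.Iso G.frag H)) hb
    (mul_nonneg (Finset.prod_nonneg fun w _ => by positivity)
      (div_nonneg (Finset.prod_nonneg fun w _ => by positivity) (by positivity)))
    (fun ε hε => by
      obtain ⟨δ', hδ', hnear⟩ := exists_not_hasUnicyclic_near nuParam_nonneg hnu hε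
      -- The added 1 keeps `L ≥ 1` even for the empty fragment, as the unchanged degree bounds
      -- require.
      set L : ℝ := ((2 * k + 1 : ℕ) : ℝ) with hL
      obtain ⟨δ, hδ, hδ1, hδ2⟩ : ∃ δ > 0, 2 * (1 + L) ^ 2 * δ ≤ δ' ∧ (4 * L + 4) * δ ≤ 1 := by
        have hL0 : 0 ≤ L := Nat.cast_nonneg _
        refine ⟨min (δ' / (2 * (1 + L) ^ 2)) (1 / (4 * L + 4)), by positivity, ?_, ?_⟩
        · rw [mul_comm, ← le_div_iff₀ (by positivity)]
          exact min_le_left _ _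
        · rw [mul_comm, ← le_div_iff₀ (by positivity)]
          exact min_le_right _ _
      filter_upwards [eventually_isNearRegime hd hmean hδ] with n hn
      refine authe_mul_cmProb_near hH hn.even ?_ fun φ hφ => ?_
      · have h1 := hn.large
        have h2 : L ≤ Fintype.card (HalfEdge (d n)) := by
          have h3 : (0 : ℝ) ≤ Fintype.card (HalfEdge (d n)) := Nat.cast_nonneg _
          have hL0 : 0 ≤ L := Nat.cast_nonneg _
          nlinarith
        have h4 : 2 * k + 1 ≤ Fintype.card (HalfEdge (d n)) := by rw [hL] at h2; exact_mod_cast h2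
        omega
      · exact hnear _ _ _ (isNearRegime_compl_range nuParam_nonneg hnu hH hn hδ hδ1 hδ2 hφ))
  rw [hlim]
  refine (ha.div_const (H.authe : ℝ)).congr fun n => ?_
  exact mul_div_cancel_left₀ _ hauthe.ne'
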